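/- Let $d\ge 2$ and let $\alpha\in L^p(\mathbb R^{d-1})+L^\infty(\mathbb R^{d-1})$ be real-valued, where $1<p<\infty$ if $d=2$ and $d-1\le p<\infty$ if $d\ge 3$. For $\lambda<0$ let $\mathsf D_{\alpha,\lambda}$ be the self-adjoint operator in $L^2(\mathbb R^{d-1})$ (complex-valued functions) that represents the densely defined, closed, semibounded form $$\mathfrak d_{\alpha,\lambda}[\phi,\psi]=2\big((-\Delta-\lambda)^{1/4}\phi,(-\Delta-\lambda)^{1/4}\psi\big)_{L^2(\mathbb R^{d-1})}-\int_{\mathbb R^{d-1}}\alpha\,\phi\,\overline{\psi}\,dx,\qquad \operatorname{dom}\mathfrak d_{\alpha,\lambda}=H^{1/2}(\mathbb R^{d-1}),$$ that is, $\operatorname{dom}\mathsf D_{\alpha,\lambda}$ consists of all $\phi\in H^{1/2}(\mathbb R^{d-1})$ for which there is an $f\in L^2(\mathbb R^{d-1})$ with $\mathfrak d_{\alpha,\lambda}[\phi,\psi]=(f,\psi)_{L^2(\mathbb R^{d-1})}$ for all $\psi\in H^{1/2}(\mathbb R^{d-1})$, and then $\mathsf D_{\alpha,\lambda}\phi=f$.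 The essential spectrum of a self-adjoint operator is its spectrum without the isolated eigenvalues of finite multiplicity. Let $\mu_\alpha(\lambda)=\inf\sigma(\mathsf D_{\alpha,\lambda})$, which is a finite number. Assume that there is an $\alpha_0\in\mathbb R$ such that for every $\varepsilon>0$ the set $\{x\in\mathbb R^{d-1}:|\alpha(x)-\alpha_0|>\varepsilon\}$ has finite Lebesgue measure. Then for every $\lambda<0$ $$\sigma_{\mathrm{ess}}(\mathsf D_{\alpha,\lambda})=\big[2\sqrt{-\lambda}-\alpha_0,\infty\big),$$ and the map $\lambda\mapsto\mu_\alpha(\lambda)$ is strictly decreasing on $(-\infty,0)$. -/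

import Mathlib

open MeasureTheory
open scoped ENNReal FourierTransform InnerProductSpace SchwartzMap

namespace RelSchroedinger

/-! ### Spectrum and essential spectrum of an unbounded operator -/

section Spectrum

variable {H : Type*} [NormedAddCommGroup H] [InnerProductSpace ℂ H]

/-- The resolvent set of an unbounded operator `T`: all `z` for which `T - z` maps its domain
bijectively onto `H`, with a bounded inverse `R`. -/
def resolventSet (T : H →ₗ.[ℂ] H) : Set ℂ :=
  {z | ∃ R : H →L[ℂ] H, (∀ x : T.domain, R (T x - z • (x : H)) = x) ∧
    ∀ y : H, ∃ hy : R y ∈ T.domain, T ⟨R y, hy⟩ - z • R y = y}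

/-- The spectrum of an unbounded operator. -/
def spectrum (T : H →ₗ.[ℂ] H) : Set ℂ := (resolventSet T)ᶜ

/-- The kernel of `T - z`, as a subspace of the domain of `T`. -/
def eigenspace (T : H →ₗ.[ℂ] H) (z : ℂ) : Submodule ℂ T.domain :=
  LinearMap.ker (T.toFun - z • T.domain.subtype)

/-- The discrete spectrum: the eigenvalues of finite multiplicity that are isolated points of
the spectrum. -/
def discreteSpectrum (T : H →ₗ.[ℂ] H) : Set ℂ :=
  {z | z ∈ spectrum T ∧ (∃ ε > 0, spectrum T ∩ Metric.ball z ε = {z}) ∧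
    eigenspace T z ≠ ⊥ ∧ FiniteDimensional ℂ (eigenspace T z)}

/-- The essential spectrum (of a self-adjoint operator): the spectrum without the discrete
spectrum. -/
def essentialSpectrum (T : H →ₗ.[ℂ] H) : Set ℂ := spectrum T \ discreteSpectrum T

end Spectrum

/-! ### The Sobolev space of order one half and Bessel-type operators -/

/-- The Hilbert space of square integrable complex-valued functions on `ℝⁿ`. -/
abbrev L2 (n : ℕ) : Type := Lp ℂ 2 (volume : Measure (EuclideanSpace ℝ (Fin n)))

/-- The Sobolev space `H^{1/2}(ℝⁿ)`, as a subspace of `L²(ℝⁿ)`. -/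
def sobolevHalf (n : ℕ) : Submodule ℂ (L2 n) where
  carrier := {φ | TemperedDistribution.MemSobolev (1 / 2) 2
    (φ : 𝓢'(EuclideanSpace ℝ (Fin n), ℂ))}
  add_mem' {φ ψ} hφ hψ := by
    have h := hφ.add hψ
    simp only [← Lp.toTemperedDistributionCLM_apply, ← map_add] at h ⊢
    exact h
  zero_mem' := by
    simp only [Set.mem_ofPred_eq, ← Lp.toTemperedDistributionCLM_apply, map_zero]
    exact TemperedDistribution.memSobolev_fun_zero _ _ _ _
  smul_mem' c φ hφ := by
    have h := TemperedDistribution.MemSobolev.smul c hφ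
    simp only [← Lp.toTemperedDistributionCLM_apply, ← map_smul] at h ⊢
    exact h

/-- `φ ∈ H^{1/2}` if and only if `(1 + |k|²)^{1/4} 𝓕φ` is square integrable. -/
theorem mem_sobolevHalf_iff {n : ℕ} (φ : L2 n) :
    φ ∈ sobolevHalf n ↔
      MemLp (fun k ↦ (((1 + ‖k‖ ^ 2) ^ (1 / 4 : ℝ) : ℝ) : ℂ) * (𝓕 φ) k) 2 volume := by
  let E := EuclideanSpace ℝ (Fin n)
  let g : E → ℂ := fun k ↦ (((1 + ‖k‖ ^ 2) ^ (1 / 2 / 2 : ℝ) : ℝ) : ℂ)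
  let h : E → ℂ := fun k ↦ (((1 + ‖k‖ ^ 2) ^ (-(1 / 2) / 2 : ℝ) : ℝ) : ℂ)
  have hg : g.HasTemperateGrowth := by fun_prop
  have hh : h.HasTemperateGrowth := by fun_prop
  have hgh : ∀ k, g k * h k = 1 := by
    intro k
    simp only [g, h]
    rw [← Complex.ofReal_mul, ← Real.rpow_add (by positivity)]
    norm_num
  have hhtop : MemLp h ∞ (volume : Measure E) := by
    refine memLp_top_of_bound hh.1.continuous.aestronglyMeasurable 1 (Filter.Eventually.of_forall ?_)
    intro k
    simp only [h, Complex.norm_real, Real.norm_eq_abs]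
    rw [abs_of_nonneg (by positivity)]
    exact Real.rpow_le_one_of_one_le_of_nonpos (le_add_of_nonneg_right (sq_nonneg _))
      (by norm_num)
  have h4 : (1 / 2 / 2 : ℝ) = 1 / 4 := by norm_num
  change TemperedDistribution.MemSobolev (1 / 2) 2 (φ : 𝓢'(E, ℂ)) ↔ _
  rw [TemperedDistribution.memSobolev_iff_exists_smulLeftCLM_fourier,
    Lp.fourier_toTemperedDistribution_eq]
  have key : ∀ f : L2 n, TemperedDistribution.smulLeftCLM ℂ g ((𝓕 φ : L2 n) : 𝓢'(E, ℂ)) = f ↔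
      (𝓕 φ : L2 n) = (hhtop.toLp h • f : L2 n) := by
    intro f
    have inj : Function.Injective
        (Lp.toTemperedDistributionCLM ℂ (volume : Measure E) 2) :=
      LinearMap.ker_eq_bot.mp Lp.ker_toTemperedDistributionCLM_eq_bot
    have e := Lp.toTemperedDistribution_smul_eq (r := 2) hh hhtop f
    constructor
    · intro H
      apply inj
      rw [Lp.toTemperedDistributionCLM_apply, Lp.toTemperedDistributionCLM_apply, e, ← H,
        TemperedDistribution.smulLeftCLM_smulLeftCLM_apply hg hh]
      rw [show g * h = fun _ ↦ (1 : ℂ) from funext hgh]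
      simp
    · intro H
      rw [H, e, TemperedDistribution.smulLeftCLM_smulLeftCLM_apply hh hg,
        show h * g = fun _ ↦ (1 : ℂ) from funext fun k ↦ by rw [← hgh k]; exact mul_comm _ _]
      simp
  constructor
  · rintro ⟨f, hf⟩
    have hf := (key f).1 hf
    refine (Lp.memLp f).ae_eq ?_
    rw [hf]
    filter_upwards [Lp.coeFn_lpSMul (r := 2) (hhtop.toLp h) f, hhtop.coeFn_toLp] with k h1 h2
    rw [h1, Pi.smul_apply', h2, smul_eq_mul, ← mul_assoc]
    have := hgh k
    simp only [g, h4] at this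
    rw [this, one_mul]
  · intro hm
    refine ⟨hm.toLp _, (key _).2 ?_⟩
    apply Lp.ext
    filter_upwards [Lp.coeFn_lpSMul (r := 2) (hhtop.toLp h) (hm.toLp _), hhtop.coeFn_toLp,
      hm.coeFn_toLp] with k h1 h2 h3
    rw [h1, Pi.smul_apply', h2, h3, smul_eq_mul, ← mul_assoc]
    have := hgh k
    simp only [g, h4] at this
    rw [mul_comm (h k), this, one_mul]

/-- `H^{1/2}(ℝⁿ)` is dense in `L²(ℝⁿ)`: only `0` is orthogonal to it. -/
theorem eq_zero_of_orthogonal_sobolevHalf {n : ℕ} (f : L2 n)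
    (hf : ∀ ψ : sobolevHalf n, ⟪(ψ : L2 n), f⟫_ℂ = 0) : f = 0 := by
  have hd : DenseRange (SchwartzMap.toLpCLM ℝ ℂ 2
      (volume : Measure (EuclideanSpace ℝ (Fin n)))) :=
    SchwartzMap.denseRange_toLpCLM (by norm_num)
  refine hd.induction_on (p := fun g : L2 n ↦ ⟪g, f⟫_ℂ = 0) f ?_ ?_ |> inner_self_eq_zero.mp
  · exact isClosed_eq (by fun_prop) continuous_const
  · intro s
    refine hf ⟨s.toLp 2 volume, ?_⟩
    change TemperedDistribution.MemSobolev (1 / 2) 2 _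
    rw [Lp.toTemperedDistribution_toLp_eq]
    exact s.memSobolev

/-- The symbol `(|k|² - lam)^{1/4}` of `(-Δ - lam)^{1/4}`. The Fourier transform in use is
`(𝓕 φ) k = ∫ exp (-2πi x·k) φ x dx`, for which `-Δ` has the symbol `|2πk|²`. -/
noncomputable def quarterSymbol (n : ℕ) (lam : ℝ) (k : EuclideanSpace ℝ (Fin n)) : ℂ :=
  (((2 * Real.pi * ‖k‖) ^ 2 - lam) ^ (1 / 4 : ℝ) : ℝ)

theorem memLp_quarterSymbol_mul {n : ℕ} (lam : ℝ) (φ : sobolevHalf n) :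
    MemLp (fun k ↦ quarterSymbol n lam k * (𝓕 (φ : L2 n)) k) 2 volume := by
  have h := (mem_sobolevHalf_iff (φ : L2 n)).1 φ.2
  have hm : Measurable (quarterSymbol n lam) := by
    unfold quarterSymbol
    fun_prop
  refine MemLp.of_le_mul (c := ((2 * Real.pi) ^ 2 + |lam|) ^ (1 / 4 : ℝ)) h
    (hm.aestronglyMeasurable.mul (Lp.aestronglyMeasurable _)) (Filter.Eventually.of_forall ?_)
  intro k
  rw [norm_mul, norm_mul, ← mul_assoc]
  refine mul_le_mul_of_nonneg_right ?_ (norm_nonneg _)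
  simp only [quarterSymbol, Complex.norm_real, Real.norm_eq_abs]
  rw [abs_of_nonneg (a := (1 + ‖k‖ ^ 2) ^ (1 / 4 : ℝ)) (by positivity),
    ← Real.mul_rpow (by positivity) (by positivity)]
  refine (Real.abs_rpow_le_abs_rpow _ _).trans
    (Real.rpow_le_rpow (abs_nonneg _) ?_ (by norm_num))
  refine (abs_sub _ _).trans ?_
  rw [abs_of_nonneg (by positivity)]
  nlinarith [mul_nonneg (abs_nonneg lam) (sq_nonneg ‖k‖), sq_nonneg (2 * Real.pi),
    abs_nonneg lam]

/-- The operator `(-Δ - lam)^{1/4} : H^{1/2}(ℝⁿ) → L²(ℝⁿ)`, as a Fourier multiplier. -/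
noncomputable def quarterPower (n : ℕ) (lam : ℝ) : sobolevHalf n →ₗ[ℂ] L2 n where
  toFun φ := 𝓕⁻ ((memLp_quarterSymbol_mul lam φ).toLp _)
  map_add' φ ψ := by
    rw [← FourierTransform.fourierInv_add]
    congr 1
    apply Lp.ext
    have e : (𝓕 ((φ + ψ : sobolevHalf n) : L2 n) : L2 n) = 𝓕 (φ : L2 n) + 𝓕 (ψ : L2 n) := by
      rw [← FourierTransform.fourier_add]; rfl
    filter_upwards [(memLp_quarterSymbol_mul lam (φ + ψ)).coeFn_toLp,
      (memLp_quarterSymbol_mul lam φ).coeFn_toLp, (memLp_quarterSymbol_mul lam ψ).coeFn_toLp,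
      Lp.coeFn_add ((memLp_quarterSymbol_mul lam φ).toLp _)
        ((memLp_quarterSymbol_mul lam ψ).toLp _),
      Lp.coeFn_add (𝓕 (φ : L2 n) : L2 n) (𝓕 (ψ : L2 n))] with k h1 h2 h3 h4 h5
    rw [h1, h4, Pi.add_apply, h2, h3, e, h5, Pi.add_apply, mul_add]
  map_smul' c φ := by
    rw [RingHom.id_apply, ← FourierTransform.fourierInv_smul]
    congr 1
    apply Lp.ext
    have e : (𝓕 ((c • φ : sobolevHalf n) : L2 n) : L2 n) = c • 𝓕 (φ : L2 n) := by
      rw [← FourierTransform.fourier_smul]; rfl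
    filter_upwards [(memLp_quarterSymbol_mul lam (c • φ)).coeFn_toLp,
      (memLp_quarterSymbol_mul lam φ).coeFn_toLp,
      Lp.coeFn_smul c ((memLp_quarterSymbol_mul lam φ).toLp _),
      Lp.coeFn_smul c (𝓕 (φ : L2 n) : L2 n)] with k h1 h2 h3 h4
    rw [h1, h3, Pi.smul_apply, h2, e, h4, Pi.smul_apply, smul_eq_mul, smul_eq_mul]
    ring

/-! ### The relativistic Schrödinger operator -/

/-- The class `L^p(ℝⁿ) + L^∞(ℝⁿ)` of real-valued functions. -/
def MemLpAddLinfty {n : ℕ} (α : EuclideanSpace ℝ (Fin n) → ℝ) (p : ℝ≥0∞) : Prop :=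
  ∃ β γ : EuclideanSpace ℝ (Fin n) → ℝ, MemLp β p volume ∧ MemLp γ ∞ volume ∧ α = β + γ

/-- The form
`𝔡[φ, ψ] = 2 ((-Δ - lam)^{1/4} φ, (-Δ - lam)^{1/4} ψ) - ∫ α φ (conj ψ)` on `H^{1/2}(ℝⁿ)`, where
`(u, v) = ∫ u (conj v)` is linear in the first entry, so it is `⟪v, u⟫_ℂ`. -/
noncomputable def form {n : ℕ} (α : EuclideanSpace ℝ (Fin n) → ℝ) (lam : ℝ)
    (φ ψ : sobolevHalf n) : ℂ :=
  2 * ⟪quarterPower n lam ψ, quarterPower n lam φ⟫_ℂ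
    - ∫ x, (α x : ℂ) * (φ : L2 n) x * (starRingEnd ℂ) ((ψ : L2 n) x)

/-- The graph of the operator that represents the form: the pairs `(φ, f)` with `φ ∈ H^{1/2}` and
`𝔡[φ, ψ] = (f, ψ)` for all `ψ ∈ H^{1/2}`. The integral in the form is required to converge (for
the coefficients under consideration it always does). -/
noncomputable def operatorGraph {n : ℕ} (α : EuclideanSpace ℝ (Fin n) → ℝ) (lam : ℝ) :
    Submodule ℂ (L2 n × L2 n) where
  carrier := {q | ∃ φ : sobolevHalf n, (φ : L2 n) = q.1 ∧ ∀ ψ : sobolevHalf n,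
    Integrable (fun x ↦ (α x : ℂ) * (φ : L2 n) x * (starRingEnd ℂ) ((ψ : L2 n) x)) ∧
      form α lam φ ψ = ⟪(ψ : L2 n), q.2⟫_ℂ}
  add_mem' := by
    rintro ⟨u, f⟩ ⟨v, g⟩ ⟨φ, rfl, hφ⟩ ⟨χ, rfl, hχ⟩
    refine ⟨φ + χ, rfl, fun ψ ↦ ?_⟩
    obtain ⟨i1, e1⟩ := hφ ψ
    obtain ⟨i2, e2⟩ := hχ ψ
    have hae : (fun x ↦ (α x : ℂ) * ((φ + χ : sobolevHalf n) : L2 n) x *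
        (starRingEnd ℂ) ((ψ : L2 n) x)) =ᵐ[volume]
        (fun x ↦ (α x : ℂ) * (φ : L2 n) x * (starRingEnd ℂ) ((ψ : L2 n) x) +
          (α x : ℂ) * (χ : L2 n) x * (starRingEnd ℂ) ((ψ : L2 n) x)) := by
      filter_upwards [Lp.coeFn_add (φ : L2 n) (χ : L2 n)] with x hx
      rw [Submodule.coe_add, hx, Pi.add_apply]
      ring
    refine ⟨(i1.add i2).congr hae.symm, ?_⟩
    have e3 : form α lam (φ + χ) ψ = form α lam φ ψ + form α lam χ ψ := by
      unfold form
      rw [integral_congr_ae hae, integral_add i1 i2, map_add, inner_add_right]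
      ring
    rw [e3, e1, e2, Prod.mk_add_mk, inner_add_right]
  zero_mem' := by
    refine ⟨0, rfl, fun ψ ↦ ?_⟩
    have hae : (fun x ↦ (α x : ℂ) * ((0 : sobolevHalf n) : L2 n) x *
        (starRingEnd ℂ) ((ψ : L2 n) x)) =ᵐ[volume] fun _ ↦ 0 := by
      filter_upwards [Lp.coeFn_zero ℂ 2 (volume : Measure (EuclideanSpace ℝ (Fin n)))] with x hx
      rw [Submodule.coe_zero, hx]
      simp
    refine ⟨(integrable_zero _ _ _).congr hae.symm, ?_⟩
    unfold form
    rw [integral_congr_ae hae]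
    simp
  smul_mem' := by
    rintro c ⟨u, f⟩ ⟨φ, rfl, hφ⟩
    refine ⟨c • φ, rfl, fun ψ ↦ ?_⟩
    obtain ⟨i1, e1⟩ := hφ ψ
    have hae : (fun x ↦ (α x : ℂ) * ((c • φ : sobolevHalf n) : L2 n) x *
        (starRingEnd ℂ) ((ψ : L2 n) x)) =ᵐ[volume]
        (fun x ↦ c * ((α x : ℂ) * (φ : L2 n) x * (starRingEnd ℂ) ((ψ : L2 n) x))) := by
      filter_upwards [Lp.coeFn_smul c (φ : L2 n)] with x hx
      rw [Submodule.coe_smul, hx, Pi.smul_apply, smul_eq_mul]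
      ring
    refine ⟨(i1.const_mul c).congr hae.symm, ?_⟩
    have e3 : form α lam (c • φ) ψ = c * form α lam φ ψ := by
      unfold form
      rw [integral_congr_ae hae, integral_const_mul, map_smul, inner_smul_right]
      ring
    rw [e3, e1, Prod.smul_mk, inner_smul_right]

/-- The operator `D_{α,lam}` in `L²(ℝⁿ)` that represents the form. -/
noncomputable def relOperator {n : ℕ} (α : EuclideanSpace ℝ (Fin n) → ℝ) (lam : ℝ) :
    L2 n →ₗ.[ℂ] L2 n :=
  (operatorGraph α lam).toLinearPMap

/-- The representing element is unique, so that `relOperator` has the prescribed graph. -/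
theorem relOperator_graph {n : ℕ} (α : EuclideanSpace ℝ (Fin n) → ℝ) (lam : ℝ) :
    (relOperator α lam).graph = operatorGraph α lam := by
  refine Submodule.toLinearPMap_graph_eq _ ?_
  rintro ⟨u, f⟩ hq hu
  change u = 0 at hu
  subst hu
  obtain ⟨φ, h0, hφ⟩ := hq
  have hφ0 : φ = 0 := Subtype.ext h0
  subst hφ0
  refine eq_zero_of_orthogonal_sobolevHalf f fun ψ ↦ ?_
  obtain ⟨φ', h0', hφ'⟩ := (operatorGraph α lam).zero_mem
  have hφ0' : φ' = 0 := Subtype.ext h0'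
  subst hφ0'
  rw [← (hφ ψ).2, (hφ' ψ).2]
  exact inner_zero_right _

/-- The set of real points of the spectrum of `D_{α,lam}`. -/
def realSpectrum {n : ℕ} (α : EuclideanSpace ℝ (Fin n) → ℝ) (lam : ℝ) : Set ℝ :=
  {x | (x : ℂ) ∈ spectrum (relOperator α lam)}

/-- The bottom `μ_α(lam) = inf σ(D_{α,lam})` of the spectrum. -/
noncomputable def bottom {n : ℕ} (α : EuclideanSpace ℝ (Fin n) → ℝ) (lam : ℝ) : ℝ :=
  sInf (realSpectrum α lam)

end RelSchroedinger

/-! Put n = d - 1 and S = (-Δ - λ)^{-1/4}, a bounded symmetric bijection of L² onto H^{1/2}.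
Substituting φ = S u turns the form into ⟪v, A u⟫ with the bounded symmetric operator A = 2 - α₀ S²
- K, where K carries the potential V = α - α₀. The unbounded operator minus z becomes the bounded
pencil A - z S², and a real z is in the spectrum exactly when the pencil is not bounded below
(`mem_spectrum_ofReal`). `Represents` records this reduction, so that the spectral theory can be
done abstractly with bounded operators.

The analytic core is that K sends bounded weakly null sequences to norm null ones. Up to an error
that is small in L^p + L^∞, |V| is dominated by a bounded function supported in a set of finite
measure (`isVanishing_sub`). The L^p error is controlled by the Sobolev embedding of H^{1/2} into
L^{2p'} with Hölder's inequality (`exists_lintegral_mul_quarterInverse_sq_le`), the L^∞ error by the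
boundedness of S, and the remaining part by Rellich's theorem
(`tendsto_setLIntegral_quarterInverse`). The embedding and Rellich's theorem both rest on splitting
S u into low and high frequencies.

Adding K back leaves the Fourier multiplier A + K. Its pencil at E has the symbol 2 - (E + α₀) /
√(|2πk|² - λ), which is bounded below by a positive constant if E < 2√(-λ) - α₀ and has a zero
otherwise. A zero yields Weyl sequences, which survive subtracting K. Below the threshold,
approximate null vectors of the full pencil have convergent subsequences, so that only isolated
eigenvalues of finite multiplicity occur there. This is `essentialSpectrum_eq`.

For strict monotonicity, the form at a fixed φ ≠ 0 strictly decreases in λ. Let λ₁ < λ₂. If μ(λ₁)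
lies below the essential spectrum, its eigenfunction is a trial function at λ₂. Otherwise μ(λ₁) ≥
2√(-λ₁) - α₀ > 2√(-λ₂) - α₀ ≥ μ(λ₂). -/

namespace RelSchroedinger

/-! ### Operators represented by a form on the range of a bounded operator -/

section FormOperator

open Filter Topology

variable {H : Type*} [NormedAddCommGroup H] [InnerProductSpace ℂ H]

/-- The operator `T` represents the form `d[S u, S v] = ⟪v, A u⟫` with form domain the range of the
injective symmetric operator `S`, and this form is bounded below. -/
structure Represents (T : H →ₗ.[ℂ] H) (S A : H →L[ℂ] H) : Prop where
  symm_left : ∀ u v, ⟪S u, v⟫_ℂ = ⟪u, S v⟫_ℂ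
  symm_right : ∀ u v, ⟪A u, v⟫_ℂ = ⟪u, A v⟫_ℂ
  injective : Function.Injective S
  mem_graph : ∀ x y, (x, y) ∈ T.graph ↔ ∃ u, S u = x ∧ A u = S y
  coercive : ∃ C : ℝ, 0 ≤ C ∧ ∀ u, ‖u‖ ^ 2 ≤ (⟪u, A u⟫_ℂ).re + C * ‖S u‖ ^ 2

/-- The bounded operator `A - z S²`, which represents `T - z` between the form domain and its
dual. -/
noncomputable def pencil (S A : H →L[ℂ] H) (z : ℂ) : H →L[ℂ] H := A - z • (S ∘L S)

@[simp]
theorem pencil_apply (S A : H →L[ℂ] H) (z : ℂ) (u : H) : pencil S A z u = A u - z • S (S u) := rfl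

/-- A bounded operator that is bounded below, and whose formal adjoint is bounded below, is
invertible. -/
theorem isUnit_of_bounded_below [CompleteSpace H] {B B' : H →L[ℂ] H} {δ : ℝ} (hδ : 0 < δ)
    (hadj : ∀ u v, ⟪B u, v⟫_ℂ = ⟪u, B' v⟫_ℂ)
    (hB : ∀ u, δ * ‖u‖ ≤ ‖B u‖) (hB' : ∀ u, δ * ‖u‖ ≤ ‖B' u‖) : IsUnit B := by
  rw [ContinuousLinearMap.isUnit_iff_bijective]
  have hanti : AntilipschitzWith (Real.toNNReal δ⁻¹) B := by
    refine B.antilipschitz_of_bound fun u ↦ ?_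
    rw [Real.coe_toNNReal _ (by positivity), inv_mul_eq_div, le_div_iff₀ hδ, mul_comm]
    exact hB u
  refine ⟨hanti.injective, ?_⟩
  have hcl : IsClosed (Set.range B) := hanti.isClosed_range B.uniformContinuous
  have hcl' : IsClosed ((LinearMap.range (B : H →ₗ[ℂ] H) : Submodule ℂ H) : Set H) := by
    rw [LinearMap.coe_range]; exact hcl
  have : CompleteSpace (LinearMap.range (B : H →ₗ[ℂ] H)) := hcl'.completeSpace_coe
  -- The range is closed, and its orthogonal complement is the kernel of the formal adjoint, which
  -- is trivial by `hB'`.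
  have htop : LinearMap.range (B : H →ₗ[ℂ] H) = ⊤ := by
    rw [← Submodule.orthogonal_eq_bot_iff, Submodule.eq_bot_iff]
    intro v hv
    have h0 : B' v = 0 := by
      rw [← inner_self_eq_zero (𝕜 := ℂ), ← hadj]
      exact (Submodule.mem_orthogonal _ _).1 hv _ ⟨B' v, rfl⟩
    have h1 := hB' v
    rw [h0, norm_zero] at h1
    exact norm_eq_zero.1 (le_antisymm (nonpos_of_mul_nonpos_right h1 hδ) (norm_nonneg _))
  intro y
  have : y ∈ LinearMap.range (B : H →ₗ[ℂ] H) := htop ▸ Submodule.mem_top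
  exact this

namespace Represents

variable {T : H →ₗ.[ℂ] H} {S A : H →L[ℂ] H}

theorem inner_pencil (h : Represents T S A) (z : ℂ) (u v : H) :
    ⟪pencil S A z u, v⟫_ℂ = ⟪u, pencil S A (starRingEnd ℂ z) v⟫_ℂ := by
  simp only [pencil_apply, inner_sub_left, inner_sub_right, inner_smul_left, inner_smul_right]
  rw [h.symm_right, h.symm_left, h.symm_left]

theorem inner_self_pencil (h : Represents T S A) (z : ℂ) (u : H) :
    ⟪u, pencil S A z u⟫_ℂ = ⟪u, A u⟫_ℂ - z * (‖S u‖ ^ 2 : ℝ) := by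
  simp only [pencil_apply, inner_sub_right, inner_smul_right]
  rw [← h.symm_left u (S u), inner_self_eq_norm_sq_to_K]
  simp

theorem inner_form_im (h : Represents T S A) (u : H) : (⟪u, A u⟫_ℂ).im = 0 := by
  have h1 := h.symm_right u u
  rw [← inner_conj_symm] at h1
  exact Complex.conj_eq_iff_im.1 h1

/-- On vectors x = S u of the domain, S (T x - z x) is the pencil at u, so the resolvent is S B⁻¹ S,
where B is the pencil at z. -/
theorem mem_resolventSet (h : Represents T S A) {z : ℂ} (hz : IsUnit (pencil S A z)) :
    z ∈ resolventSet T := by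
  obtain ⟨b, hb⟩ := hz
  have h1 : ∀ u, (↑b⁻¹ : H →L[ℂ] H) (pencil S A z u) = u := fun u ↦ by
    rw [← hb, ← mul_apply_eq_comp, Units.inv_mul]; rfl
  have h2 : ∀ u, pencil S A z ((↑b⁻¹ : H →L[ℂ] H) u) = u := fun u ↦ by
    rw [← hb, ← mul_apply_eq_comp, Units.mul_inv]; rfl
  refine ⟨S ∘L (↑b⁻¹ : H →L[ℂ] H) ∘L S, fun x ↦ ?_, fun y ↦ ?_⟩
  · obtain ⟨u, hu, hAu⟩ := (h.mem_graph _ _).1 (T.mem_graph x)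
    have : S (T x - z • (x : H)) = pencil S A z u := by
      rw [map_sub, map_smul, ← hAu, ← hu, pencil_apply]
    rw [ContinuousLinearMap.comp_apply, ContinuousLinearMap.comp_apply, this, h1, hu]
  · set v := (↑b⁻¹ : H →L[ℂ] H) (S y) with hv
    have hBv := h2 (S y)
    rw [← hv, pencil_apply] at hBv
    have hg : (S v, y + z • S v) ∈ T.graph :=
      (h.mem_graph _ _).2 ⟨v, rfl, by rw [map_add, map_smul, ← hBv]; abel⟩
    obtain ⟨x, hx1, hx2⟩ := (LinearPMap.mem_graph_iff _).1 hg
    have hmem : S v ∈ T.domain := by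
      have := x.2
      rwa [hx1] at this
    refine ⟨hmem, ?_⟩
    have : x = ⟨S v, hmem⟩ := Subtype.ext hx1
    rw [this] at hx2
    change T ⟨S v, hmem⟩ - z • S v = y
    rw [hx2]
    simp

/-- `z` is in the resolvent set if the pencil is bounded below at `z` and at its conjugate. -/
theorem mem_resolventSet_of_bounded_below [CompleteSpace H] (h : Represents T S A) {z : ℂ} {δ : ℝ}
    (hδ : 0 < δ) (hz : ∀ u, δ * ‖u‖ ≤ ‖pencil S A z u‖)
    (hz' : ∀ u, δ * ‖u‖ ≤ ‖pencil S A (starRingEnd ℂ z) u‖) : z ∈ resolventSet T :=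
  h.mem_resolventSet (isUnit_of_bounded_below hδ (h.inner_pencil z) hz hz')

theorem re_inner_pencil (h : Represents T S A) (z : ℂ) (u : H) :
    (⟪u, pencil S A z u⟫_ℂ).re = (⟪u, A u⟫_ℂ).re - z.re * ‖S u‖ ^ 2 := by
  rw [h.inner_self_pencil, Complex.sub_re, Complex.re_mul_ofReal]

/-- The spectrum is real. -/
theorem mem_resolventSet_of_im_ne_zero [CompleteSpace H] (h : Represents T S A) {z : ℂ}
    (hz : z.im ≠ 0) : z ∈ resolventSet T := by
  obtain ⟨C, hC0, hC⟩ := h.coercive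
  -- The imaginary part of ⟪u, B u⟫ controls ‖S u‖², and coercivity then controls ‖u‖². The bound is
  -- stated for all w with the same real part and the same |im|, so that it covers both z and its
  -- conjugate.
  have key : ∀ w : ℂ, |w.im| = |z.im| → w.re = z.re → ∀ u,
      (1 + |C + z.re| / |z.im|)⁻¹ * ‖u‖ ≤ ‖pencil S A w u‖ := by
    intro w hw1 hw2 u
    have him : (⟪u, pencil S A w u⟫_ℂ).im = - (w.im * ‖S u‖ ^ 2) := by
      rw [h.inner_self_pencil, Complex.sub_im, h.inner_form_im, Complex.im_mul_ofReal]
      ring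
    have hre := h.re_inner_pencil w u
    have hn : ‖⟪u, pencil S A w u⟫_ℂ‖ ≤ ‖u‖ * ‖pencil S A w u‖ := norm_inner_le_norm _ _
    have h1 : |z.im| * ‖S u‖ ^ 2 ≤ ‖u‖ * ‖pencil S A w u‖ := by
      have := (Complex.abs_im_le_norm _).trans hn
      rw [him, abs_neg, abs_mul, hw1, abs_of_nonneg (sq_nonneg ‖S u‖)] at this
      exact this
    have h2 := (Complex.re_le_norm _).trans hn
    have hz' : 0 < |z.im| := abs_pos.2 hz
    have h3 : ‖u‖ ^ 2 ≤ (1 + |C + z.re| / |z.im|) * (‖u‖ * ‖pencil S A w u‖) := by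
      have h4 : (C + z.re) * ‖S u‖ ^ 2 ≤ |C + z.re| / |z.im| * (‖u‖ * ‖pencil S A w u‖) := by
        calc (C + z.re) * ‖S u‖ ^ 2 ≤ |C + z.re| * ‖S u‖ ^ 2 := by
              gcongr; exact le_abs_self _
          _ = |C + z.re| / |z.im| * (|z.im| * ‖S u‖ ^ 2) := by field_simp
          _ ≤ _ := by gcongr
      have := hC u
      rw [hw2] at hre
      linarith
    rcases eq_or_ne u 0 with rfl | hu
    · simp
    have hu' : 0 < ‖u‖ := norm_pos_iff.2 hu
    rw [inv_mul_le_iff₀ (by positivity)]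
    refine le_of_mul_le_mul_left ?_ hu'
    linarith
  refine h.mem_resolventSet_of_bounded_below (δ := (1 + |C + z.re| / |z.im|)⁻¹) (by positivity)
    (key z rfl rfl) (key _ (by simp) (by simp))

theorem im_eq_zero [CompleteSpace H] (h : Represents T S A) {z : ℂ} (hz : z ∈ spectrum T) :
    z.im = 0 := by
  by_contra hne
  exact hz (h.mem_resolventSet_of_im_ne_zero hne)

/-- For real E the pencil B is symmetric, so a lower bound alone makes it invertible. Conversely, a
bounded resolvent R controls ‖S u‖ by ‖B u‖ through duality, and coercivity upgrades this to a lower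
bound on B. -/
theorem mem_spectrum_ofReal [CompleteSpace H] (h : Represents T S A) {E : ℝ} :
    (E : ℂ) ∈ spectrum T ↔ ∀ δ > 0, ∃ u, ‖pencil S A E u‖ < δ * ‖u‖ := by
  constructor
  · intro hE δ hδ
    by_contra! hcon
    exact hE (h.mem_resolventSet_of_bounded_below hδ hcon (by simpa using hcon))
  · rintro hE ⟨R, hR1, hR2⟩
    obtain ⟨C, hC0, hC⟩ := h.coercive
    set a := 1 + |C + E| * ‖S‖
    have ha : 1 ≤ a := le_add_of_nonneg_right (by positivity)
    have hb : ∀ u, ‖u‖ ≤ ‖pencil S A E u‖ + |C + E| * ‖S‖ * ‖S u‖ := by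
      intro u
      rcases eq_or_ne u 0 with rfl | hu
      · simp
      refine le_of_mul_le_mul_left ?_ (norm_pos_iff.2 hu)
      have h1 := hC u
      have h2 := h.re_inner_pencil E u
      rw [Complex.ofReal_re] at h2
      have h3 : (⟪u, pencil S A E u⟫_ℂ).re ≤ ‖u‖ * ‖pencil S A E u‖ :=
        (Complex.re_le_norm _).trans (norm_inner_le_norm _ _)
      have h4 : (C + E) * ‖S u‖ ^ 2 ≤ ‖u‖ * (|C + E| * ‖S‖ * ‖S u‖) :=
        calc (C + E) * ‖S u‖ ^ 2 ≤ |C + E| * ‖S u‖ ^ 2 := by gcongr; exact le_abs_self _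
          _ = |C + E| * ‖S u‖ * ‖S u‖ := by ring
          _ ≤ |C + E| * ‖S u‖ * (‖S‖ * ‖u‖) := by gcongr; exact S.le_opNorm u
          _ = _ := by ring
      linarith
    -- R f lies in the operator domain, hence in the range of S. Its preimage v solves the equation
    -- at the level of the form.
    have hv : ∀ f, ∃ v, S v = R f ∧ pencil S A E v = S f := by
      intro f
      obtain ⟨hy, hTy⟩ := hR2 f
      obtain ⟨v, hv1, hv2⟩ := (h.mem_graph _ _).1 (T.mem_graph ⟨R f, hy⟩)
      refine ⟨v, hv1, ?_⟩
      rw [pencil_apply, hv2, hv1, ← map_smul, ← map_sub, hTy]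
    set b := ‖S‖ + |C + E| * ‖S‖ * ‖R‖
    have hb0 : 0 ≤ b := by positivity
    have hS : ∀ u, ‖S u‖ ≤ b * ‖pencil S A E u‖ := by
      intro u
      rcases eq_or_ne (S u) 0 with h0 | h0
      · rw [h0, norm_zero]; positivity
      obtain ⟨v, hv1, hv2⟩ := hv (S u)
      refine le_of_mul_le_mul_right ?_ (norm_pos_iff.2 h0)
      have hvn : ‖v‖ ≤ b * ‖S u‖ := by
        have := hb v
        rw [hv1, hv2] at this
        refine this.trans ?_
        calc _ ≤ ‖S‖ * ‖S u‖ + |C + E| * ‖S‖ * (‖R‖ * ‖S u‖) := by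
              gcongr
              · exact S.le_opNorm _
              · exact R.le_opNorm _
          _ = _ := by ring
      -- Testing B u against the solution v of B v = S (S u) produces ‖S u‖², while ‖v‖ is at most a
      -- multiple of ‖S u‖.
      have e : ⟪pencil S A E u, v⟫_ℂ = ⟪S u, S u⟫_ℂ := by
        rw [h.inner_pencil, Complex.conj_ofReal, hv2, ← h.symm_left]
      have : ‖S u‖ * ‖S u‖ = ‖⟪pencil S A E u, v⟫_ℂ‖ := by
        rw [e, inner_self_eq_norm_sq_to_K]; simp [sq]
      rw [this]
      calc _ ≤ ‖pencil S A E u‖ * ‖v‖ := norm_inner_le_norm _ _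
        _ ≤ ‖pencil S A E u‖ * (b * ‖S u‖) := by gcongr
        _ = _ := by ring
    set M := 1 + |C + E| * ‖S‖ * b
    have hM : 0 < M := by positivity
    obtain ⟨u, hu⟩ := hE M⁻¹ (by positivity)
    have h1 : ‖u‖ ≤ M * ‖pencil S A E u‖ := by
      refine (hb u).trans ?_
      calc _ ≤ ‖pencil S A E u‖ + |C + E| * ‖S‖ * (b * ‖pencil S A E u‖) := by
            gcongr; exact hS u
        _ = _ := by ring
    rw [lt_inv_mul_iff₀ hM] at hu
    linarith

/-- An element of the spectrum has normalized approximate null vectors of the pencil. -/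
theorem exists_seq_of_mem_spectrum [CompleteSpace H] (h : Represents T S A) {E : ℝ}
    (hE : (E : ℂ) ∈ spectrum T) :
    ∃ u : ℕ → H, (∀ j, ‖u j‖ = 1) ∧ Tendsto (fun j ↦ pencil S A E (u j)) atTop (𝓝 0) := by
  have := h.mem_spectrum_ofReal.1 hE
  choose v hv using fun j : ℕ ↦ this (1 / ((j : ℝ) + 1)) Nat.one_div_pos_of_nat
  have hv0 : ∀ j, ‖v j‖ ≠ 0 := by
    intro j hj
    have := hv j
    rw [hj, mul_zero] at this
    exact absurd this (norm_nonneg _).not_gt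
  refine ⟨fun j ↦ ((‖v j‖ : ℂ)⁻¹) • v j, fun j ↦ ?_, ?_⟩
  · rw [norm_smul, norm_inv, Complex.norm_real, norm_norm, inv_mul_cancel₀ (hv0 j)]
  · refine squeeze_zero_norm (fun j ↦ ?_) (tendsto_one_div_add_atTop_nhds_zero_nat (𝕜 := ℝ))
    have hpos : 0 < ‖v j‖ := lt_of_le_of_ne (norm_nonneg _) (hv0 j).symm
    rw [map_smul, norm_smul, norm_inv, Complex.norm_real, norm_norm, inv_mul_le_iff₀ hpos, mul_comm]
    exact (hv j).le

theorem mem_spectrum_of_seq [CompleteSpace H] (h : Represents T S A) {E : ℝ} {u : ℕ → H}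
    (hu : ∀ j, ‖u j‖ = 1) (hE : Tendsto (fun j ↦ pencil S A E (u j)) atTop (𝓝 0)) :
    (E : ℂ) ∈ spectrum T := by
  refine h.mem_spectrum_ofReal.2 fun δ hδ ↦ ?_
  obtain ⟨j, hj⟩ := ((tendsto_zero_iff_norm_tendsto_zero.1 hE).eventually_lt_const hδ).exists
  exact ⟨u j, by rwa [hu j, mul_one]⟩

end Represents

end FormOperator

/-! ### Bottom of the spectrum and Weyl's theorem for compact perturbations of the form. -/

section CompactPerturbation

open Filter Topology

variable {H : Type*} [NormedAddCommGroup H] [InnerProductSpace ℂ H]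

namespace Represents

variable {T : H →ₗ.[ℂ] H} {S A : H →L[ℂ] H}

/-- The Cauchy-Schwarz inequality for a nonnegative pencil. -/
theorem norm_pencil_sq_le (h : Represents T S A) {E : ℝ}
    (hE : ∀ u, E * ‖S u‖ ^ 2 ≤ (⟪u, A u⟫_ℂ).re) (u : H) :
    ‖pencil S A E u‖ ^ 2 ≤ (‖pencil S A E‖ + 1) * (⟪u, pencil S A E u⟫_ℂ).re := by
  set B := pencil S A E with hB
  -- Nonnegativity of the form is tested on u - N⁻¹ B u. The summand 1 keeps N positive when B = 0.
  set N := ‖B‖ + 1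
  have hN : 0 < N := by positivity
  have hpos : ∀ w, 0 ≤ (⟪w, B w⟫_ℂ).re := fun w ↦ by
    rw [hB, h.re_inner_pencil, Complex.ofReal_re, sub_nonneg]
    exact hE w
  have h1 := hpos (u - ((N⁻¹ : ℝ) : ℂ) • B u)
  have hsymm : ⟪u, B (B u)⟫_ℂ = ⟪B u, B u⟫_ℂ := by
    rw [hB, h.inner_pencil, Complex.conj_ofReal]
  have hself : (⟪B u, B u⟫_ℂ).re = ‖B u‖ ^ 2 := inner_self_eq_norm_sq (𝕜 := ℂ) (B u)
  have h2 : (⟪B u, B (B u)⟫_ℂ).re ≤ N * ‖B u‖ ^ 2 := by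
    refine ((Complex.re_le_norm _).trans (norm_inner_le_norm _ _)).trans ?_
    calc ‖B u‖ * ‖B (B u)‖ ≤ ‖B u‖ * (‖B‖ * ‖B u‖) := by gcongr; exact B.le_opNorm _
      _ ≤ ‖B u‖ * (N * ‖B u‖) := by gcongr; exact (lt_add_one _).le
      _ = _ := by ring
  have h3 : (⟪u - ((N⁻¹ : ℝ) : ℂ) • B u, B (u - ((N⁻¹ : ℝ) : ℂ) • B u)⟫_ℂ).re =
      (⟪u, B u⟫_ℂ).re - 2 * N⁻¹ * ‖B u‖ ^ 2 + N⁻¹ * (N⁻¹ * (⟪B u, B (B u)⟫_ℂ).re) := by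
    rw [map_sub, map_smul]
    simp only [inner_sub_left, inner_sub_right, inner_smul_left, inner_smul_right,
      Complex.conj_ofReal, Complex.sub_re, Complex.re_ofReal_mul, hsymm, hself]
    ring
  rw [h3] at h1
  have h4 : N⁻¹ * (N⁻¹ * (⟪B u, B (B u)⟫_ℂ).re) ≤ N⁻¹ * ‖B u‖ ^ 2 := by
    gcongr
    rw [inv_mul_le_iff₀ hN]
    exact h2
  have h5 : N⁻¹ * ‖B u‖ ^ 2 ≤ (⟪u, B u⟫_ℂ).re := by linarith
  rwa [inv_mul_le_iff₀ hN] at h5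

/-- The spectrum has a least element, which is a lower bound of the form. -/
theorem exists_isLeast_spectrum [CompleteSpace H] [Nontrivial H] (h : Represents T S A) :
    ∃ E : ℝ, IsLeast {x : ℝ | (x : ℂ) ∈ spectrum T} E ∧
      ∀ u, E * ‖S u‖ ^ 2 ≤ (⟪u, A u⟫_ℂ).re := by
  obtain ⟨C, hC0, hC⟩ := h.coercive
  -- G is the set of lower bounds of the form. Its supremum is the least spectral point: were the
  -- pencil bounded below there, Cauchy-Schwarz would make its form coercive and leave room for a
  -- larger element of G.
  set G : Set ℝ := {E | ∀ u, E * ‖S u‖ ^ 2 ≤ (⟪u, A u⟫_ℂ).re} with hG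
  have hGne : -C ∈ G := fun u ↦ by nlinarith [hC u, sq_nonneg ‖u‖]
  have hpos : ∀ u, u ≠ 0 → 0 < ‖S u‖ ^ 2 := fun u hu ↦ by
    have : S u ≠ 0 := fun h0 ↦ hu (h.injective (by simpa using h0))
    positivity
  have hle : ∀ E ∈ G, ∀ u, u ≠ 0 → E ≤ (⟪u, A u⟫_ℂ).re / ‖S u‖ ^ 2 := fun E hE u hu ↦ by
    rw [le_div_iff₀ (hpos u hu)]
    exact hE u
  have hbdd : BddAbove G := by
    obtain ⟨u, hu⟩ := exists_ne (0 : H)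
    exact ⟨_, fun E hE ↦ hle E hE u hu⟩
  have hmem : sSup G ∈ G := by
    intro u
    rcases eq_or_ne u 0 with rfl | hu
    · simp
    rw [← le_div_iff₀ (hpos u hu)]
    exact csSup_le ⟨_, hGne⟩ fun E hE ↦ hle E hE u hu
  refine ⟨sSup G, ⟨?_, ?_⟩, hmem⟩
  · by_contra hcon
    change ¬ ((sSup G : ℝ) : ℂ) ∈ spectrum T at hcon
    rw [h.mem_spectrum_ofReal] at hcon
    push Not at hcon
    obtain ⟨δ, hδ, hB⟩ := hcon
    set N := ‖pencil S A ((sSup G : ℝ) : ℂ)‖ + 1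
    have hN : 0 < N := by positivity
    set η := δ ^ 2 / N / (‖S‖ ^ 2 + 1)
    have hη : 0 < η := by positivity
    have : sSup G + η ∈ G := by
      intro u
      have h1 := h.norm_pencil_sq_le hmem u
      rw [h.re_inner_pencil, Complex.ofReal_re] at h1
      have h2 : (δ * ‖u‖) ^ 2 ≤ ‖pencil S A ((sSup G : ℝ) : ℂ) u‖ ^ 2 := by
        gcongr; exact hB u
      have h3 : η * ‖S u‖ ^ 2 ≤ (δ * ‖u‖) ^ 2 / N := by
        calc η * ‖S u‖ ^ 2 ≤ η * (‖S‖ * ‖u‖) ^ 2 := by gcongr; exact S.le_opNorm u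
          _ = η * ‖S‖ ^ 2 * ‖u‖ ^ 2 := by ring
          _ ≤ η * (‖S‖ ^ 2 + 1) * ‖u‖ ^ 2 := by gcongr; exact (lt_add_one _).le
          _ = δ ^ 2 / N * ‖u‖ ^ 2 := by
              rw [div_mul_cancel₀ _ (by positivity)]
          _ = _ := by ring
      have h4 : (δ * ‖u‖) ^ 2 / N ≤ (⟪u, A u⟫_ℂ).re - sSup G * ‖S u‖ ^ 2 := by
        rw [div_le_iff₀' hN]; exact h2.trans h1
      linarith
    linarith [le_csSup hbdd this]
  · intro E hE
    change (E : ℂ) ∈ spectrum T at hE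
    -- If E < sup G, the form minus E dominates (sup G - E) ‖S u‖². Together with coercivity this
    -- bounds the pencil below, so E is not in the spectrum.
    by_contra! hlt
    have hd : 0 < sSup G - E := sub_pos.2 hlt
    set M := 1 + |C + E| / (sSup G - E)
    have hM : 0 < M := by positivity
    obtain ⟨u, hu⟩ := h.mem_spectrum_ofReal.1 hE M⁻¹ (by positivity)
    have h1 := h.re_inner_pencil E u
    rw [Complex.ofReal_re] at h1
    have h2 := hmem u
    have h3 : ‖S u‖ ^ 2 ≤ (⟪u, pencil S A E u⟫_ℂ).re / (sSup G - E) := by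
      rw [le_div_iff₀ hd]; linarith
    have h4 : (C + E) * ‖S u‖ ^ 2 ≤ |C + E| * ((⟪u, pencil S A E u⟫_ℂ).re / (sSup G - E)) :=
      (mul_le_mul_of_nonneg_right (le_abs_self _) (sq_nonneg _)).trans
        (mul_le_mul_of_nonneg_left h3 (abs_nonneg _))
    have h5 : ‖u‖ ^ 2 ≤ M * (⟪u, pencil S A E u⟫_ℂ).re := by
      have := hC u
      have e : M * (⟪u, pencil S A E u⟫_ℂ).re = (⟪u, pencil S A E u⟫_ℂ).re +
        |C + E| * ((⟪u, pencil S A E u⟫_ℂ).re / (sSup G - E)) := by ring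
      rw [e]
      linarith
    have h6 : (⟪u, pencil S A E u⟫_ℂ).re ≤ ‖u‖ * ‖pencil S A E u‖ :=
      (Complex.re_le_norm _).trans (norm_inner_le_norm _ _)
    rw [lt_inv_mul_iff₀ hM] at hu
    have h7 : 0 < ‖u‖ := lt_of_le_of_lt (by positivity) hu
    nlinarith

end Represents

variable [CompleteSpace H]

/-- A bounded sequence in a separable Hilbert space has a weakly convergent subsequence. -/
theorem exists_weak_limit [TopologicalSpace.SeparableSpace H] {u : ℕ → H} {C : ℝ}
    (hu : ∀ j, ‖u j‖ ≤ C) :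
    ∃ (v : H) (φ : ℕ → ℕ), StrictMono φ ∧
      ∀ w, Tendsto (fun j ↦ ⟪w, u (φ j)⟫_ℂ) atTop (𝓝 ⟪w, v⟫_ℂ) := by
  -- Sequential Banach-Alaoglu applies in the dual. Moving back by Riesz conjugates the pairings.
  let D := InnerProductSpace.toDual ℂ H
  let F : ℕ → WeakDual ℂ H := fun j ↦ WeakDual.toStrongDual.symm (D (u j))
  obtain ⟨f, -, φ, hφ, hlim⟩ := WeakDual.isSeqCompact_closedBall ℂ H 0 C (x := F) fun j ↦ by
    simp [F, D, hu j]
  refine ⟨D.symm (WeakDual.toStrongDual f), φ, hφ, fun w ↦ ?_⟩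
  have h1 := (WeakBilin.tendsto_iff_forall_eval_tendsto _
    (ContinuousLinearMap.coe_injective)).1 hlim w
  have h2 := (Complex.continuous_conj.tendsto _).comp h1
  have e1 : ⟪w, D.symm (WeakDual.toStrongDual f)⟫_ℂ = starRingEnd ℂ (f w) := by
    rw [← inner_conj_symm, InnerProductSpace.toDual_symm_apply]
    rfl
  rw [e1]
  refine h2.congr fun j ↦ ?_
  rw [← inner_conj_symm w]
  rfl

/-- The operator maps bounded weakly null sequences to norm null sequences. -/
def IsWeakStrongContinuous (K : H →L[ℂ] H) : Prop :=
  ∀ (u : ℕ → H) (C : ℝ), (∀ j, ‖u j‖ ≤ C) →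
    (∀ w, Tendsto (fun j ↦ ⟪w, u j⟫_ℂ) atTop (𝓝 0)) → Tendsto (fun j ↦ K (u j)) atTop (𝓝 0)

namespace Represents

variable {T : H →ₗ.[ℂ] H} {S A K : H →L[ℂ] H} {m : ℝ}

/-- Below the bottom `m` of the unperturbed form, bounded approximate null vectors of the pencil
have a convergent subsequence. -/
theorem exists_tendsto_of_pencil [TopologicalSpace.SeparableSpace H] (h : Represents T S A)
    (hK : IsWeakStrongContinuous K)
    (hm : ∀ E < m, ∃ δ > 0, ∀ u, δ * ‖u‖ ^ 2 ≤ (⟪u, A u + K u⟫_ℂ).re - E * ‖S u‖ ^ 2)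
    {E : ℝ} (hE : E < m) {u : ℕ → H} {C : ℝ} (hu : ∀ j, ‖u j‖ ≤ C)
    (hB : Tendsto (fun j ↦ pencil S A E (u j)) atTop (𝓝 0)) :
    ∃ (v : H) (φ : ℕ → ℕ), StrictMono φ ∧ Tendsto (fun j ↦ u (φ j)) atTop (𝓝 v) := by
  obtain ⟨v, φ, hφ, hv⟩ := exists_weak_limit hu
  refine ⟨v, φ, hφ, ?_⟩
  obtain ⟨δ, hδ, hδ'⟩ := hm E hE
  have hBφ := hB.comp hφ.tendsto_atTop
  -- The pencil is symmetric, hence weakly continuous, so the weak limit is an exact null vector and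
  -- can be subtracted from the sequence.
  have hBv : pencil S A E v = 0 := by
    refine ext_inner_left ℂ fun w ↦ ?_
    rw [inner_zero_right]
    have h1 := hv (pencil S A E w)
    have h2 : Tendsto (fun j ↦ ⟪w, pencil S A E (u (φ j))⟫_ℂ) atTop (𝓝 ⟪w, (0 : H)⟫_ℂ) :=
      ((continuous_const.inner continuous_id).tendsto (0 : H)).comp hBφ
    simp only [h.inner_pencil, Complex.conj_ofReal] at h1
    rw [inner_zero_right] at h2
    exact tendsto_nhds_unique h1 h2
  set d : ℕ → H := fun j ↦ u (φ j) - v with hd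
  have hdb : ∀ j, ‖d j‖ ≤ C + ‖v‖ := fun j ↦
    (norm_sub_le _ _).trans (add_le_add_left (hu _) _)
  have hdw : ∀ w, Tendsto (fun j ↦ ⟪w, d j⟫_ℂ) atTop (𝓝 0) := fun w ↦ by
    simpa [d, inner_sub_right] using (hv w).sub_const ⟪w, v⟫_ℂ
  have hdK := hK d _ hdb hdw
  have hdB : Tendsto (fun j ↦ pencil S A E (d j)) atTop (𝓝 0) := by
    refine hBφ.congr fun j ↦ ?_
    change pencil S A E (u (φ j)) = pencil S A E (u (φ j) - v)
    rw [map_sub, hBv, sub_zero]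
  have hsum : Tendsto (fun j ↦ ‖pencil S A E (d j) + K (d j)‖) atTop (𝓝 0) := by
    simpa using (hdB.add hdK).norm
  -- Coercivity of A + K - E S² applied to the weakly null differences turns weak convergence into
  -- norm convergence.
  have hbound : ∀ j, ‖d j‖ ^ 2 ≤ δ⁻¹ * ((C + ‖v‖) * ‖pencil S A E (d j) + K (d j)‖) := fun j ↦ by
    rw [le_inv_mul_iff₀ hδ]
    refine (hδ' (d j)).trans ?_
    have e : (⟪d j, A (d j) + K (d j)⟫_ℂ).re - E * ‖S (d j)‖ ^ 2 =
        (⟪d j, pencil S A E (d j) + K (d j)⟫_ℂ).re := by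
      have := h.re_inner_pencil E (d j)
      rw [Complex.ofReal_re] at this
      rw [inner_add_right, inner_add_right, Complex.add_re, Complex.add_re, this]
      ring
    rw [e]
    refine ((Complex.re_le_norm _).trans (norm_inner_le_norm _ _)).trans ?_
    gcongr
    exact hdb j
  have hsq : Tendsto (fun j ↦ ‖d j‖ ^ 2) atTop (𝓝 0) :=
    squeeze_zero (fun j ↦ sq_nonneg _) hbound (by simpa using (hsum.const_mul _).const_mul δ⁻¹)
  have hd0 : Tendsto (fun j ↦ ‖d j‖) atTop (𝓝 0) := by
    have := hsq.sqrt
    simpa [Real.sqrt_sq (norm_nonneg _)] using this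
  rw [tendsto_iff_norm_sub_tendsto_zero]
  exact hd0

/-- The norm limit of normalized approximate null vectors is normalized and lies in the kernel. -/
theorem exists_ne_zero_of_mem_spectrum [TopologicalSpace.SeparableSpace H] (h : Represents T S A)
    (hK : IsWeakStrongContinuous K)
    (hm : ∀ E < m, ∃ δ > 0, ∀ u, δ * ‖u‖ ^ 2 ≤ (⟪u, A u + K u⟫_ℂ).re - E * ‖S u‖ ^ 2)
    {E : ℝ} (hE : E < m) (hs : (E : ℂ) ∈ spectrum T) :
    ∃ u, ‖u‖ = 1 ∧ pencil S A E u = 0 := by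
  obtain ⟨u, hu, hB⟩ := h.exists_seq_of_mem_spectrum hs
  obtain ⟨v, φ, hφ, hv⟩ := h.exists_tendsto_of_pencil hK hm hE (fun j ↦ (hu j).le) hB
  refine ⟨v, ?_, ?_⟩
  · refine tendsto_nhds_unique hv.norm ?_
    simp only [hu]
    exact tendsto_const_nhds
  · exact tendsto_nhds_unique (((pencil S A E).continuous.tendsto v).comp hv)
      (hB.comp hφ.tendsto_atTop)

/-- Below `m`, each point of the spectrum is isolated. -/
theorem exists_isolated [TopologicalSpace.SeparableSpace H] (h : Represents T S A)
    (hK : IsWeakStrongContinuous K)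
    (hm : ∀ E < m, ∃ δ > 0, ∀ u, δ * ‖u‖ ^ 2 ≤ (⟪u, A u + K u⟫_ℂ).re - E * ‖S u‖ ^ 2)
    {E : ℝ} (hE : E < m) (hs : (E : ℂ) ∈ spectrum T) :
    ∃ ε > 0, spectrum T ∩ Metric.ball (E : ℂ) ε = {(E : ℂ)} := by
  by_contra! hcon
  have hseq : ∀ j : ℕ, ∃ x : ℝ, x ≠ E ∧ (x : ℂ) ∈ spectrum T ∧
      |x - E| < min (m - E) (1 / ((j : ℝ) + 1)) := by
    intro j
    have hr : 0 < min (m - E) (1 / ((j : ℝ) + 1)) := lt_min (sub_pos.2 hE) Nat.one_div_pos_of_nat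
    by_contra! hno
    refine hcon _ hr (Set.Subset.antisymm ?_ ?_)
    · rintro z ⟨hz, hzb⟩
      have hz' : z = (z.re : ℂ) := Complex.ext rfl (by simp [h.im_eq_zero hz])
      rw [hz'] at hz hzb ⊢
      rw [Metric.mem_ball, Complex.dist_eq, ← Complex.ofReal_sub, Complex.norm_real,
        Real.norm_eq_abs] at hzb
      by_contra hne
      have hne' : z.re ≠ E := fun e ↦ hne (by rw [e]; rfl)
      exact absurd hzb (hno _ hne' hz).not_gt
    · rintro _ rfl
      exact ⟨hs, Metric.mem_ball_self hr⟩
  choose x hx1 hx2 hx3 using hseq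
  have hxm : ∀ j, x j < m := fun j ↦ by
    have := (le_abs_self _).trans_lt ((hx3 j).trans_le (min_le_left _ _))
    linarith
  choose u hu1 hu2 using fun j ↦ h.exists_ne_zero_of_mem_spectrum hK hm (hxm j) (hx2 j)
  have hxlim : Tendsto (fun j ↦ x j - E) atTop (𝓝 0) :=
    squeeze_zero_norm (fun j ↦ ((hx3 j).trans_le (min_le_right _ _)).le)
      (tendsto_one_div_add_atTop_nhds_zero_nat (𝕜 := ℝ))
  -- Eigenvectors for the nearby spectral points x j → E are approximate null vectors of the pencil
  -- at E.
  have hdiff : ∀ j, pencil S A E (u j) = ((x j - E : ℝ) : ℂ) • S (S (u j)) := fun j ↦ by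
    have := hu2 j
    rw [pencil_apply, sub_eq_zero] at this
    rw [pencil_apply, this, ← sub_smul, Complex.ofReal_sub]
  have hB : Tendsto (fun j ↦ pencil S A E (u j)) atTop (𝓝 0) := by
    refine squeeze_zero_norm (a := fun j ↦ |x j - E| * (‖S‖ * ‖S‖)) (fun j ↦ ?_) ?_
    · rw [hdiff, norm_smul, Complex.norm_real, Real.norm_eq_abs]
      gcongr
      refine (S.le_opNorm _).trans ?_
      gcongr
      simpa [hu1 j] using S.le_opNorm (u j)
    · simpa using hxlim.abs.mul_const (‖S‖ * ‖S‖)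
  obtain ⟨v, φ, hφ, hv⟩ := h.exists_tendsto_of_pencil hK hm hE (fun j ↦ (hu1 j).le) hB
  have hBv : pencil S A E v = 0 :=
    tendsto_nhds_unique (((pencil S A E).continuous.tendsto v).comp hv) (hB.comp hφ.tendsto_atTop)
  -- Eigenvectors of distinct eigenvalues are orthogonal after applying S. In the limit S v is
  -- orthogonal to itself, against ‖v‖ = 1.
  have horth : ∀ j, ⟪S (u j), S v⟫_ℂ = 0 := fun j ↦ by
    have h1 : ⟪pencil S A E (u j), v⟫_ℂ = 0 := by
      rw [h.inner_pencil, Complex.conj_ofReal, hBv, inner_zero_right]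
    rw [hdiff, inner_smul_left, Complex.conj_ofReal, h.symm_left] at h1
    exact (mul_eq_zero.1 h1).resolve_left
      (Complex.ofReal_ne_zero.2 (sub_ne_zero.2 (hx1 j)))
  have hlim : Tendsto (fun j ↦ ⟪S (u (φ j)), S v⟫_ℂ) atTop (𝓝 ⟪S v, S v⟫_ℂ) :=
    (((S.continuous.inner continuous_const).tendsto v)).comp hv
  have h0 : ⟪S v, S v⟫_ℂ = 0 := by
    refine tendsto_nhds_unique hlim ?_
    simp only [horth]
    exact tendsto_const_nhds
  have hv0 : v = 0 := h.injective (by simpa using h0)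
  have hv1 : ‖v‖ = 1 := by
    refine tendsto_nhds_unique hv.norm ?_
    simp only [hu1]
    exact tendsto_const_nhds
  simp [hv0] at hv1

/-- Every bounded sequence in the kernel has a convergent subsequence, so the unit ball of the
kernel is compact and Riesz's theorem applies. -/
theorem finiteDimensional_ker_pencil [TopologicalSpace.SeparableSpace H] (h : Represents T S A)
    (hK : IsWeakStrongContinuous K)
    (hm : ∀ E < m, ∃ δ > 0, ∀ u, δ * ‖u‖ ^ 2 ≤ (⟪u, A u + K u⟫_ℂ).re - E * ‖S u‖ ^ 2)
    {E : ℝ} (hE : E < m) :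
    FiniteDimensional ℂ (LinearMap.ker (pencil S A E : H →ₗ[ℂ] H)) := by
  set N := LinearMap.ker (pencil S A E : H →ₗ[ℂ] H)
  have hNc : IsClosed (N : Set H) := (pencil S A E).isClosed_ker
  refine FiniteDimensional.of_isCompact_closedBall₀ ℂ one_pos ?_
  rw [isCompact_iff_isSeqCompact]
  intro u hu
  have hu' : ∀ j, ‖(u j : H)‖ ≤ 1 := fun j ↦ by simpa using hu j
  have hB : ∀ j, pencil S A E (u j : H) = 0 := fun j ↦ (u j).2
  obtain ⟨v, φ, hφ, hv⟩ := h.exists_tendsto_of_pencil hK hm hE hu'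
    (by simp only [hB]; exact tendsto_const_nhds)
  have hvN : v ∈ N := hNc.mem_of_tendsto hv (Eventually.of_forall fun j ↦ (u (φ j)).2)
  refine ⟨⟨v, hvN⟩, ?_, φ, hφ, ?_⟩
  · rw [mem_closedBall_zero_iff]
    exact le_of_tendsto hv.norm (Eventually.of_forall fun j ↦ hu' _)
  · rw [tendsto_subtype_rng]
    exact hv

theorem mem_discreteSpectrum [TopologicalSpace.SeparableSpace H] (h : Represents T S A)
    (hK : IsWeakStrongContinuous K)
    (hm : ∀ E < m, ∃ δ > 0, ∀ u, δ * ‖u‖ ^ 2 ≤ (⟪u, A u + K u⟫_ℂ).re - E * ‖S u‖ ^ 2)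
    {E : ℝ} (hE : E < m) (hs : (E : ℂ) ∈ spectrum T) : (E : ℂ) ∈ discreteSpectrum T := by
  have hdom : ∀ x : T.domain, ∃ u, S u = x ∧ A u = S (T x) := fun x ↦
    (h.mem_graph _ _).1 (T.mem_graph x)
  refine ⟨hs, h.exists_isolated hK hm hE hs, ?_, ?_⟩
  · obtain ⟨u, hu1, hu2⟩ := h.exists_ne_zero_of_mem_spectrum hK hm hE hs
    have hg : (S u, (E : ℂ) • S u) ∈ T.graph := (h.mem_graph _ _).2 ⟨u, rfl, by
      rw [map_smul]
      rwa [pencil_apply, sub_eq_zero] at hu2⟩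
    obtain ⟨x, hx1, hx2⟩ := (LinearPMap.mem_graph_iff _).1 hg
    intro hbot
    have hx : x ∈ eigenspace T E := by
      change T x - (E : ℂ) • (x : H) = 0
      rw [hx2, hx1]
      exact sub_self _
    rw [hbot, Submodule.mem_bot] at hx
    rw [hx] at hx1
    have : u = 0 := h.injective (by rw [map_zero]; exact hx1.symm)
    simp [this] at hu1
  · have := h.finiteDimensional_ker_pencil hK hm hE
    set N := LinearMap.ker (pencil S A E : H →ₗ[ℂ] H)
    have : FiniteDimensional ℂ (N.map (S : H →ₗ[ℂ] H)) := inferInstance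
    have hle : (eigenspace T E).map T.domain.subtype ≤ N.map (S : H →ₗ[ℂ] H) := by
      rintro _ ⟨x, hx, rfl⟩
      have hx' : T x - (E : ℂ) • (x : H) = 0 := hx
      obtain ⟨u, hu1, hu2⟩ := hdom x
      refine ⟨u, ?_, hu1⟩
      change pencil S A E u = 0
      rw [pencil_apply, hu2, hu1, ← map_smul, ← map_sub, hx', map_zero]
    have hfin : FiniteDimensional ℂ ((eigenspace T E).map T.domain.subtype) :=
      Submodule.finiteDimensional_of_le hle
    exact Module.Finite.equiv
      (Submodule.equivMapOfInjective _ T.domain.injective_subtype (eigenspace T E)).symm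

/-- Weyl's theorem: if `A + K` has singular sequences at all points of `[m, ∞)` and is coercive
below `m`, then the essential spectrum of the operator represented by `A` is `[m, ∞)`. -/
theorem essentialSpectrum_eq [TopologicalSpace.SeparableSpace H] (h : Represents T S A)
    (hK : IsWeakStrongContinuous K)
    (hm : ∀ E < m, ∃ δ > 0, ∀ u, δ * ‖u‖ ^ 2 ≤ (⟪u, A u + K u⟫_ℂ).re - E * ‖S u‖ ^ 2)
    (hW : ∀ E ≥ m, ∃ u : ℕ → H, (∀ j, ‖u j‖ = 1) ∧
      (∀ w, Tendsto (fun j ↦ ⟪w, u j⟫_ℂ) atTop (𝓝 0)) ∧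
      Tendsto (fun j ↦ pencil S (A + K) E (u j)) atTop (𝓝 0)) :
    essentialSpectrum T = Complex.ofReal '' Set.Ici m := by
  have hsp : ∀ E : ℝ, m ≤ E → (E : ℂ) ∈ spectrum T := by
    intro E hE
    obtain ⟨u, hu1, hu2, hu3⟩ := hW E hE
    refine h.mem_spectrum_of_seq hu1 ?_
    -- K is negligible along a weakly null sequence, so the singular sequence of A + K also serves
    -- A.
    have := hu3.sub (hK u 1 (fun j ↦ (hu1 j).le) hu2)
    rw [sub_zero] at this
    refine this.congr fun j ↦ ?_
    simp only [pencil_apply, add_apply]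
    abel
  refine Set.Subset.antisymm ?_ ?_
  · rintro z ⟨hz, hzd⟩
    have hz' : z = (z.re : ℂ) := Complex.ext rfl (by simp [h.im_eq_zero hz])
    refine ⟨z.re, ?_, hz'.symm⟩
    by_contra hlt
    rw [Set.mem_Ici, not_le] at hlt
    rw [hz'] at hz hzd
    exact hzd (h.mem_discreteSpectrum hK hm hlt hz)
  · rintro _ ⟨E, hE, rfl⟩
    refine ⟨hsp E hE, ?_⟩
    rintro ⟨-, ⟨ε, hε, hball⟩, -⟩
    -- The whole half-line from `m` is in the spectrum, so none of its points is isolated.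
    have hmem : ((E + ε / 2 : ℝ) : ℂ) ∈ spectrum T ∩ Metric.ball (E : ℂ) ε := by
      refine ⟨hsp _ (by rw [Set.mem_Ici] at hE; linarith), ?_⟩
      rw [Metric.mem_ball, Complex.dist_eq, ← Complex.ofReal_sub, Complex.norm_real,
        Real.norm_eq_abs, add_sub_cancel_left, abs_of_pos (by positivity)]
      linarith
    rw [hball, Set.mem_singleton_iff, Complex.ofReal_inj] at hmem
    linarith

end Represents

end CompactPerturbation

/-! ### Weighted operators and the inverse Fourier transform in `L²` -/

section WeightedOperators

open Filter Topology

variable {n : ℕ}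

theorem lintegral_enorm_sq (f : L2 n) : ∫⁻ x, ‖f x‖ₑ ^ 2 = ‖f‖ₑ ^ 2 := by
  rw [Lp.enorm_def, eLpNorm_eq_lintegral_rpow_enorm_toReal (by norm_num) (by norm_num)]
  simp only [ENNReal.toReal_ofNat, ENNReal.rpow_ofNat]
  rw [← ENNReal.rpow_natCast, ← ENNReal.rpow_mul]
  norm_num

theorem memLp_two_of_lintegral_lt_top {f : EuclideanSpace ℝ (Fin n) → ℂ}
    (hf : AEStronglyMeasurable f) (h : ∫⁻ x, ‖f x‖ₑ ^ 2 < ∞) : MemLp f 2 := by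
  refine ⟨hf, ?_⟩
  rw [eLpNorm_lt_top_iff_lintegral_rpow_enorm_lt_top (by norm_num) (by norm_num)]
  simpa using h

theorem enorm_toLp_sq {f : EuclideanSpace ℝ (Fin n) → ℂ} (hf : MemLp f 2) :
    ‖(hf.toLp f : L2 n)‖ₑ ^ 2 = ∫⁻ x, ‖f x‖ₑ ^ 2 := by
  rw [← lintegral_enorm_sq]
  refine lintegral_congr_ae ?_
  filter_upwards [hf.coeFn_toLp] with x hx
  rw [hx]

theorem norm_le_of_enorm_sq_le {E F : Type*} [NormedAddCommGroup E] [NormedAddCommGroup F]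
    {x : E} {y : F} {C : NNReal} (h : ‖x‖ₑ ^ 2 ≤ C * ‖y‖ₑ ^ 2) : ‖x‖ ≤ √C * ‖y‖ := by
  have h' : ‖x‖₊ ^ 2 ≤ C * ‖y‖₊ ^ 2 := by
    simp only [enorm_eq_nnnorm] at h
    exact_mod_cast h
  have h2 : ‖x‖ ^ 2 ≤ C * ‖y‖ ^ 2 := by exact_mod_cast h'
  rw [← Real.sqrt_sq (norm_nonneg x), ← Real.sqrt_sq (norm_nonneg y), ← Real.sqrt_mul C.coe_nonneg]
  exact Real.sqrt_le_sqrt h2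

/-- The weight `w` is bounded relative to the operator `S` on `L²`. -/
structure IsRelBounded (S : L2 n →L[ℂ] L2 n) (w : EuclideanSpace ℝ (Fin n) → ℂ) : Prop where
  aestronglyMeasurable : AEStronglyMeasurable w
  bound : ∃ C : NNReal, ∀ u, ∫⁻ x, ‖w x * (S u) x‖ₑ ^ 2 ≤ C * ‖u‖ₑ ^ 2

theorem IsRelBounded.memLp {S : L2 n →L[ℂ] L2 n} {w : EuclideanSpace ℝ (Fin n) → ℂ}
    (h : IsRelBounded S w) (u : L2 n) : MemLp (fun x ↦ w x * (S u) x) 2 := by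
  obtain ⟨C, hC⟩ := h.bound
  refine memLp_two_of_lintegral_lt_top
    (h.aestronglyMeasurable.mul (Lp.aestronglyMeasurable _)) ((hC u).trans_lt ?_)
  exact ENNReal.mul_lt_top ENNReal.coe_lt_top (by simp)

/-- The bounded operator `u ↦ w · S u`. -/
noncomputable def weighted {S : L2 n →L[ℂ] L2 n} {w : EuclideanSpace ℝ (Fin n) → ℂ}
    (h : IsRelBounded S w) : L2 n →L[ℂ] L2 n :=
  LinearMap.mkContinuousOfExistsBound
    { toFun := fun u ↦ (h.memLp u).toLp _
      map_add' := fun u v ↦ by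
        apply Lp.ext
        filter_upwards [(h.memLp (u + v)).coeFn_toLp, (h.memLp u).coeFn_toLp,
          (h.memLp v).coeFn_toLp, Lp.coeFn_add ((h.memLp u).toLp _) ((h.memLp v).toLp _),
          Lp.coeFn_add (S u) (S v)] with x h1 h2 h3 h4 h5
        rw [h1, h4, Pi.add_apply, h2, h3, map_add, h5, Pi.add_apply, mul_add]
      map_smul' := fun c u ↦ by
        apply Lp.ext
        filter_upwards [(h.memLp (c • u)).coeFn_toLp, (h.memLp u).coeFn_toLp,
          Lp.coeFn_smul c ((h.memLp u).toLp _), Lp.coeFn_smul c (S u)] with x h1 h2 h3 h4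
        rw [h1, RingHom.id_apply, h3, Pi.smul_apply, h2, map_smul, h4, Pi.smul_apply, smul_eq_mul,
          smul_eq_mul]
        ring }
    (by
      obtain ⟨C, hC⟩ := h.bound
      refine ⟨√C, fun u ↦ norm_le_of_enorm_sq_le ?_⟩
      change ‖((h.memLp u).toLp _ : L2 n)‖ₑ ^ 2 ≤ _
      rw [enorm_toLp_sq]
      exact hC u)

theorem coeFn_weighted {S : L2 n →L[ℂ] L2 n} {w : EuclideanSpace ℝ (Fin n) → ℂ}
    (h : IsRelBounded S w) (u : L2 n) : weighted h u =ᵐ[volume] fun x ↦ w x * (S u) x :=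
  (h.memLp u).coeFn_toLp

theorem enorm_weighted_sq {S : L2 n →L[ℂ] L2 n} {w : EuclideanSpace ℝ (Fin n) → ℂ}
    (h : IsRelBounded S w) (u : L2 n) : ‖weighted h u‖ₑ ^ 2 = ∫⁻ x, ‖w x * (S u) x‖ₑ ^ 2 :=
  enorm_toLp_sq (h.memLp u)

theorem isRelBounded_id {w : EuclideanSpace ℝ (Fin n) → ℂ} (hw : AEStronglyMeasurable w)
    {C : ℝ} (hC : ∀ x, ‖w x‖ ≤ C) : IsRelBounded (ContinuousLinearMap.id ℂ (L2 n)) w := by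
  refine ⟨hw, (Real.toNNReal C) ^ 2, fun u ↦ ?_⟩
  rw [ContinuousLinearMap.id_apply, ← lintegral_enorm_sq u, ← lintegral_const_mul' _ _ (by simp)]
  refine lintegral_mono fun x ↦ ?_
  rw [enorm_mul, mul_pow, ENNReal.coe_pow]
  gcongr
  rw [← ofReal_norm]
  exact ENNReal.ofReal_le_ofReal (hC x)

theorem inner_eq_integral (f g : L2 n) : ⟪f, g⟫_ℂ = ∫ x, g x * starRingEnd ℂ (f x) := by
  rw [L2.inner_def]
  rfl

/-- The inverse Fourier transform in `L²` of an integrable function is given by the integral. -/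
theorem coeFn_fourierInv_toLp {h : EuclideanSpace ℝ (Fin n) → ℂ} (h1 : Integrable h)
    (h2 : MemLp h 2) : (𝓕⁻ (h2.toLp h : L2 n) : L2 n) =ᵐ[volume] 𝓕⁻ h := by
  have hcont : Continuous (𝓕⁻ h) :=
    VectorFourier.fourierIntegral_continuous Real.continuous_fourierChar
      continuous_inner.neg h1
  refine ae_eq_of_integral_contDiff_smul_eq
    ((Lp.memLp _).locallyIntegrable (by norm_num)) hcont.locallyIntegrable ?_
  intro g hg hgc
  let G : 𝓢(EuclideanSpace ℝ (Fin n), ℂ) := HasCompactSupport.toSchwartzMap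
    (f := fun x ↦ (g x : ℂ)) (hgc.comp_left Complex.ofReal_zero)
    (Complex.ofRealCLM.contDiff.comp hg)
  have hG : ∀ x, G x = (g x : ℂ) := fun x ↦ rfl
  have e1 : (∫ x, g x • (𝓕⁻ (h2.toLp h : L2 n) : L2 n) x) =
      Lp.toTemperedDistribution (𝓕⁻ (h2.toLp h : L2 n) : L2 n) G := by
    rw [Lp.toTemperedDistribution_apply]
    rfl
  have e2 : Lp.toTemperedDistribution (𝓕⁻ (h2.toLp h : L2 n) : L2 n) G =
      ∫ k, (𝓕⁻ G) k • h k := by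
    rw [← Lp.fourierInv_toTemperedDistribution_eq, TemperedDistribution.fourierInv_apply,
      Lp.toTemperedDistribution_apply]
    refine integral_congr_ae ?_
    filter_upwards [h2.coeFn_toLp] with k hk
    rw [hk]
  -- The Fourier integral can be moved from one factor to the other. Thus the distributional and the
  -- pointwise inverse transform agree on all test functions.
  have e3 : (∫ x, g x • (𝓕⁻ h) x) = ∫ k, (𝓕⁻ G) k • h k := by
    have := VectorFourier.integral_fourierIntegral_smul_eq_flip (f := (G : _ → ℂ)) (g := h)
      (μ := volume) (ν := volume) (L := -innerₗ (EuclideanSpace ℝ (Fin n)))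
      Real.continuous_fourierChar continuous_inner.neg G.integrable h1
    rw [SchwartzMap.fourierInv_coe]
    refine Eq.trans ?_ this.symm
    refine integral_congr_ae (Eventually.of_forall fun x ↦ ?_)
    simp only [hG, Complex.real_smul, smul_eq_mul]
    congr 1
    rw [Real.fourierInv_eq]
    simp [VectorFourier.fourierIntegral, real_inner_comm]
  rw [e1, e2, e3]

end WeightedOperators

/-! ### The inverse of the operator `(-Δ - lam)^{1/4}` -/

section QuarterInverse

open Filter Topology

variable {n : ℕ} {lam : ℝ}

/-- The real-valued symbol `(|2πk|² - lam)^{1/4}`. -/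
noncomputable def realSymbol (n : ℕ) (lam : ℝ) (k : EuclideanSpace ℝ (Fin n)) : ℝ :=
  ((2 * Real.pi * ‖k‖) ^ 2 - lam) ^ (1 / 4 : ℝ)

theorem quarterSymbol_eq (k : EuclideanSpace ℝ (Fin n)) :
    quarterSymbol n lam k = (realSymbol n lam k : ℂ) := rfl

@[fun_prop]
theorem measurable_realSymbol : Measurable (realSymbol n lam) := by
  unfold realSymbol
  fun_prop

theorem realSymbol_pos (hlam : lam < 0) (k : EuclideanSpace ℝ (Fin n)) : 0 < realSymbol n lam k :=
  Real.rpow_pos_of_pos (by nlinarith [sq_nonneg (2 * Real.pi * ‖k‖)]) _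

theorem realSymbol_sq (hlam : lam < 0) (k : EuclideanSpace ℝ (Fin n)) :
    realSymbol n lam k ^ 2 = √((2 * Real.pi * ‖k‖) ^ 2 - lam) := by
  have : 0 ≤ (2 * Real.pi * ‖k‖) ^ 2 - lam := by nlinarith [sq_nonneg (2 * Real.pi * ‖k‖)]
  rw [realSymbol, ← Real.rpow_natCast, ← Real.rpow_mul this, Real.sqrt_eq_rpow]
  norm_num

theorem sqrt_neg_le_realSymbol_sq (hlam : lam < 0) (k : EuclideanSpace ℝ (Fin n)) :
    √(-lam) ≤ realSymbol n lam k ^ 2 := by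
  rw [realSymbol_sq hlam]
  exact Real.sqrt_le_sqrt (by nlinarith [sq_nonneg (2 * Real.pi * ‖k‖)])

theorem norm_le_realSymbol_sq (hlam : lam < 0) (k : EuclideanSpace ℝ (Fin n)) :
    2 * Real.pi * ‖k‖ ≤ realSymbol n lam k ^ 2 := by
  rw [realSymbol_sq hlam]
  exact Real.le_sqrt_of_sq_le (by linarith)

theorem continuous_realSymbol : Continuous (realSymbol n lam) := by
  unfold realSymbol
  refine Continuous.rpow_const (by fun_prop) fun k ↦ Or.inr (by norm_num)

/-- The symbol of `(-Δ - lam)^{-1/4}`. -/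
noncomputable def inverseSymbol (n : ℕ) (lam : ℝ) (k : EuclideanSpace ℝ (Fin n)) : ℂ :=
  ((realSymbol n lam k)⁻¹ : ℝ)

@[fun_prop]
theorem measurable_inverseSymbol : Measurable (inverseSymbol n lam) := by
  unfold inverseSymbol
  fun_prop

theorem quarterSymbol_mul_inverseSymbol (hlam : lam < 0) (k : EuclideanSpace ℝ (Fin n)) :
    quarterSymbol n lam k * inverseSymbol n lam k = 1 := by
  rw [quarterSymbol_eq, inverseSymbol, ← Complex.ofReal_mul,
    mul_inv_cancel₀ (realSymbol_pos hlam k).ne', Complex.ofReal_one]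

theorem norm_inverseSymbol (hlam : lam < 0) (k : EuclideanSpace ℝ (Fin n)) :
    ‖inverseSymbol n lam k‖ = (realSymbol n lam k)⁻¹ := by
  rw [inverseSymbol, Complex.norm_real, Real.norm_of_nonneg]
  exact inv_nonneg.2 (realSymbol_pos hlam k).le

theorem norm_inverseSymbol_sq_le (hlam : lam < 0) (k : EuclideanSpace ℝ (Fin n)) :
    ‖inverseSymbol n lam k‖ ^ 2 ≤ (√(-lam))⁻¹ := by
  rw [norm_inverseSymbol hlam, inv_pow]
  exact inv_anti₀ (Real.sqrt_pos.2 (neg_pos.2 hlam)) (sqrt_neg_le_realSymbol_sq hlam k)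

theorem isRelBounded_inverseSymbol (hlam : lam < 0) :
    IsRelBounded (ContinuousLinearMap.id ℂ (L2 n)) (inverseSymbol n lam) :=
  isRelBounded_id measurable_inverseSymbol.aestronglyMeasurable
    fun k ↦ Real.le_sqrt_of_sq_le (norm_inverseSymbol_sq_le hlam k)

/-- The operator `(-Δ - lam)^{-1/4}` on `L²`. -/
noncomputable def quarterInverse (n : ℕ) {lam : ℝ} (hlam : lam < 0) : L2 n →L[ℂ] L2 n :=
  ((Lp.fourierTransformₗᵢ (EuclideanSpace ℝ (Fin n)) ℂ).symm.toContinuousLinearEquiv :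
      L2 n →L[ℂ] L2 n) ∘L weighted (isRelBounded_inverseSymbol hlam) ∘L
    ((Lp.fourierTransformₗᵢ (EuclideanSpace ℝ (Fin n)) ℂ).toContinuousLinearEquiv :
      L2 n →L[ℂ] L2 n)

theorem quarterInverse_apply (hlam : lam < 0) (u : L2 n) :
    quarterInverse n hlam u = 𝓕⁻ (weighted (isRelBounded_inverseSymbol hlam) (𝓕 u)) := rfl

theorem fourier_quarterInverse (hlam : lam < 0) (u : L2 n) :
    𝓕 (quarterInverse n hlam u) = weighted (isRelBounded_inverseSymbol hlam) (𝓕 u) := by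
  rw [quarterInverse_apply, FourierTransform.fourier_fourierInv_eq]

theorem coeFn_fourier_quarterInverse (hlam : lam < 0) (u : L2 n) :
    (𝓕 (quarterInverse n hlam u) : L2 n) =ᵐ[volume]
      fun k ↦ inverseSymbol n lam k * (𝓕 u : L2 n) k := by
  rw [fourier_quarterInverse]
  exact coeFn_weighted _ _

theorem norm_fourier_L2 (u : L2 n) : ‖(𝓕 u : L2 n)‖ = ‖u‖ := Lp.norm_fourier_eq u

theorem enorm_fourier_L2 (u : L2 n) : ‖(𝓕 u : L2 n)‖ₑ = ‖u‖ₑ := by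
  rw [← ofReal_norm, ← ofReal_norm, norm_fourier_L2]

theorem inner_quarterInverse (hlam : lam < 0) (u v : L2 n) :
    ⟪quarterInverse n hlam u, v⟫_ℂ = ⟪u, quarterInverse n hlam v⟫_ℂ := by
  rw [← Lp.inner_fourier_eq, ← Lp.inner_fourier_eq u, inner_eq_integral, inner_eq_integral]
  refine integral_congr_ae ?_
  filter_upwards [coeFn_fourier_quarterInverse hlam u, coeFn_fourier_quarterInverse hlam v]
    with k h1 h2
  rw [h1, h2, map_mul, inverseSymbol, Complex.conj_ofReal]
  ring

theorem norm_quarterInverse_sq_le (hlam : lam < 0) (u : L2 n) :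
    √(-lam) * ‖quarterInverse n hlam u‖ ^ 2 ≤ ‖u‖ ^ 2 := by
  have hs : 0 < √(-lam) := Real.sqrt_pos.2 (neg_pos.2 hlam)
  have h1 : ‖quarterInverse n hlam u‖ₑ ^ 2 ≤ ((Real.toNNReal (√(-lam))⁻¹ : NNReal) : ℝ≥0∞) *
      ‖u‖ₑ ^ 2 := by
    rw [← enorm_fourier_L2, ← enorm_fourier_L2 u, fourier_quarterInverse, enorm_weighted_sq,
      ← lintegral_enorm_sq (𝓕 u), ← lintegral_const_mul' _ _ (by simp)]
    refine lintegral_mono fun k ↦ ?_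
    rw [enorm_mul, mul_pow, ContinuousLinearMap.id_apply]
    gcongr
    rw [← ofReal_norm, ← ENNReal.ofReal_pow (norm_nonneg _)]
    exact ENNReal.ofReal_le_ofReal (norm_inverseSymbol_sq_le hlam k)
  have h2 := norm_le_of_enorm_sq_le h1
  rw [Real.coe_toNNReal _ (by positivity)] at h2
  have h3 := pow_le_pow_left₀ (norm_nonneg _) h2 2
  rw [mul_pow, Real.sq_sqrt (by positivity), ← div_eq_inv_mul, le_div_iff₀ hs] at h3
  linarith

theorem quarterInverse_mem_sobolevHalf (hlam : lam < 0) (u : L2 n) :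
    quarterInverse n hlam u ∈ sobolevHalf n := by
  rw [mem_sobolevHalf_iff]
  -- This constant gives 1 + |k|² ≤ c (|2πk|² - λ).
  set c : ℝ := 1 + (-lam)⁻¹
  have hc : 0 < c := by
    have := inv_pos.2 (neg_pos.2 hlam)
    positivity
  have hm : Measurable fun k : EuclideanSpace ℝ (Fin n) ↦
      (((1 + ‖k‖ ^ 2) ^ (1 / 4 : ℝ) : ℝ) : ℂ) := by fun_prop
  refine MemLp.of_le_mul (c := c ^ (1 / 4 : ℝ)) (Lp.memLp (𝓕 u : L2 n))
    (hm.aestronglyMeasurable.mul (Lp.aestronglyMeasurable _)) ?_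
  filter_upwards [coeFn_fourier_quarterInverse hlam u] with k hk
  rw [hk, norm_mul, norm_mul, norm_inverseSymbol hlam, Complex.norm_real,
    Real.norm_of_nonneg (by positivity), ← mul_assoc]
  gcongr
  rw [← div_eq_mul_inv, div_le_iff₀ (realSymbol_pos hlam k), realSymbol, ← Real.mul_rpow hc.le
    (by nlinarith [sq_nonneg (2 * Real.pi * ‖k‖)])]
  refine Real.rpow_le_rpow (by positivity) ?_ (by norm_num)
  have hl : (-lam)⁻¹ * (-lam) = 1 := inv_mul_cancel₀ (neg_pos.2 hlam).ne'
  have hl' : 0 < (-lam)⁻¹ := inv_pos.2 (neg_pos.2 hlam)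
  have hpi : 1 ≤ (2 * Real.pi) ^ 2 := by nlinarith [Real.pi_gt_three]
  have h1 : ‖k‖ ^ 2 ≤ (2 * Real.pi * ‖k‖) ^ 2 := by
    rw [mul_pow]
    exact le_mul_of_one_le_left (sq_nonneg _) hpi
  have h2 : 0 ≤ (-lam)⁻¹ * (2 * Real.pi * ‖k‖) ^ 2 := by positivity
  have h3 : c * ((2 * Real.pi * ‖k‖) ^ 2 - lam) = (2 * Real.pi * ‖k‖) ^ 2 - lam +
      (-lam)⁻¹ * (2 * Real.pi * ‖k‖) ^ 2 + (-lam)⁻¹ * (-lam) := by ring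
  rw [h3, hl]
  linarith

theorem coeFn_fourier_quarterPower (φ : sobolevHalf n) :
    (𝓕 (quarterPower n lam φ) : L2 n) =ᵐ[volume]
      fun k ↦ quarterSymbol n lam k * (𝓕 (φ : L2 n) : L2 n) k := by
  have : (𝓕 (quarterPower n lam φ) : L2 n) = (memLp_quarterSymbol_mul lam φ).toLp _ :=
    FourierTransform.fourier_fourierInv_eq _
  rw [this]
  exact (memLp_quarterSymbol_mul lam φ).coeFn_toLp

theorem fourier_injective_L2 {u v : L2 n} (h : (𝓕 u : L2 n) = 𝓕 v) : u = v :=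
  (Lp.fourierTransformₗᵢ (EuclideanSpace ℝ (Fin n)) ℂ).injective h

theorem quarterPower_quarterInverse (hlam : lam < 0) (u : L2 n) (φ : sobolevHalf n)
    (hφ : (φ : L2 n) = quarterInverse n hlam u) : quarterPower n lam φ = u := by
  refine fourier_injective_L2 (Lp.ext ?_)
  have h1 := coeFn_fourier_quarterPower (lam := lam) φ
  rw [hφ] at h1
  filter_upwards [h1, coeFn_fourier_quarterInverse hlam u] with k h1 h2
  rw [h1, h2, ← mul_assoc, quarterSymbol_mul_inverseSymbol hlam, one_mul]

theorem quarterInverse_quarterPower (hlam : lam < 0) (φ : sobolevHalf n) :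
    quarterInverse n hlam (quarterPower n lam φ) = φ := by
  refine fourier_injective_L2 (Lp.ext ?_)
  filter_upwards [coeFn_fourier_quarterPower (lam := lam) φ,
    coeFn_fourier_quarterInverse hlam (quarterPower n lam φ)] with k h1 h2
  rw [h2, h1, ← mul_assoc, mul_comm (inverseSymbol n lam k), quarterSymbol_mul_inverseSymbol hlam,
    one_mul]

theorem quarterInverse_injective (hlam : lam < 0) :
    Function.Injective (quarterInverse n hlam) := by
  intro u v huv
  rw [← quarterPower_quarterInverse hlam u ⟨_, quarterInverse_mem_sobolevHalf hlam u⟩ rfl,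
    quarterPower_quarterInverse hlam v _ huv]

end QuarterInverse

/-! ### Splitting into low and high frequencies -/

section FrequencySplitting

open Filter Topology

variable {n : ℕ} {lam : ℝ}

theorem lintegral_mul_enorm_le (f g : EuclideanSpace ℝ (Fin n) → ℂ) (hf : AEStronglyMeasurable f)
    (hg : AEStronglyMeasurable g) :
    ∫⁻ x, ‖f x‖ₑ * ‖g x‖ₑ ≤
      (∫⁻ x, ‖f x‖ₑ ^ 2) ^ (1 / 2 : ℝ) * (∫⁻ x, ‖g x‖ₑ ^ 2) ^ (1 / 2 : ℝ) := by
  have h := ENNReal.lintegral_mul_le_Lp_mul_Lq volume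
    (Real.HolderConjugate.two_two) hf.enorm hg.enorm
  simpa using h

variable (lam) in
/-- The part of the Fourier transform of `quarterInverse u` supported in `L`. -/
noncomputable def lowFrequency (L : Set (EuclideanSpace ℝ (Fin n))) (u : L2 n) :
    EuclideanSpace ℝ (Fin n) → ℂ :=
  fun k ↦ L.indicator (inverseSymbol n lam) k * (𝓕 u : L2 n) k

theorem memLp_indicator_inverseSymbol {L : Set (EuclideanSpace ℝ (Fin n))} (hL : MeasurableSet L)
    (hfin : ∫⁻ k in L, ‖inverseSymbol n lam k‖ₑ ^ 2 < ∞) :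
    MemLp (L.indicator (inverseSymbol n lam)) 2 := by
  refine memLp_two_of_lintegral_lt_top
    (measurable_inverseSymbol.indicator hL).aestronglyMeasurable (lt_of_eq_of_lt ?_ hfin)
  rw [← lintegral_indicator hL]
  refine lintegral_congr fun k ↦ ?_
  by_cases hk : k ∈ L <;> simp [hk]

theorem integrable_lowFrequency {L : Set (EuclideanSpace ℝ (Fin n))} (hL : MeasurableSet L)
    (hfin : ∫⁻ k in L, ‖inverseSymbol n lam k‖ₑ ^ 2 < ∞) (u : L2 n) :
    Integrable (lowFrequency lam L u) :=
  (memLp_indicator_inverseSymbol hL hfin).integrable_mul (Lp.memLp (𝓕 u : L2 n))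

/-- `quarterInverse u` is the sum of a bounded low frequency part, given by an integral, and a high
frequency part. -/
theorem exists_frequency_splitting (hlam : lam < 0) {L : Set (EuclideanSpace ℝ (Fin n))}
    (hL : MeasurableSet L) (hfin : ∫⁻ k in L, ‖inverseSymbol n lam k‖ₑ ^ 2 < ∞) (u : L2 n) :
    ∃ high : L2 n, (quarterInverse n hlam u =ᵐ[volume]
        fun x ↦ (𝓕⁻ (lowFrequency lam L u)) x + high x) ∧
      ‖high‖ₑ ^ 2 = ∫⁻ k in Lᶜ, ‖inverseSymbol n lam k‖ₑ ^ 2 * ‖(𝓕 u : L2 n) k‖ₑ ^ 2 := by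
  set h := weighted (isRelBounded_inverseSymbol hlam) (𝓕 u : L2 n) with hh
  have hc := coeFn_weighted (isRelBounded_inverseSymbol hlam) (𝓕 u : L2 n)
  have h2low : MemLp (lowFrequency lam L u) 2 := by
    refine ((Lp.memLp h).indicator hL).ae_eq ?_
    filter_upwards [hc] with k hk
    by_cases hkL : k ∈ L
    · simp [lowFrequency, hkL, hh, hk]
    · simp [lowFrequency, hkL]
  have h2high : MemLp (Lᶜ.indicator (h : EuclideanSpace ℝ (Fin n) → ℂ)) 2 :=
    (Lp.memLp h).indicator hL.compl
  have hsum : h = h2low.toLp _ + h2high.toLp _ := by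
    apply Lp.ext
    filter_upwards [hc, h2low.coeFn_toLp, h2high.coeFn_toLp,
      Lp.coeFn_add (h2low.toLp _) (h2high.toLp _)] with k h1 h2 h3 h4
    rw [h4, Pi.add_apply, h2, h3]
    by_cases hkL : k ∈ L
    · simp [lowFrequency, hkL, hh, h1]
    · simp [lowFrequency, hkL]
  refine ⟨𝓕⁻ (h2high.toLp _ : L2 n), ?_, ?_⟩
  · have e : quarterInverse n hlam u =
        (𝓕⁻ (h2low.toLp _ : L2 n) : L2 n) + 𝓕⁻ (h2high.toLp _ : L2 n) := by
      rw [quarterInverse_apply, ← hh]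
      exact (congrArg (fun v : L2 n ↦ (𝓕⁻ v : L2 n)) hsum).trans
        (FourierTransform.fourierInv_add _ _)
    rw [e]
    filter_upwards [Lp.coeFn_add (𝓕⁻ (h2low.toLp _ : L2 n) : L2 n) (𝓕⁻ (h2high.toLp _ : L2 n)),
      coeFn_fourierInv_toLp (integrable_lowFrequency hL hfin u) h2low] with x h1 h2
    rw [h1, Pi.add_apply, h2]
  · have e : ‖(𝓕⁻ (h2high.toLp _ : L2 n) : L2 n)‖ₑ = ‖(h2high.toLp _ : L2 n)‖ₑ := by
      rw [← enorm_fourier_L2, FourierTransform.fourier_fourierInv_eq]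
    rw [e, enorm_toLp_sq, ← lintegral_indicator hL.compl]
    refine lintegral_congr_ae ?_
    filter_upwards [hc] with k hk
    by_cases hkL : k ∈ L
    · simp [hkL]
    · simp [hkL, hh, hk, mul_pow]

theorem enorm_fourierInv_lowFrequency_le {L : Set (EuclideanSpace ℝ (Fin n))}
    (hL : MeasurableSet L) (u : L2 n) (x : EuclideanSpace ℝ (Fin n)) :
    ‖(𝓕⁻ (lowFrequency lam L u)) x‖ₑ ≤
      (∫⁻ k in L, ‖inverseSymbol n lam k‖ₑ ^ 2) ^ (1 / 2 : ℝ) * ‖u‖ₑ := by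
  have h1 : ‖(𝓕⁻ (lowFrequency lam L u)) x‖ₑ ≤ ∫⁻ k, ‖lowFrequency lam L u k‖ₑ := by
    rw [Real.fourierInv_eq]
    refine (enorm_integral_le_lintegral_enorm _).trans (le_of_eq ?_)
    refine lintegral_congr fun k ↦ ?_
    rw [← ofReal_norm, ← ofReal_norm, Circle.norm_smul]
  refine h1.trans ?_
  have h2 := lintegral_mul_enorm_le (L.indicator (inverseSymbol n lam)) (𝓕 u : L2 n)
    (measurable_inverseSymbol.indicator hL).aestronglyMeasurable (Lp.aestronglyMeasurable _)
  simp only [lowFrequency, enorm_mul]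
  refine h2.trans (le_of_eq ?_)
  rw [lintegral_enorm_sq, enorm_fourier_L2]
  congr 1
  · congr 1
    rw [← lintegral_indicator hL]
    refine lintegral_congr fun k ↦ ?_
    by_cases hk : k ∈ L <;> simp [hk]
  · rw [← ENNReal.rpow_natCast, ← ENNReal.rpow_mul]
    norm_num

/-- Distribution function estimate: the low frequency part is below `t / 2`, and Chebyshev's
inequality applies to the high frequency part. -/
theorem meas_lt_quarterInverse_le (hlam : lam < 0) {L : Set (EuclideanSpace ℝ (Fin n))}
    (hL : MeasurableSet L) {u : L2 n} {t : ℝ} (ht : 0 < t)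
    (hlow : (∫⁻ k in L, ‖inverseSymbol n lam k‖ₑ ^ 2) ^ (1 / 2 : ℝ) ≤ ENNReal.ofReal (t / 2))
    (hu : ‖u‖ ≤ 1) :
    volume {x | t < ‖(quarterInverse n hlam u) x‖} ≤ ENNReal.ofReal (4 / t ^ 2) *
      ∫⁻ k in Lᶜ, ‖inverseSymbol n lam k‖ₑ ^ 2 * ‖(𝓕 u : L2 n) k‖ₑ ^ 2 := by
  have hfin : ∫⁻ k in L, ‖inverseSymbol n lam k‖ₑ ^ 2 < ∞ := by
    by_contra hcon
    rw [not_lt, top_le_iff] at hcon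
    rw [hcon] at hlow
    norm_num at hlow
  obtain ⟨high, h1, h2⟩ := exists_frequency_splitting hlam hL hfin u
  rw [← h2, ← lintegral_enorm_sq]
  have hu' : ‖u‖ₑ ≤ 1 := by
    rw [← ofReal_norm, ← ENNReal.ofReal_one]
    exact ENNReal.ofReal_le_ofReal hu
  have hsub : volume {x | t < ‖(quarterInverse n hlam u) x‖} ≤
      volume {x | ENNReal.ofReal (t / 2) ^ 2 ≤ ‖high x‖ₑ ^ 2} := by
    refine measure_mono_ae ?_
    filter_upwards [h1] with x hx
    intro hxt
    change t < ‖(quarterInverse n hlam u) x‖ at hxt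
    change ENNReal.ofReal (t / 2) ^ 2 ≤ ‖high x‖ₑ ^ 2
    have hl : ‖(𝓕⁻ (lowFrequency lam L u)) x‖ ≤ t / 2 := by
      have := (enorm_fourierInv_lowFrequency_le (lam := lam) hL u x).trans (mul_le_mul' hlow hu')
      rw [mul_one, ← ofReal_norm] at this
      exact (ENNReal.ofReal_le_ofReal_iff (by positivity)).1 this
    gcongr
    rw [← ofReal_norm]
    refine ENNReal.ofReal_le_ofReal ?_
    rw [hx] at hxt
    have := norm_add_le ((𝓕⁻ (lowFrequency lam L u)) x) (high x)
    linarith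
  refine hsub.trans ?_
  have h3 := mul_meas_ge_le_lintegral₀ (μ := volume)
    ((Lp.aestronglyMeasurable high).enorm.pow_const 2) (ENNReal.ofReal (t / 2) ^ 2)
  have h4 : ENNReal.ofReal (4 / t ^ 2) * ENNReal.ofReal (t / 2) ^ 2 = 1 := by
    rw [← ENNReal.ofReal_pow (by positivity), ← ENNReal.ofReal_mul (by positivity)]
    rw [show 4 / t ^ 2 * (t / 2) ^ 2 = 1 by field_simp; norm_num, ENNReal.ofReal_one]
  calc _ = ENNReal.ofReal (4 / t ^ 2) * (ENNReal.ofReal (t / 2) ^ 2 *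
        volume {x | ENNReal.ofReal (t / 2) ^ 2 ≤ ‖high x‖ₑ ^ 2}) := by
        rw [← mul_assoc, h4, one_mul]
    _ ≤ _ := by gcongr

end FrequencySplitting

/-! ### The Sobolev embedding of `H^{1/2}` -/

section SobolevEmbedding

variable {n : ℕ} {lam : ℝ}

/-- Polar coordinates reduce this to the integral of r^{n-1-s} over (0, A). -/
theorem lintegral_ball_norm_rpow_neg (hn : 0 < n) {s : ℝ} (hs : s < n) {A : ℝ} (hA : 0 < A) :
    ∫⁻ k in Metric.ball (0 : EuclideanSpace ℝ (Fin n)) A, ENNReal.ofReal (‖k‖ ^ (-s)) =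
      ENNReal.ofReal (n * volume.real (Metric.ball (0 : EuclideanSpace ℝ (Fin n)) 1) *
        (A ^ (n - s) / (n - s))) := by
  have : Nonempty (Fin n) := ⟨⟨0, hn⟩⟩
  have hpow : ∀ y ∈ Set.Ioo 0 A, y ^ (n - 1) • y ^ (-s) = y ^ ((n : ℝ) - 1 - s) := by
    intro y hy
    rw [smul_eq_mul, ← Real.rpow_natCast, ← Real.rpow_add hy.1, Nat.cast_sub hn]
    congr 1
    push_cast
    ring
  have hexp : -1 < (n : ℝ) - 1 - s := by linarith
  have hint : IntegrableOn (fun k : EuclideanSpace ℝ (Fin n) ↦ ‖k‖ ^ (-s)) (Metric.ball 0 A) := by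
    rw [integrableOn_fun_norm_addHaar volume (f := fun y ↦ y ^ (-s)), finrank_euclideanSpace_fin,
      integrableOn_congr_fun hpow measurableSet_Ioo]
    exact (intervalIntegral.integrableOn_Ioo_rpow_iff hA).2 hexp
  rw [← ofReal_integral_eq_lintegral_ofReal hint
    (Filter.Eventually.of_forall fun k ↦ by positivity)]
  congr 1
  have h1 := integral_fun_norm_addHaar (volume : Measure (EuclideanSpace ℝ (Fin n)))
    ((Set.Iio A).indicator fun y ↦ y ^ (-s))
  rw [finrank_euclideanSpace_fin] at h1
  have h2 : (∫ k in Metric.ball (0 : EuclideanSpace ℝ (Fin n)) A, ‖k‖ ^ (-s)) =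
      ∫ k : EuclideanSpace ℝ (Fin n), (Set.Iio A).indicator (fun y ↦ y ^ (-s)) ‖k‖ := by
    rw [← integral_indicator Metric.isOpen_ball.measurableSet]
    refine integral_congr_ae (Filter.Eventually.of_forall fun k ↦ ?_)
    by_cases hk : ‖k‖ < A <;> simp [hk, Set.indicator]
  have h3 : (∫ y in Set.Ioi (0 : ℝ), y ^ (n - 1) • (Set.Iio A).indicator (fun y ↦ y ^ (-s)) y) =
      A ^ (n - s) / (n - s) := by
    have e : ∀ y : ℝ, y ^ (n - 1) • (Set.Iio A).indicator (fun y ↦ y ^ (-s)) y =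
        (Set.Iio A).indicator (fun y ↦ y ^ (n - 1) • y ^ (-s)) y := fun y ↦ by
      by_cases hy : y < A <;> simp [hy]
    simp only [e]
    rw [setIntegral_indicator measurableSet_Iio, Set.Ioi_inter_Iio,
      setIntegral_congr_fun measurableSet_Ioo hpow, ← integral_Ioc_eq_integral_Ioo,
      ← intervalIntegral.integral_of_le hA.le, integral_rpow (Or.inl hexp),
      Real.zero_rpow (by linarith), sub_zero]
    rw [show (n : ℝ) - 1 - s + 1 = n - s by ring]
  rw [h2, h1, h3]
  simp [mul_assoc]

/-- The squared symbol dominates both a positive constant and |k|, hence every power |k|^s in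
between. The freedom in s lets the Sobolev exponent match any admissible p. -/
theorem exists_norm_rpow_le_realSymbol_sq (hlam : lam < 0) {s : ℝ} (hs : 0 ≤ s) (hs1 : s ≤ 1) :
    ∃ c > 0, ∀ k : EuclideanSpace ℝ (Fin n), ‖k‖ ^ s ≤ c * realSymbol n lam k ^ 2 := by
  have hq : 0 < √(-lam) := Real.sqrt_pos.2 (neg_pos.2 hlam)
  refine ⟨(√(-lam))⁻¹ + 1, by positivity, fun k ↦ ?_⟩
  rcases le_total ‖k‖ 1 with hk | hk
  · calc ‖k‖ ^ s ≤ 1 := Real.rpow_le_one (norm_nonneg _) hk hs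
      _ = (√(-lam))⁻¹ * √(-lam) := (inv_mul_cancel₀ hq.ne').symm
      _ ≤ ((√(-lam))⁻¹ + 1) * realSymbol n lam k ^ 2 := by
        gcongr
        · linarith
        · exact sqrt_neg_le_realSymbol_sq hlam k
  · calc ‖k‖ ^ s ≤ ‖k‖ ^ (1 : ℝ) := Real.rpow_le_rpow_of_exponent_le hk hs1
      _ = ‖k‖ := Real.rpow_one _
      _ ≤ 2 * Real.pi * ‖k‖ :=
        le_mul_of_one_le_left (norm_nonneg _) (by nlinarith [Real.pi_gt_three])
      _ ≤ realSymbol n lam k ^ 2 := norm_le_realSymbol_sq hlam k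
      _ ≤ _ := le_mul_of_one_le_left (sq_nonneg _) (by
        have := inv_pos.2 hq
        linarith)

theorem exists_lintegral_ball_inverseSymbol_le (hn : 0 < n) (hlam : lam < 0) {s : ℝ} (hs : 0 ≤ s)
    (hs1 : s ≤ 1) (hsn : s < n) :
    ∃ C > 0, ∀ A > 0, ∫⁻ k in Metric.ball (0 : EuclideanSpace ℝ (Fin n)) A,
      ‖inverseSymbol n lam k‖ₑ ^ 2 ≤ ENNReal.ofReal (C * A ^ (n - s)) := by
  obtain ⟨c, hc, hck⟩ := exists_norm_rpow_le_realSymbol_sq (n := n) hlam hs hs1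
  set B := n * volume.real (Metric.ball (0 : EuclideanSpace ℝ (Fin n)) 1) / (n - s)
  have hd : 0 < n - s := sub_pos.2 hsn
  have hB : 0 ≤ B := by positivity
  refine ⟨c * B + 1, by positivity, fun A hA ↦ ?_⟩
  have : Nonempty (Fin n) := ⟨⟨0, hn⟩⟩
  calc _ ≤ ∫⁻ k in Metric.ball (0 : EuclideanSpace ℝ (Fin n)) A,
        ENNReal.ofReal c * ENNReal.ofReal (‖k‖ ^ (-s)) := by
        refine lintegral_mono_ae (ae_restrict_of_ae ?_)
        filter_upwards [Measure.ae_ne volume (0 : EuclideanSpace ℝ (Fin n))] with k hk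
        have hk' : 0 < ‖k‖ := norm_pos_iff.2 hk
        rw [← ofReal_norm, ← ENNReal.ofReal_pow (norm_nonneg _), ← ENNReal.ofReal_mul hc.le]
        refine ENNReal.ofReal_le_ofReal ?_
        have hp : 0 < realSymbol n lam k ^ 2 := pow_pos (realSymbol_pos hlam k) 2
        rw [norm_inverseSymbol hlam, inv_pow, Real.rpow_neg hk'.le, inv_le_iff_one_le_mul₀ hp,
          mul_right_comm, ← div_eq_mul_inv, one_le_div (Real.rpow_pos_of_pos hk' _)]
        exact hck k
    _ = ENNReal.ofReal (c * (B * A ^ (n - s))) := by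
        rw [lintegral_const_mul' _ _ ENNReal.ofReal_ne_top, lintegral_ball_norm_rpow_neg hn hsn hA,
          ← ENNReal.ofReal_mul hc.le]
        congr 2
        ring
    _ ≤ _ := by
        refine ENNReal.ofReal_le_ofReal ?_
        have : 0 < A ^ (n - s) := Real.rpow_pos_of_pos hA _
        linarith

end SobolevEmbedding

/-! ### The Sobolev inequality by layer cake, and form bounds for L^p potentials. -/

section SobolevInequality

variable {n : ℕ} {lam : ℝ}

theorem lintegral_Ioc_rpow {r : ℝ} (hr : -1 < r) {a : ℝ} (ha : 0 ≤ a) :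
    ∫⁻ t in Set.Ioc 0 a, ENNReal.ofReal (t ^ r) = ENNReal.ofReal (a ^ (r + 1) / (r + 1)) := by
  have hint := (intervalIntegral.intervalIntegrable_rpow' hr : IntervalIntegrable (fun t : ℝ ↦ t ^ r)
    volume 0 a)
  rw [intervalIntegrable_iff_integrableOn_Ioc_of_le ha] at hint
  rw [← ofReal_integral_eq_lintegral_ofReal hint, ← intervalIntegral.integral_of_le ha,
    integral_rpow (Or.inl hr), Real.zero_rpow (by linarith), sub_zero]
  filter_upwards [ae_restrict_mem measurableSet_Ioc] with t ht
  exact Real.rpow_nonneg ht.1.le _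

/-- Sobolev inequality in `H^{1/2}`, on the unit ball: the exponent `q = 2 + 2 s / (n - s)` is
admissible for `0 ≤ s ≤ 1` and `s < n`. -/
theorem exists_lintegral_quarterInverse_rpow_le (hn : 0 < n) (hlam : lam < 0) {s : ℝ} (hs : 0 < s)
    (hs1 : s ≤ 1) (hsn : s < n) {q : ℝ} (hq : q = 2 + 2 * s / (n - s)) :
    ∃ C : NNReal, ∀ u : L2 n, ‖u‖ ≤ 1 →
      ∫⁻ x, ENNReal.ofReal (‖(quarterInverse n hlam u) x‖ ^ q) ≤ C := by
  obtain ⟨C, hC, hball⟩ := exists_lintegral_ball_inverseSymbol_le hn hlam hs.le hs1 hsn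
  obtain ⟨c, hc, hck⟩ := exists_norm_rpow_le_realSymbol_sq (n := n) hlam hs.le hs1
  have hd : 0 < n - s := sub_pos.2 hsn
  set b := (n - s) / 2 with hb
  have hb0 : 0 < b := by positivity
  -- The frequency cutoff at height t is the set where B |k|^b < t. With B = 2√C and 2b = n - s, the
  -- low frequency bound C A^{n-s} on the corresponding ball is exactly (t/2)².
  set B := 2 * √C
  have hB : 0 < B := by positivity
  have hq2 : 0 < q - 2 := by rw [hq, add_sub_cancel_left]; positivity
  have hbq : b * (q - 2) = s := by rw [hq, hb]; field_simp; ring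
  set D := 4 * B ^ (q - 2) * c / (q - 2) with hD
  refine ⟨Real.toNNReal (q * D), fun u hu ↦ ?_⟩
  set τ : EuclideanSpace ℝ (Fin n) → ℝ := fun k ↦ B * ‖k‖ ^ b with hτ
  have hτm : Measurable τ := by fun_prop
  have hτ0 : ∀ k, 0 ≤ τ k := fun k ↦ by positivity
  set g : EuclideanSpace ℝ (Fin n) → ℝ≥0∞ := fun k ↦
    ‖inverseSymbol n lam k‖ₑ ^ 2 * ‖(𝓕 u : L2 n) k‖ₑ ^ 2 with hg
  have hgm : AEMeasurable g := by
    have hm1 : AEMeasurable fun k : EuclideanSpace ℝ (Fin n) ↦ ‖inverseSymbol n lam k‖ₑ ^ 2 :=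
      (measurable_inverseSymbol.enorm.pow_const 2).aemeasurable
    have hm2 : AEMeasurable fun k ↦ ‖(𝓕 u : L2 n) k‖ₑ ^ 2 :=
      (Lp.aestronglyMeasurable _).enorm.pow_const 2
    exact hm1.mul hm2
  have hdist : ∀ t > 0, volume {x | t < ‖(quarterInverse n hlam u) x‖} ≤
      ENNReal.ofReal (4 / t ^ 2) * ∫⁻ k, (Set.Ici t).indicator (fun _ ↦ 1) (τ k) * g k := by
    intro t ht
    set L : Set (EuclideanSpace ℝ (Fin n)) := {k | τ k < t}
    have hL : MeasurableSet L := measurableSet_lt hτm measurable_const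
    set A := (t / B) ^ b⁻¹
    have hA : 0 < A := Real.rpow_pos_of_pos (by positivity) _
    have hLA : L ⊆ Metric.ball 0 A := by
      intro k hk
      change B * ‖k‖ ^ b < t at hk
      rw [mem_ball_zero_iff, ← Real.rpow_lt_rpow_iff (norm_nonneg _) hA.le hb0,
        Real.rpow_inv_rpow (by positivity) hb0.ne', lt_div_iff₀' hB]
      exact hk
    have hAt : C * A ^ (n - s) = (t / 2) ^ 2 := by
      have : A ^ (n - s) = (t / B) ^ 2 := by
        rw [show n - s = b * 2 by rw [hb]; ring, Real.rpow_mul hA.le,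
          Real.rpow_inv_rpow (by positivity) hb0.ne', Real.rpow_ofNat]
      rw [this, div_pow, div_pow, mul_pow, Real.sq_sqrt hC.le]
      field_simp
    have hlow : (∫⁻ k in L, ‖inverseSymbol n lam k‖ₑ ^ 2) ^ (1 / 2 : ℝ) ≤
        ENNReal.ofReal (t / 2) := by
      have h1 := (lintegral_mono_set hLA).trans (hball A hA)
      rw [hAt] at h1
      refine (ENNReal.rpow_le_rpow h1 (by norm_num)).trans (le_of_eq ?_)
      rw [ENNReal.ofReal_rpow_of_nonneg (by positivity) (by norm_num), ← Real.sqrt_eq_rpow,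
        Real.sqrt_sq (by positivity)]
    refine (meas_lt_quarterInverse_le hlam hL ht hlow hu).trans (le_of_eq ?_)
    congr 1
    rw [← lintegral_indicator hL.compl]
    refine lintegral_congr fun k ↦ ?_
    by_cases hk : τ k < t
    · have hk' : k ∈ L := hk
      simp [hk', hk]
    · have hk' : k ∉ L := hk
      simp [hk', not_lt.1 hk, hg]
  rw [lintegral_rpow_eq_lintegral_meas_lt_mul volume
    (Filter.Eventually.of_forall fun x ↦ norm_nonneg _)
    (Lp.aestronglyMeasurable _).norm.aemeasurable (by linarith : 0 < q)]
  -- After exchanging the integrals, each frequency k contributes the integral of 4 t^{q-3} over 0 <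
  -- t ≤ τ(k), a multiple of |k|^{b(q-2)} = |k|^s. The factor ‖`inverseSymbol`‖² absorbs it, and
  -- Plancherel finishes.
  have hmain : ∫⁻ t in Set.Ioi (0 : ℝ), volume {x | t < ‖(quarterInverse n hlam u) x‖} *
      ENNReal.ofReal (t ^ (q - 1)) ≤ ENNReal.ofReal D := by
    calc _ ≤ ∫⁻ t in Set.Ioi (0 : ℝ), ∫⁻ k,
          ENNReal.ofReal (4 * t ^ (q - 3)) * ((Set.Ici t).indicator (fun _ ↦ 1) (τ k) * g k) := by
          refine setLIntegral_mono_ae' measurableSet_Ioi (Filter.Eventually.of_forall ?_)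
          intro t ht
          rw [lintegral_const_mul' _ _ ENNReal.ofReal_ne_top]
          refine (mul_le_mul_left (hdist t ht) _).trans (le_of_eq ?_)
          rw [mul_right_comm, ← ENNReal.ofReal_mul (by positivity)]
          congr 2
          rw [div_mul_eq_mul_div, mul_div_assoc]
          congr 1
          rw [← Real.rpow_natCast, ← Real.rpow_sub ht]
          congr 1
          push_cast
          ring
      _ = ∫⁻ k, ∫⁻ t in Set.Ioi (0 : ℝ),
          ENNReal.ofReal (4 * t ^ (q - 3)) * ((Set.Ici t).indicator (fun _ ↦ 1) (τ k) * g k) := by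
          refine lintegral_lintegral_swap ?_
          have hset : MeasurableSet {z : ℝ × EuclideanSpace ℝ (Fin n) | z.1 ≤ τ z.2} :=
            measurableSet_le measurable_fst (hτm.comp measurable_snd)
          have hm1 : Measurable fun z : ℝ × EuclideanSpace ℝ (Fin n) ↦
              (Set.Ici z.1).indicator (fun _ ↦ (1 : ℝ≥0∞)) (τ z.2) := by
            have hm : Measurable ({z : ℝ × EuclideanSpace ℝ (Fin n) | z.1 ≤ τ z.2}.indicator
                fun _ ↦ (1 : ℝ≥0∞)) := measurable_const.indicator hset
            convert hm using 2 with z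
            simp [Set.indicator]
          have hm2 : Measurable fun z : ℝ × EuclideanSpace ℝ (Fin n) ↦
              ENNReal.ofReal (4 * z.1 ^ (q - 3)) := by fun_prop
          exact hm2.aemeasurable.mul (hm1.aemeasurable.mul hgm.comp_snd)
      _ ≤ ∫⁻ k, ENNReal.ofReal D * ‖(𝓕 u : L2 n) k‖ₑ ^ 2 := by
          refine lintegral_mono fun k ↦ ?_
          have e1 : ∫⁻ t in Set.Ioi (0 : ℝ), ENNReal.ofReal (4 * t ^ (q - 3)) *
              ((Set.Ici t).indicator (fun _ ↦ 1) (τ k) * g k) =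
              ENNReal.ofReal (4 * (τ k ^ (q - 2) / (q - 2))) * g k := by
            have e2 : ∀ t : ℝ, ENNReal.ofReal (4 * t ^ (q - 3)) *
                ((Set.Ici t).indicator (fun _ ↦ 1) (τ k) * g k) =
                ENNReal.ofReal 4 * g k * (Set.Iic (τ k)).indicator
                  (fun t ↦ ENNReal.ofReal (t ^ (q - 3))) t := fun t ↦ by
              rw [ENNReal.ofReal_mul (by norm_num)]
              by_cases ht : t ≤ τ k
              · simp [ht]; ring
              · simp [ht]
            have hgk : ENNReal.ofReal 4 * g k ≠ ∞ := by finiteness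
            simp only [e2]
            rw [lintegral_const_mul' _ _ hgk, setLIntegral_indicator measurableSet_Iic,
              Set.inter_comm, Set.Ioi_inter_Iic, lintegral_Ioc_rpow (by linarith) (hτ0 k),
              show q - 3 + 1 = q - 2 by ring, ENNReal.ofReal_mul (by norm_num)]
            ring
          rw [e1, hg]
          simp only
          rw [← mul_assoc]
          refine mul_le_mul_left ?_ _
          rw [← ofReal_norm, ← ENNReal.ofReal_pow (norm_nonneg _), ← ENNReal.ofReal_mul (by
            have := Real.rpow_nonneg (hτ0 k) (q - 2)
            positivity)]
          refine ENNReal.ofReal_le_ofReal ?_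
          have hτq : τ k ^ (q - 2) = B ^ (q - 2) * ‖k‖ ^ s := by
            rw [hτ, Real.mul_rpow hB.le (by positivity), ← Real.rpow_mul (norm_nonneg _), hbq]
          have hp := realSymbol_pos hlam k
          rw [hτq, norm_inverseSymbol hlam, inv_pow, mul_inv_le_iff₀ (by positivity), hD]
          calc _ = 4 * B ^ (q - 2) / (q - 2) * ‖k‖ ^ s := by ring
            _ ≤ 4 * B ^ (q - 2) / (q - 2) * (c * realSymbol n lam k ^ 2) := by
              gcongr
              exact hck k
            _ = _ := by ring
      _ ≤ ENNReal.ofReal D := by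
          rw [lintegral_const_mul' _ _ ENNReal.ofReal_ne_top, lintegral_enorm_sq, enorm_fourier_L2]
          refine mul_le_of_le_one_right' (pow_le_one₀ zero_le ?_)
          rw [← ofReal_norm, ← ENNReal.ofReal_one]
          exact ENNReal.ofReal_le_ofReal hu
  refine (mul_le_mul_right hmain _).trans (le_of_eq ?_)
  rw [← ENNReal.ofReal_mul (by linarith)]
  rfl

/-- Multiplication by `β ∈ L^p` is form bounded relative to `H^{1/2}` with bound `‖β‖_p`. -/
theorem exists_lintegral_mul_quarterInverse_sq_le (hn : 0 < n) (hlam : lam < 0) {p : ℝ}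
    (hp : 1 < p) (hnp : n ≤ p) :
    ∃ C : NNReal, ∀ β : EuclideanSpace ℝ (Fin n) → ℝ, AEStronglyMeasurable β →
      ∀ u : L2 n, ∫⁻ x, ‖β x‖ₑ * ‖(quarterInverse n hlam u) x‖ₑ ^ 2 ≤
        C * eLpNorm β (ENNReal.ofReal p) * ‖u‖ₑ ^ 2 := by
  have hn' : (0 : ℝ) < n := Nat.cast_pos.2 hn
  have hp0 : 0 < p := by linarith
  have hpq : p.HolderConjugate p.conjExponent := Real.HolderConjugate.conjExponent hp
  set p' := p.conjExponent with hp'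
  have hp'0 : 0 < p' := hpq.symm.pos
  -- The choice s = n/p makes the Sobolev exponent equal to 2p', as Hölder requires. Then s ≤ 1
  -- means n ≤ p, and s < n means p > 1.
  obtain ⟨C, hC⟩ := exists_lintegral_quarterInverse_rpow_le hn hlam (s := n / p)
    (by positivity) ((div_le_one hp0).2 hnp) (div_lt_self hn' hp) (q := 2 * p') (by
      rw [hp', Real.conjExponent]
      have h1 : p - 1 ≠ 0 := by linarith
      have h2 : (n : ℝ) - n / p ≠ 0 := (sub_pos.2 (div_lt_self hn' hp)).ne'
      have h3 : (n : ℝ) - n / p = n * (p - 1) / p := by field_simp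
      rw [h3]
      field_simp
      ring)
  refine ⟨C ^ (1 / p'), fun β hβ u ↦ ?_⟩
  rcases eq_or_ne u 0 with rfl | hu0
  · rw [map_zero]
    refine le_of_eq_of_le ?_ zero_le
    rw [lintegral_eq_zero_iff' (by fun_prop)]
    filter_upwards [Lp.coeFn_zero ℂ 2 (volume : Measure (EuclideanSpace ℝ (Fin n)))] with x hx
    rw [hx]
    simp
  have hu1 : 0 < ‖u‖ := norm_pos_iff.2 hu0
  set v : L2 n := ((‖u‖⁻¹ : ℝ) : ℂ) • u with hv
  have hvn : ‖v‖ ≤ 1 := by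
    rw [hv, norm_smul, Complex.norm_real, norm_inv, norm_norm, inv_mul_cancel₀ hu1.ne']
  have huv : u = (‖u‖ : ℂ) • v := by
    rw [hv, smul_smul, Complex.ofReal_inv, mul_inv_cancel₀ (Complex.ofReal_ne_zero.2 hu1.ne'),
      one_smul]
  have hSv : ∫⁻ x, ‖β x‖ₑ * ‖(quarterInverse n hlam v) x‖ₑ ^ 2 ≤
      eLpNorm β (ENNReal.ofReal p) * (C : ℝ≥0∞) ^ (1 / p') := by
    have h := ENNReal.lintegral_mul_le_Lp_mul_Lq volume hpq hβ.enorm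
      ((Lp.aestronglyMeasurable (quarterInverse n hlam v)).enorm.pow_const 2)
    refine h.trans (mul_le_mul' (le_of_eq ?_) (ENNReal.rpow_le_rpow ?_ (by positivity)))
    · rw [eLpNorm_eq_lintegral_rpow_enorm_toReal (by simpa using hp0) ENNReal.ofReal_ne_top,
        ENNReal.toReal_ofReal hp0.le]
    · refine le_of_eq_of_le (lintegral_congr fun x ↦ ?_) (hC v hvn)
      rw [← ENNReal.ofReal_rpow_of_nonneg (norm_nonneg _) (by positivity), ofReal_norm,
        ENNReal.rpow_mul]
      simp
  have e : ∫⁻ x, ‖β x‖ₑ * ‖(quarterInverse n hlam u) x‖ₑ ^ 2 =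
      ‖u‖ₑ ^ 2 * ∫⁻ x, ‖β x‖ₑ * ‖(quarterInverse n hlam v) x‖ₑ ^ 2 := by
    rw [← lintegral_const_mul' _ _ (by simp)]
    refine lintegral_congr_ae ?_
    have e1 : quarterInverse n hlam u = (‖u‖ : ℂ) • quarterInverse n hlam v := by
      rw [← map_smul, ← huv]
    rw [e1]
    filter_upwards [Lp.coeFn_smul (‖u‖ : ℂ) (quarterInverse n hlam v)] with x hx
    rw [hx, Pi.smul_apply, enorm_smul, mul_pow]
    have : ‖(‖u‖ : ℂ)‖ₑ = ‖u‖ₑ := by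
      rw [← ofReal_norm, ← ofReal_norm, Complex.norm_real, norm_norm]
    rw [this]
    ring
  rw [e, mul_comm, ENNReal.coe_rpow_of_nonneg _ (by positivity)]
  refine mul_le_mul_left (hSv.trans (le_of_eq (mul_comm _ _))) _

end SobolevInequality

/-! ### Relatively compact potentials -/

section Potential

open Filter Topology

variable {n : ℕ} {lam : ℝ}

theorem tendsto_zero_of_le_add_ofReal {a : ℕ → ℝ≥0∞}
    (h : ∀ η : ℝ, 0 < η → ∃ f : ℕ → ℝ≥0∞, Tendsto f atTop (𝓝 0) ∧
      ∀ j, a j ≤ f j + ENNReal.ofReal η) : Tendsto a atTop (𝓝 0) := by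
  rw [ENNReal.tendsto_nhds_zero]
  intro ε hε
  obtain ⟨r, hr0, hr⟩ := ENNReal.lt_iff_exists_nnreal_btwn.1 (ENNReal.half_pos hε.ne')
  obtain ⟨f, hf, haf⟩ := h r (by exact_mod_cast hr0)
  filter_upwards [ENNReal.tendsto_nhds_zero.1 hf _ (ENNReal.half_pos hε.ne')] with j hj
  refine (haf j).trans ?_
  rw [ENNReal.ofReal_coe_nnreal, ← ENNReal.add_halves ε]
  exact add_le_add hj hr.le

theorem enorm_add_sq_le (a b : ℂ) : ‖a + b‖ₑ ^ 2 ≤ 2 * ‖a‖ₑ ^ 2 + 2 * ‖b‖ₑ ^ 2 := by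
  have h := ENNReal.rpow_add_le_mul_rpow_add_rpow ‖a‖ₑ ‖b‖ₑ (p := 2) (by norm_num)
  norm_num at h
  calc ‖a + b‖ₑ ^ 2 ≤ (‖a‖ₑ + ‖b‖ₑ) ^ 2 := by gcongr; exact enorm_add_le _ _
    _ ≤ _ := by rw [← mul_add]; exact h

/-- The low frequency part of a weakly null sequence tends to zero pointwise. -/
theorem tendsto_fourierInv_lowFrequency {L : Set (EuclideanSpace ℝ (Fin n))}
    (hL : MeasurableSet L) (hfin : ∫⁻ k in L, ‖inverseSymbol n lam k‖ₑ ^ 2 < ∞) {u : ℕ → L2 n}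
    (hw : ∀ w, Tendsto (fun j ↦ ⟪w, u j⟫_ℂ) atTop (𝓝 0)) (x : EuclideanSpace ℝ (Fin n)) :
    Tendsto (fun j ↦ (𝓕⁻ (lowFrequency lam L (u j))) x) atTop (𝓝 0) := by
  -- Evaluation of the low frequency part at x is the inner product with a fixed L² vector, whose
  -- Fourier transform is e. Weak convergence therefore gives pointwise convergence.
  set e : EuclideanSpace ℝ (Fin n) → ℂ := fun k ↦
    starRingEnd ℂ ((Real.fourierChar (inner ℝ k x) : ℂ) * L.indicator (inverseSymbol n lam) k)
    with he
  have hem : AEStronglyMeasurable e := by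
    have h1 : Continuous fun k : EuclideanSpace ℝ (Fin n) ↦
        (Real.fourierChar (inner ℝ k x) : ℂ) := by fun_prop
    exact Complex.continuous_conj.comp_aestronglyMeasurable (h1.aestronglyMeasurable.mul
      (measurable_inverseSymbol.indicator hL).aestronglyMeasurable)
  have he2 : MemLp e 2 := by
    refine (memLp_indicator_inverseSymbol (lam := lam) hL hfin).of_le hem
      (Eventually.of_forall fun k ↦ ?_)
    rw [he, RCLike.norm_conj, norm_mul, Circle.norm_coe, one_mul]
  have key : ∀ j, ⟪(𝓕⁻ (he2.toLp e : L2 n) : L2 n), u j⟫_ℂ =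
      (𝓕⁻ (lowFrequency lam L (u j))) x := by
    intro j
    rw [← Lp.inner_fourier_eq, FourierTransform.fourier_fourierInv_eq, inner_eq_integral,
      Real.fourierInv_eq]
    refine integral_congr_ae ?_
    filter_upwards [he2.coeFn_toLp] with k hk
    rw [hk, he, RCLike.conj_conj, lowFrequency, Circle.smul_def, smul_eq_mul]
    ring
  simpa only [key] using hw (𝓕⁻ (he2.toLp e : L2 n))

/-- Rellich's theorem: weakly null sequences in `H^{1/2}` tend to zero in `L²` of sets of finite
measure. -/
theorem tendsto_setLIntegral_quarterInverse (hn : 0 < n) (hlam : lam < 0)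
    {s : Set (EuclideanSpace ℝ (Fin n))} (hs : volume s < ∞) {u : ℕ → L2 n} {C : ℝ}
    (hu : ∀ j, ‖u j‖ ≤ C) (hw : ∀ w, Tendsto (fun j ↦ ⟪w, u j⟫_ℂ) atTop (𝓝 0)) :
    Tendsto (fun j ↦ ∫⁻ x in s, ‖(quarterInverse n hlam (u j)) x‖ₑ ^ 2) atTop (𝓝 0) := by
  obtain ⟨c, hc, hball⟩ := exists_lintegral_ball_inverseSymbol_le hn hlam le_rfl zero_le_one
    (Nat.cast_pos.2 hn)
  have hC0 : 0 ≤ C := (norm_nonneg _).trans (hu 0)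
  have huC : ∀ j, ‖u j‖ₑ ≤ ENNReal.ofReal C := fun j ↦ by
    rw [← ofReal_norm]
    exact ENNReal.ofReal_le_ofReal (hu j)
  refine tendsto_zero_of_le_add_ofReal fun η hη ↦ ?_
  -- For |k| ≥ A the squared inverse symbol is at most 1/(2πA), so twice the high frequency mass is
  -- at most 2C²/(2πA) ≤ η. The summand 1 keeps A positive when C = 0.
  set A := (2 * C ^ 2 + 1) / (2 * Real.pi * η) with hA
  have hA0 : 0 < A := by positivity
  set L : Set (EuclideanSpace ℝ (Fin n)) := Metric.ball 0 A
  have hL : MeasurableSet L := Metric.isOpen_ball.measurableSet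
  have hfin : ∫⁻ k in L, ‖inverseSymbol n lam k‖ₑ ^ 2 < ∞ :=
    (hball A hA0).trans_lt ENNReal.ofReal_lt_top
  choose high hh1 hh2 using fun j ↦ exists_frequency_splitting hlam hL hfin (u j)
  have hhigh : ∀ j, 2 * ‖high j‖ₑ ^ 2 ≤ ENNReal.ofReal η := by
    intro j
    rw [hh2]
    have h1 : ∫⁻ k in Lᶜ, ‖inverseSymbol n lam k‖ₑ ^ 2 * ‖(𝓕 (u j) : L2 n) k‖ₑ ^ 2 ≤
        ∫⁻ k, ENNReal.ofReal (1 / (2 * Real.pi * A)) * ‖(𝓕 (u j) : L2 n) k‖ₑ ^ 2 := by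
      refine (setLIntegral_mono_ae' hL.compl (Eventually.of_forall fun k hk ↦ ?_)).trans
        (setLIntegral_le_lintegral _ _)
      refine mul_le_mul_left ?_ _
      rw [← ofReal_norm, ← ENNReal.ofReal_pow (norm_nonneg _)]
      refine ENNReal.ofReal_le_ofReal ?_
      have hk' : A ≤ ‖k‖ := by simpa [L] using hk
      rw [norm_inverseSymbol hlam, inv_pow, one_div]
      refine inv_anti₀ (by positivity) (le_trans ?_ (norm_le_realSymbol_sq hlam k))
      gcongr
    rw [lintegral_const_mul' _ _ ENNReal.ofReal_ne_top, lintegral_enorm_sq, enorm_fourier_L2] at h1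
    calc _ ≤ 2 * (ENNReal.ofReal (1 / (2 * Real.pi * A)) * ENNReal.ofReal C ^ 2) := by
          gcongr
          refine h1.trans ?_
          gcongr
          exact huC j
      _ = ENNReal.ofReal (2 * (1 / (2 * Real.pi * A) * C ^ 2)) := by
          rw [ENNReal.ofReal_mul (by norm_num), ENNReal.ofReal_mul (by positivity),
            ENNReal.ofReal_pow hC0]
          simp
      _ ≤ ENNReal.ofReal η := by
          refine ENNReal.ofReal_le_ofReal ?_
          have : 2 * (1 / (2 * Real.pi * A) * C ^ 2) = η * (2 * C ^ 2 / (2 * C ^ 2 + 1)) := by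
            rw [hA]; field_simp
          rw [this]
          refine mul_le_of_le_one_right hη.le ?_
          rw [div_le_one (by positivity)]
          linarith
  refine ⟨fun j ↦ 2 * ∫⁻ x in s, ‖(𝓕⁻ (lowFrequency lam L (u j))) x‖ₑ ^ 2, ?_, fun j ↦ ?_⟩
  · have hlim : Tendsto (fun j ↦ ∫⁻ x in s, ‖(𝓕⁻ (lowFrequency lam L (u j))) x‖ₑ ^ 2) atTop
        (𝓝 (∫⁻ _ in s, 0)) := by
      -- The low frequency parts are uniformly bounded, and the set has finite measure, so this
      -- constant is an integrable majorant.
      set b : ℝ≥0∞ := ((∫⁻ k in L, ‖inverseSymbol n lam k‖ₑ ^ 2) ^ (1 / 2 : ℝ) *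
        ENNReal.ofReal C) ^ 2
      have hb : b ≠ ∞ := by
        have : (∫⁻ k in L, ‖inverseSymbol n lam k‖ₑ ^ 2) ^ (1 / 2 : ℝ) ≠ ∞ :=
          ENNReal.rpow_ne_top_of_nonneg (by norm_num) hfin.ne
        finiteness
      refine tendsto_lintegral_of_dominated_convergence' (fun _ ↦ b) (fun j ↦ ?_) (fun j ↦ ?_) ?_
        (Eventually.of_forall fun x ↦ ?_)
      · have : Continuous (𝓕⁻ (lowFrequency lam L (u j))) :=
          VectorFourier.fourierIntegral_continuous Real.continuous_fourierChar
            continuous_inner.neg (integrable_lowFrequency hL hfin _)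
        exact (this.aestronglyMeasurable.enorm.pow_const 2)
      · refine Eventually.of_forall fun x ↦ pow_le_pow_left' ?_ 2
        refine (enorm_fourierInv_lowFrequency_le hL (u j) x).trans ?_
        gcongr
        exact huC j
      · rw [setLIntegral_const]
        exact ENNReal.mul_ne_top hb hs.ne
      · have := (tendsto_fourierInv_lowFrequency hL hfin hw x).enorm
        have h2 := ENNReal.Tendsto.pow (n := 2) this
        simpa using h2
    rw [lintegral_zero] at hlim
    simpa using ENNReal.Tendsto.const_mul hlim (Or.inr (ENNReal.ofNat_ne_top (n := 2)))
  · calc _ ≤ ∫⁻ x in s, (2 * ‖(𝓕⁻ (lowFrequency lam L (u j))) x‖ₑ ^ 2 + 2 * ‖high j x‖ₑ ^ 2) := by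
          refine lintegral_mono_ae (ae_restrict_of_ae ?_)
          filter_upwards [hh1 j] with x hx
          rw [hx]
          exact enorm_add_sq_le _ _
      _ = 2 * (∫⁻ x in s, ‖(𝓕⁻ (lowFrequency lam L (u j))) x‖ₑ ^ 2) +
          2 * ∫⁻ x in s, ‖high j x‖ₑ ^ 2 := by
          rw [lintegral_add_right' _ (by fun_prop),
            lintegral_const_mul' _ _ (by norm_num), lintegral_const_mul' _ _ (by norm_num)]
      _ ≤ 2 * (∫⁻ x in s, ‖(𝓕⁻ (lowFrequency lam L (u j))) x‖ₑ ^ 2) + 2 * ‖high j‖ₑ ^ 2 := by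
          gcongr
          rw [← lintegral_enorm_sq]
          exact setLIntegral_le_lintegral _ _
      _ ≤ _ := by
          gcongr
          exact hhigh j

/-- The potential `V` is, up to a small error in `L^p + L^∞`, bounded and supported in a set of
finite measure. -/
structure IsVanishing (V : EuclideanSpace ℝ (Fin n) → ℝ) (p : ℝ) : Prop where
  aestronglyMeasurable : AEStronglyMeasurable V
  approx : ∀ ε : ℝ, 0 < ε → ∃ (β : EuclideanSpace ℝ (Fin n) → ℝ) (M : NNReal)
    (s : Set (EuclideanSpace ℝ (Fin n))), AEStronglyMeasurable β ∧
      eLpNorm β (ENNReal.ofReal p) ≤ ENNReal.ofReal ε ∧ MeasurableSet s ∧ volume s < ∞ ∧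
      ∀ᵐ x, ‖V x‖ₑ ≤ ‖β x‖ₑ + s.indicator (fun _ ↦ (M : ℝ≥0∞)) x + ENNReal.ofReal ε

/-- Off the set where |α - α₀| > ε, the difference is at most ε. On this set of finite measure, the
large values of the L^p part form a function of small norm, and everything else is bounded. -/
theorem isVanishing_sub {α : EuclideanSpace ℝ (Fin n) → ℝ} {p : ℝ≥0∞} (hp : p ≠ ∞)
    (hα : MemLpAddLinfty α p) {α₀ : ℝ}
    (hdecay : ∀ ε : ℝ, 0 < ε → volume {x | ε < |α x - α₀|} < ∞) :
    IsVanishing (fun x ↦ α x - α₀) p.toReal := by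
  obtain ⟨β, γ, hβ, hγ, rfl⟩ := hα
  refine ⟨(hβ.1.add hγ.1).sub aestronglyMeasurable_const, fun ε hε ↦ ?_⟩
  set β' := hβ.1.mk β
  have hβ' : MemLp β' p := hβ.ae_eq hβ.1.ae_eq_mk
  have hβm : StronglyMeasurable β' := hβ.1.stronglyMeasurable_mk
  -- Truncation height beyond which the L^p part has norm at most ε. This is where p < ∞ enters.
  obtain ⟨M, hM⟩ := hβ'.eLpNorm_indicator_norm_ge_le hβm hε
  set G : NNReal := (eLpNorm γ ∞ volume).toNNReal
  have hG : ∀ᵐ x, ‖γ x‖ₑ ≤ G := by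
    rw [ENNReal.coe_toNNReal hγ.2.ne, eLpNorm_exponent_top]
    exact enorm_ae_le_eLpNormEssSup γ volume
  set T : Set (EuclideanSpace ℝ (Fin n)) := {x | M ≤ ‖β' x‖₊}
  have hT : MeasurableSet T := measurableSet_le measurable_const hβm.norm.measurable
  set s := toMeasurable volume {x | ε < |(β + γ) x - α₀|} with hs
  refine ⟨T.indicator β', M.toNNReal + G + ‖α₀‖₊, s,
    (hβm.indicator hT).aestronglyMeasurable, ?_, measurableSet_toMeasurable _ _, ?_, ?_⟩
  · rwa [ENNReal.ofReal_toReal hp]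
  · rw [hs, measure_toMeasurable]
    exact hdecay ε hε
  · filter_upwards [hG, hβ.1.ae_eq_mk] with x hx1 hx2
    by_cases hxs : x ∈ s
    · rw [Set.indicator_of_mem hxs]
      have hβx : ‖β x‖ₑ ≤ ‖T.indicator β' x‖ₑ + (M.toNNReal : ℝ≥0∞) := by
        rw [hx2]
        by_cases hxT : x ∈ T
        · rw [Set.indicator_of_mem hxT]
          exact le_self_add
        · have : ‖β' x‖ < M := not_le.1 hxT
          refine le_add_left ?_
          rw [← ofReal_norm]
          exact ENNReal.ofReal_le_ofReal this.le
      calc ‖(β + γ) x - α₀‖ₑ ≤ ‖(β + γ) x‖ₑ + ‖α₀‖ₑ := enorm_sub_le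
        _ ≤ ‖β x‖ₑ + ‖γ x‖ₑ + ‖α₀‖ₑ := by gcongr; exact enorm_add_le _ _
        _ ≤ (‖T.indicator β' x‖ₑ + (M.toNNReal : ℝ≥0∞)) + G + ‖α₀‖ₑ := by gcongr
        _ = ‖T.indicator β' x‖ₑ + ((M.toNNReal + G + ‖α₀‖₊ : NNReal) : ℝ≥0∞) := by
          push_cast
          rw [enorm_eq_nnnorm α₀]
          ring
        _ ≤ _ := le_self_add
    · have hle : |(β + γ) x - α₀| ≤ ε := by
        by_contra! hlt
        exact hxs (subset_toMeasurable _ _ hlt)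
      refine le_add_left ?_
      rw [← ofReal_norm]
      exact ENNReal.ofReal_le_ofReal hle

/-- The quadratic form of `|V|` on `H^{1/2}` is bounded by a small multiple of the norm of `H^{1/2}`
and the `L²`-norm over a set of finite measure. -/
theorem IsVanishing.exists_lintegral_le {V : EuclideanSpace ℝ (Fin n) → ℝ} {p : ℝ}
    (hV : IsVanishing V p) (hn : 0 < n) (hlam : lam < 0) (hp : 1 < p) (hnp : n ≤ p) {ε : ℝ}
    (hε : 0 < ε) :
    ∃ (M : NNReal) (s : Set (EuclideanSpace ℝ (Fin n))), volume s < ∞ ∧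
      ∀ u : L2 n, ∫⁻ x, ‖V x‖ₑ * ‖(quarterInverse n hlam u) x‖ₑ ^ 2 ≤
        M * (∫⁻ x in s, ‖(quarterInverse n hlam u) x‖ₑ ^ 2) + ENNReal.ofReal ε * ‖u‖ₑ ^ 2 := by
  obtain ⟨C, hC⟩ := exists_lintegral_mul_quarterInverse_sq_le hn hlam hp hnp
  have hq : 0 < √(-lam) := Real.sqrt_pos.2 (neg_pos.2 hlam)
  -- The L^p error costs C δ and the uniform error δ/√(-λ), since ‖S‖² ≤ 1/√(-λ). Together they make
  -- ε.
  set δ := ε / (C + (√(-lam))⁻¹) with hδ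
  have hδ0 : 0 < δ := by positivity
  obtain ⟨β, M, s, hβ, hβε, hs, hsf, hle⟩ := hV.approx δ hδ0
  refine ⟨M, s, hsf, fun u ↦ ?_⟩
  have hS : ‖quarterInverse n hlam u‖ₑ ^ 2 ≤ ENNReal.ofReal (√(-lam))⁻¹ * ‖u‖ₑ ^ 2 := by
    rw [← ofReal_norm, ← ofReal_norm, ← ENNReal.ofReal_pow (norm_nonneg _),
      ← ENNReal.ofReal_pow (norm_nonneg _), ← ENNReal.ofReal_mul (by positivity)]
    refine ENNReal.ofReal_le_ofReal ?_
    rw [← div_eq_inv_mul, le_div_iff₀' hq]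
    exact norm_quarterInverse_sq_le hlam u
  have hm : AEMeasurable fun x ↦ ‖(quarterInverse n hlam u) x‖ₑ ^ 2 :=
    (Lp.aestronglyMeasurable _).enorm.pow_const 2
  have hm1 : AEMeasurable fun x ↦ ‖β x‖ₑ * ‖(quarterInverse n hlam u) x‖ₑ ^ 2 := hβ.enorm.mul hm
  have hm2 : AEMeasurable fun x ↦ s.indicator (fun _ ↦ (M : ℝ≥0∞)) x *
      ‖(quarterInverse n hlam u) x‖ₑ ^ 2 := (measurable_const.indicator hs).aemeasurable.mul hm
  have e2 : ∫⁻ x, s.indicator (fun _ ↦ (M : ℝ≥0∞)) x * ‖(quarterInverse n hlam u) x‖ₑ ^ 2 =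
      M * ∫⁻ x in s, ‖(quarterInverse n hlam u) x‖ₑ ^ 2 := by
    rw [← lintegral_const_mul' _ _ ENNReal.coe_ne_top, ← lintegral_indicator hs]
    refine lintegral_congr fun x ↦ ?_
    by_cases hx : x ∈ s <;> simp [hx]
  calc _ ≤ ∫⁻ x, (‖β x‖ₑ * ‖(quarterInverse n hlam u) x‖ₑ ^ 2 +
        (s.indicator (fun _ ↦ (M : ℝ≥0∞)) x * ‖(quarterInverse n hlam u) x‖ₑ ^ 2 +
          ENNReal.ofReal δ * ‖(quarterInverse n hlam u) x‖ₑ ^ 2)) := by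
        refine lintegral_mono_ae ?_
        filter_upwards [hle] with x hx
        rw [← add_assoc, ← add_mul, ← add_mul]
        gcongr
    _ = (∫⁻ x, ‖β x‖ₑ * ‖(quarterInverse n hlam u) x‖ₑ ^ 2) +
        (M * (∫⁻ x in s, ‖(quarterInverse n hlam u) x‖ₑ ^ 2) +
          ENNReal.ofReal δ * ‖quarterInverse n hlam u‖ₑ ^ 2) := by
        rw [lintegral_add_left' hm1, lintegral_add_left' hm2, e2,
          lintegral_const_mul' _ _ ENNReal.ofReal_ne_top, lintegral_enorm_sq]
    _ ≤ C * ENNReal.ofReal δ * ‖u‖ₑ ^ 2 +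
        (M * (∫⁻ x in s, ‖(quarterInverse n hlam u) x‖ₑ ^ 2) +
          ENNReal.ofReal δ * (ENNReal.ofReal (√(-lam))⁻¹ * ‖u‖ₑ ^ 2)) := by
        refine add_le_add ((hC β hβ u).trans ?_) ?_
        · gcongr
        · gcongr
    _ = M * (∫⁻ x in s, ‖(quarterInverse n hlam u) x‖ₑ ^ 2) +
        ENNReal.ofReal (C * δ + δ * (√(-lam))⁻¹) * ‖u‖ₑ ^ 2 := by
        rw [ENNReal.ofReal_add (by positivity) (by positivity), ENNReal.ofReal_mul (by positivity),
          ENNReal.ofReal_mul (by positivity), ENNReal.ofReal_coe_nnreal]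
        ring
    _ = _ := by
        have : C * δ + δ * (√(-lam))⁻¹ = ε := by
          rw [hδ]
          have : (C : ℝ) + (√(-lam))⁻¹ ≠ 0 := by positivity
          rw [mul_comm, ← mul_add, div_mul_cancel₀ _ this]
        rw [this]

end Potential

/-! ### The bounded operator of the form -/

section FormRepresentation

open Filter Topology

variable {n : ℕ} {lam : ℝ}

/-- The square root of `|V|`. -/
noncomputable def sqrtWeight (V : EuclideanSpace ℝ (Fin n) → ℝ) (x : EuclideanSpace ℝ (Fin n)) :
    ℂ := (√|V x| : ℝ)

/-- The square root of `|V|` with the sign of `V`. -/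
noncomputable def signWeight (V : EuclideanSpace ℝ (Fin n) → ℝ) (x : EuclideanSpace ℝ (Fin n)) :
    ℂ := (V x / √|V x| : ℝ)

theorem enorm_sqrtWeight_sq (V : EuclideanSpace ℝ (Fin n) → ℝ) (x : EuclideanSpace ℝ (Fin n)) :
    ‖sqrtWeight V x‖ₑ ^ 2 = ‖V x‖ₑ := by
  rw [← ofReal_norm, ← ofReal_norm, ← ENNReal.ofReal_pow (norm_nonneg _), sqrtWeight,
    Complex.norm_real, Real.norm_of_nonneg (Real.sqrt_nonneg _), Real.sq_sqrt (abs_nonneg _),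
    Real.norm_eq_abs]

theorem enorm_signWeight_sq (V : EuclideanSpace ℝ (Fin n) → ℝ) (x : EuclideanSpace ℝ (Fin n)) :
    ‖signWeight V x‖ₑ ^ 2 = ‖V x‖ₑ := by
  rw [← ofReal_norm, ← ofReal_norm, ← ENNReal.ofReal_pow (norm_nonneg _), signWeight,
    Complex.norm_real, norm_div, div_pow, Real.norm_of_nonneg (Real.sqrt_nonneg _),
    Real.sq_sqrt (abs_nonneg _), Real.norm_eq_abs]
  congr 1
  rcases eq_or_ne |V x| 0 with h | h
  · simp [h]
  · field_simp

theorem signWeight_mul_sqrtWeight (V : EuclideanSpace ℝ (Fin n) → ℝ)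
    (x : EuclideanSpace ℝ (Fin n)) : signWeight V x * sqrtWeight V x = V x := by
  rw [signWeight, sqrtWeight, ← Complex.ofReal_mul]
  congr 1
  rcases eq_or_ne (V x) 0 with h | h
  · simp [h]
  · exact div_mul_cancel₀ _ (Real.sqrt_ne_zero'.2 (abs_pos.2 h))

theorem aestronglyMeasurable_sqrtWeight {V : EuclideanSpace ℝ (Fin n) → ℝ}
    (hV : AEStronglyMeasurable V) : AEStronglyMeasurable (sqrtWeight V) := by
  have h := hV.aemeasurable
  unfold sqrtWeight
  exact (Complex.measurable_ofReal.comp_aemeasurable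
    (Real.continuous_sqrt.measurable.comp_aemeasurable h.abs)).aestronglyMeasurable

theorem aestronglyMeasurable_signWeight {V : EuclideanSpace ℝ (Fin n) → ℝ}
    (hV : AEStronglyMeasurable V) : AEStronglyMeasurable (signWeight V) := by
  have h := hV.aemeasurable
  unfold signWeight
  exact (Complex.measurable_ofReal.comp_aemeasurable
    (h.div (Real.continuous_sqrt.measurable.comp_aemeasurable h.abs))).aestronglyMeasurable

theorem lintegral_weight_mul_sq {V : EuclideanSpace ℝ (Fin n) → ℝ}
    {w : EuclideanSpace ℝ (Fin n) → ℂ} (hw : ∀ x, ‖w x‖ₑ ^ 2 = ‖V x‖ₑ) (f : L2 n) :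
    ∫⁻ x, ‖w x * f x‖ₑ ^ 2 = ∫⁻ x, ‖V x‖ₑ * ‖f x‖ₑ ^ 2 := by
  simp only [enorm_mul, mul_pow, hw]

section Potential

variable {S : L2 n →L[ℂ] L2 n} {V : EuclideanSpace ℝ (Fin n) → ℝ}

/-- The bounded operator `K` with `⟪v, K u⟫ = ∫ V (S u) (conj (S v))`. -/
noncomputable def potentialOperator (hX : IsRelBounded S (sqrtWeight V))
    (hY : IsRelBounded S (signWeight V)) : L2 n →L[ℂ] L2 n :=
  -- Only the square root of |V| is bounded relative to S, so V is factored as √|V| times V/√|V|.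
  -- Where V = 0, division by zero gives the value 0.
  ContinuousLinearMap.adjoint (weighted hX) ∘L weighted hY

theorem potential_mul_ae (hX : IsRelBounded S (sqrtWeight V)) (hY : IsRelBounded S (signWeight V))
    (u v : L2 n) : (fun x ↦ weighted hY u x * starRingEnd ℂ (weighted hX v x)) =ᵐ[volume]
      fun x ↦ (V x : ℂ) * (S u) x * starRingEnd ℂ ((S v) x) := by
  filter_upwards [coeFn_weighted hX v, coeFn_weighted hY u] with x h1 h2
  have e : starRingEnd ℂ (sqrtWeight V x) = sqrtWeight V x := Complex.conj_ofReal _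
  rw [h1, h2, map_mul, e, ← signWeight_mul_sqrtWeight]
  ring

theorem integrable_mul_conj (f g : L2 n) : Integrable fun x ↦ f x * starRingEnd ℂ (g x) :=
  (Lp.memLp f).integrable_mul (Lp.memLp g).star

theorem integrable_potential (hX : IsRelBounded S (sqrtWeight V))
    (hY : IsRelBounded S (signWeight V)) (u v : L2 n) :
    Integrable fun x ↦ (V x : ℂ) * (S u) x * starRingEnd ℂ ((S v) x) :=
  (integrable_mul_conj _ _).congr (potential_mul_ae hX hY u v)

theorem inner_potentialOperator (hX : IsRelBounded S (sqrtWeight V))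
    (hY : IsRelBounded S (signWeight V)) (u v : L2 n) :
    ⟪v, potentialOperator hX hY u⟫_ℂ = ∫ x, (V x : ℂ) * (S u) x * starRingEnd ℂ ((S v) x) := by
  rw [potentialOperator, ContinuousLinearMap.comp_apply, ContinuousLinearMap.adjoint_inner_right,
    inner_eq_integral]
  exact integral_congr_ae (potential_mul_ae hX hY u v)

theorem potentialOperator_symm (hX : IsRelBounded S (sqrtWeight V))
    (hY : IsRelBounded S (signWeight V)) (u v : L2 n) :
    ⟪potentialOperator hX hY u, v⟫_ℂ = ⟪u, potentialOperator hX hY v⟫_ℂ := by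
  rw [← inner_conj_symm, inner_potentialOperator, inner_potentialOperator, ← integral_conj]
  congr 1
  ext x
  simp only [map_mul, Complex.conj_ofReal, Complex.conj_conj]
  ring

theorem enorm_weighted_sq_of_weight {w : EuclideanSpace ℝ (Fin n) → ℂ} (h : IsRelBounded S w)
    (hw : ∀ x, ‖w x‖ₑ ^ 2 = ‖V x‖ₑ) (u : L2 n) :
    ‖weighted h u‖ₑ ^ 2 = ∫⁻ x, ‖V x‖ₑ * ‖(S u) x‖ₑ ^ 2 := by
  rw [enorm_weighted_sq, lintegral_weight_mul_sq hw]

theorem re_inner_potentialOperator_le (hX : IsRelBounded S (sqrtWeight V))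
    (hY : IsRelBounded S (signWeight V)) {u : L2 n} {b : ℝ} (hb : 0 ≤ b)
    (hub : ∫⁻ x, ‖V x‖ₑ * ‖(S u) x‖ₑ ^ 2 ≤ ENNReal.ofReal b) :
    (⟪u, potentialOperator hX hY u⟫_ℂ).re ≤ b := by
  have key : ∀ {w : EuclideanSpace ℝ (Fin n) → ℂ} (h : IsRelBounded S w)
      (_ : ∀ x, ‖w x‖ₑ ^ 2 = ‖V x‖ₑ), ‖weighted h u‖ ≤ √b := by
    intro w h hw
    have := (enorm_weighted_sq_of_weight h hw u).trans_le hub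
    rw [← ofReal_norm, ← ENNReal.ofReal_pow (norm_nonneg _), ENNReal.ofReal_le_ofReal_iff hb] at this
    exact Real.le_sqrt_of_sq_le this
  rw [potentialOperator, ContinuousLinearMap.comp_apply, ContinuousLinearMap.adjoint_inner_right]
  refine ((Complex.re_le_norm _).trans (norm_inner_le_norm _ _)).trans ?_
  calc _ ≤ √b * √b := by
        gcongr
        · exact key hX (enorm_sqrtWeight_sq V)
        · exact key hY (enorm_signWeight_sq V)
    _ = b := Real.mul_self_sqrt hb

end Potential

/-- The form bound with ε = 1 suffices here, with the integral over the set enlarged to ‖S u‖². -/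
theorem IsVanishing.isRelBounded {V : EuclideanSpace ℝ (Fin n) → ℝ} {p : ℝ}
    (hV : IsVanishing V p) (hn : 0 < n) (hlam : lam < 0) (hp : 1 < p) (hnp : n ≤ p)
    {w : EuclideanSpace ℝ (Fin n) → ℂ} (hwm : AEStronglyMeasurable w)
    (hw : ∀ x, ‖w x‖ₑ ^ 2 = ‖V x‖ₑ) : IsRelBounded (quarterInverse n hlam) w := by
  refine ⟨hwm, ?_⟩
  obtain ⟨M, s, -, hM⟩ := hV.exists_lintegral_le hn hlam hp hnp one_pos
  refine ⟨M * ‖quarterInverse n hlam‖₊ ^ 2 + 1, fun u ↦ ?_⟩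
  rw [lintegral_weight_mul_sq hw]
  have hS : ‖quarterInverse n hlam u‖ₑ ≤ ‖quarterInverse n hlam‖₊ * ‖u‖ₑ := by
    rw [enorm_eq_nnnorm, enorm_eq_nnnorm]
    exact_mod_cast (quarterInverse n hlam).le_opNNNorm u
  calc _ ≤ M * ‖quarterInverse n hlam u‖ₑ ^ 2 + ENNReal.ofReal 1 * ‖u‖ₑ ^ 2 := by
        refine (hM u).trans ?_
        gcongr
        rw [← lintegral_enorm_sq]
        exact setLIntegral_le_lintegral _ _
    _ ≤ M * (‖quarterInverse n hlam‖₊ * ‖u‖ₑ) ^ 2 + ENNReal.ofReal 1 * ‖u‖ₑ ^ 2 := by gcongr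
    _ = _ := by
        push_cast
        rw [ENNReal.ofReal_one]
        ring

/-- The right factor already maps the sequence to a norm null one: Rellich's theorem handles the set
of finite measure, and the rest is at most ε ‖u‖². The left factor is merely bounded. -/
theorem IsVanishing.isWeakStrongContinuous {V : EuclideanSpace ℝ (Fin n) → ℝ} {p : ℝ}
    (hV : IsVanishing V p) (hn : 0 < n) (hlam : lam < 0) (hp : 1 < p) (hnp : n ≤ p)
    (hX : IsRelBounded (quarterInverse n hlam) (sqrtWeight V))
    (hY : IsRelBounded (quarterInverse n hlam) (signWeight V)) :
    IsWeakStrongContinuous (potentialOperator hX hY) := by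
  intro u C hu hw
  have hC0 : 0 ≤ C := (norm_nonneg _).trans (hu 0)
  have huC : ∀ j, ‖u j‖ₑ ≤ ENNReal.ofReal C := fun j ↦ by
    rw [← ofReal_norm]
    exact ENNReal.ofReal_le_ofReal (hu j)
  have h1 : Tendsto (fun j ↦ ‖weighted hY (u j)‖ₑ ^ 2) atTop (𝓝 0) := by
    simp only [enorm_weighted_sq_of_weight hY (enorm_signWeight_sq V)]
    refine tendsto_zero_of_le_add_ofReal fun η hη ↦ ?_
    obtain ⟨M, s, hs, hM⟩ := hV.exists_lintegral_le hn hlam hp hnp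
      (ε := η / (C ^ 2 + 1)) (by positivity)
    refine ⟨fun j ↦ M * ∫⁻ x in s, ‖(quarterInverse n hlam (u j)) x‖ₑ ^ 2, ?_, fun j ↦ ?_⟩
    · simpa using ENNReal.Tendsto.const_mul
        (tendsto_setLIntegral_quarterInverse hn hlam hs hu hw)
        (Or.inr (ENNReal.coe_ne_top (r := M)))
    · refine (hM (u j)).trans ?_
      gcongr
      calc _ ≤ ENNReal.ofReal (η / (C ^ 2 + 1)) * ENNReal.ofReal C ^ 2 := by
            gcongr
            exact huC j
        _ = ENNReal.ofReal (η * (C ^ 2 / (C ^ 2 + 1))) := by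
            rw [← ENNReal.ofReal_pow hC0, ← ENNReal.ofReal_mul (by positivity)]
            congr 1
            ring
        _ ≤ _ := by
            refine ENNReal.ofReal_le_ofReal (mul_le_of_le_one_right hη.le ?_)
            rw [div_le_one (by positivity)]
            linarith
  have h2 : Tendsto (fun j ↦ weighted hY (u j)) atTop (𝓝 0) := by
    rw [tendsto_zero_iff_norm_tendsto_zero]
    have h3 := (ENNReal.tendsto_toReal ENNReal.zero_ne_top).comp h1
    have h4 := h3.sqrt
    simpa [Function.comp_def, Real.sqrt_sq (norm_nonneg _)] using h4
  have h3 := ((ContinuousLinearMap.adjoint (weighted hX)).continuous.tendsto 0).comp h2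
  rw [map_zero] at h3
  exact h3

/-- The operator `2 - α₀ S² - K`, which represents the form if `K` represents the potential
`α - α₀`. -/
noncomputable def formOperator (S : L2 n →L[ℂ] L2 n) (α₀ : ℝ) (K : L2 n →L[ℂ] L2 n) :
    L2 n →L[ℂ] L2 n :=
  (2 : ℂ) • ContinuousLinearMap.id ℂ (L2 n) - (α₀ : ℂ) • (S ∘L S) - K

theorem formOperator_apply (S : L2 n →L[ℂ] L2 n) (α₀ : ℝ) (K : L2 n →L[ℂ] L2 n) (u : L2 n) :
    formOperator S α₀ K u = (2 : ℂ) • u - (α₀ : ℂ) • S (S u) - K u := rfl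

/-- With φ = S u the kinetic term becomes 2⟪v, u⟫, and α is split as (α - α₀) + α₀. Both pieces are
integrable, which also supplies the convergence required in `operatorGraph`. -/
theorem form_eq_inner (hlam : lam < 0) {α : EuclideanSpace ℝ (Fin n) → ℝ} {α₀ : ℝ}
    (hX : IsRelBounded (quarterInverse n hlam) (sqrtWeight fun x ↦ α x - α₀))
    (hY : IsRelBounded (quarterInverse n hlam) (signWeight fun x ↦ α x - α₀))
    (φ ψ : sobolevHalf n) :
    Integrable (fun x ↦ (α x : ℂ) * (φ : L2 n) x * (starRingEnd ℂ) ((ψ : L2 n) x)) ∧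
      form α lam φ ψ = ⟪quarterPower n lam ψ,
        formOperator (quarterInverse n hlam) α₀ (potentialOperator hX hY)
          (quarterPower n lam φ)⟫_ℂ := by
  have hφ := quarterInverse_quarterPower hlam φ
  have hψ := quarterInverse_quarterPower hlam ψ
  have i1 := integrable_potential hX hY (quarterPower n lam φ) (quarterPower n lam ψ)
  have i2 := (integrable_mul_conj (φ : L2 n) (ψ : L2 n)).const_mul (α₀ : ℂ)
  rw [hφ, hψ] at i1
  have e : ∀ x, (((α x - α₀ : ℝ) : ℂ) * (φ : L2 n) x * (starRingEnd ℂ) ((ψ : L2 n) x)) +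
      (α₀ : ℂ) * ((φ : L2 n) x * (starRingEnd ℂ) ((ψ : L2 n) x)) =
      (α x : ℂ) * (φ : L2 n) x * (starRingEnd ℂ) ((ψ : L2 n) x) := fun x ↦ by
    push_cast
    ring
  refine ⟨(i1.add i2).congr (Eventually.of_forall e), ?_⟩
  have h1 : ⟪quarterPower n lam ψ, quarterInverse n hlam (quarterInverse n hlam
      (quarterPower n lam φ))⟫_ℂ = ∫ x, (φ : L2 n) x * (starRingEnd ℂ) ((ψ : L2 n) x) := by
    rw [← inner_quarterInverse, hφ, hψ, inner_eq_integral]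
  rw [formOperator_apply, inner_sub_right, inner_sub_right, inner_smul_right, inner_smul_right,
    h1, inner_potentialOperator, hφ, hψ, form, sub_sub]
  congr 1
  rw [← integral_const_mul, add_comm, ← integral_add i1 i2]
  exact integral_congr_ae (Eventually.of_forall fun x ↦ (e x).symm)

theorem IsVanishing.represents {α : EuclideanSpace ℝ (Fin n) → ℝ} {α₀ p : ℝ}
    (hV : IsVanishing (fun x ↦ α x - α₀) p) (hn : 0 < n) (hlam : lam < 0) (hp : 1 < p)
    (hnp : n ≤ p) (hX : IsRelBounded (quarterInverse n hlam) (sqrtWeight fun x ↦ α x - α₀))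
    (hY : IsRelBounded (quarterInverse n hlam) (signWeight fun x ↦ α x - α₀)) :
    Represents (relOperator α lam) (quarterInverse n hlam)
      (formOperator (quarterInverse n hlam) α₀ (potentialOperator hX hY)) where
  symm_left := inner_quarterInverse hlam
  symm_right u v := by
    simp only [formOperator_apply, inner_sub_left, inner_sub_right, inner_smul_left,
      inner_smul_right, inner_quarterInverse, potentialOperator_symm, Complex.conj_ofReal,
      Complex.conj_ofNat]
  injective := quarterInverse_injective hlam
  mem_graph x y := by
    rw [relOperator_graph]
    constructor
    · rintro ⟨φ, hφx, hφ⟩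
      refine ⟨quarterPower n lam φ, (quarterInverse_quarterPower hlam φ).trans hφx, ?_⟩
      refine ext_inner_left ℂ fun v ↦ ?_
      have h1 := (form_eq_inner hlam hX hY φ ⟨_, quarterInverse_mem_sobolevHalf hlam v⟩).2
      rw [(hφ _).2, quarterPower_quarterInverse hlam v _ rfl] at h1
      rw [← h1, ← inner_quarterInverse]
    · rintro ⟨u, hux, hu⟩
      refine ⟨⟨_, quarterInverse_mem_sobolevHalf hlam u⟩, hux, fun ψ ↦ ?_⟩
      have h1 := form_eq_inner hlam hX hY ⟨_, quarterInverse_mem_sobolevHalf hlam u⟩ ψ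
      refine ⟨h1.1, ?_⟩
      rw [h1.2, quarterPower_quarterInverse hlam u ⟨_, quarterInverse_mem_sobolevHalf hlam u⟩ rfl, hu,
        ← inner_quarterInverse, quarterInverse_quarterPower]
  coercive := by
    obtain ⟨M, s, -, hM⟩ := hV.exists_lintegral_le hn hlam hp hnp one_pos
    -- The kinetic part is 2‖u‖². The potential with ε = 1 takes away one ‖u‖² and leaves the other.
    refine ⟨|α₀| + M, by positivity, fun u ↦ ?_⟩
    have h1 : (⟪u, potentialOperator hX hY u⟫_ℂ).re ≤
        M * ‖quarterInverse n hlam u‖ ^ 2 + ‖u‖ ^ 2 := by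
      refine re_inner_potentialOperator_le hX hY (by positivity) ((hM u).trans ?_)
      rw [ENNReal.ofReal_add (by positivity) (by positivity), ENNReal.ofReal_mul (by positivity),
        ENNReal.ofReal_pow (norm_nonneg _), ENNReal.ofReal_pow (norm_nonneg _), ofReal_norm,
        ofReal_norm, ENNReal.ofReal_coe_nnreal, ENNReal.ofReal_one, one_mul,
        ← lintegral_enorm_sq (quarterInverse n hlam u)]
      gcongr
      exact Measure.restrict_le_self
    have h2 : (⟪u, formOperator (quarterInverse n hlam) α₀ (potentialOperator hX hY) u⟫_ℂ).re =
        2 * ‖u‖ ^ 2 - α₀ * ‖quarterInverse n hlam u‖ ^ 2 -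
          (⟪u, potentialOperator hX hY u⟫_ℂ).re := by
      rw [formOperator_apply, inner_sub_right, inner_sub_right, inner_smul_right, inner_smul_right,
        ← inner_quarterInverse, inner_self_eq_norm_sq_to_K, inner_self_eq_norm_sq_to_K]
      simp [← Complex.ofReal_pow]
    have h3 : α₀ * ‖quarterInverse n hlam u‖ ^ 2 ≤ |α₀| * ‖quarterInverse n hlam u‖ ^ 2 := by
      gcongr
      exact le_abs_self _
    rw [h2]
    linarith

end FormRepresentation

/-! ### Essential spectrum and bottom of the spectrum -/

section Spectrum

open Filter Topology

variable {n : ℕ} {lam : ℝ}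

theorem pencil_formOperator_add (S K : L2 n →L[ℂ] L2 n) (α₀ E : ℝ) (u : L2 n) :
    pencil S (formOperator S α₀ K + K) E u = (2 : ℂ) • u - ((E + α₀ : ℝ) : ℂ) • S (S u) := by
  rw [pencil_apply, add_apply, formOperator_apply, Complex.ofReal_add, add_smul]
  abel

theorem exists_realSymbol_sq_eq (hn : 0 < n) (hlam : lam < 0) {b : ℝ} (hb : √(-lam) ≤ b) :
    ∃ k : EuclideanSpace ℝ (Fin n), realSymbol n lam k ^ 2 = b := by
  have hb0 : 0 ≤ b := (Real.sqrt_nonneg _).trans hb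
  have h1 : 0 ≤ b ^ 2 + lam := by
    have := (Real.sqrt_le_left hb0).1 hb
    linarith
  refine ⟨EuclideanSpace.single ⟨0, hn⟩ (√(b ^ 2 + lam) / (2 * Real.pi)), ?_⟩
  rw [realSymbol_sq hlam, PiLp.norm_single, Real.norm_of_nonneg (by positivity),
    mul_div_cancel₀ _ (by positivity), Real.sq_sqrt h1, add_sub_cancel_right, Real.sqrt_sq hb0]

/-- Singular sequences of the free operator: in Fourier space, normalized indicator functions of
shrinking balls. -/
theorem exists_weyl_sequence (hn : 0 < n) (hlam : lam < 0) {b : ℝ} (hb : 2 * √(-lam) ≤ b) :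
    ∃ u : ℕ → L2 n, (∀ j, ‖u j‖ = 1) ∧ (∀ w, Tendsto (fun j ↦ ⟪w, u j⟫_ℂ) atTop (𝓝 0)) ∧
      Tendsto (fun j ↦ (2 : ℂ) • u j -
        (b : ℂ) • quarterInverse n hlam (quarterInverse n hlam (u j))) atTop (𝓝 0) := by
  have : Nonempty (Fin n) := ⟨⟨0, hn⟩⟩
  -- At k₀ the symbol 2 - b / √(|2πk|² - λ) vanishes.
  obtain ⟨k₀, hk₀⟩ := exists_realSymbol_sq_eq (n := n) hn hlam (b := b / 2) (by linarith)
  set B : ℕ → Set (EuclideanSpace ℝ (Fin n)) := fun j ↦ Metric.ball k₀ (1 / ((j : ℝ) + 1))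
  have hr : ∀ j : ℕ, 0 < 1 / ((j : ℝ) + 1) := fun j ↦ Nat.one_div_pos_of_nat
  have hBm : ∀ j, MeasurableSet (B j) := fun j ↦ Metric.isOpen_ball.measurableSet
  have hBfin : ∀ j, volume (B j) ≠ ∞ := fun j ↦ measure_ball_lt_top.ne
  have hBpos : ∀ j, 0 < volume.real (B j) := fun j ↦
    ENNReal.toReal_pos (Metric.measure_ball_pos volume k₀ (hr j)).ne' (hBfin j)
  set c : ℕ → ℂ := fun j ↦ ((volume.real (B j) ^ (-(1 / 2) : ℝ) : ℝ) : ℂ)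
  set v : ℕ → L2 n := fun j ↦ indicatorConstLp 2 (hBm j) (hBfin j) (c j)
  have hv1 : ∀ j, ‖v j‖ = 1 := by
    intro j
    rw [norm_indicatorConstLp (by norm_num) (by norm_num), Complex.norm_real,
      Real.norm_of_nonneg (Real.rpow_nonneg (hBpos j).le _), ENNReal.toReal_ofNat,
      ← Real.rpow_add (hBpos j)]
    norm_num
  have hvB : ∀ j, v j =ᵐ[volume] (B j).indicator fun _ ↦ c j := fun j ↦ indicatorConstLp_coeFn
  have hve : ∀ j, ‖v j‖ₑ = 1 := fun j ↦ by rw [← ofReal_norm, hv1, ENNReal.ofReal_one]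
  refine ⟨fun j ↦ 𝓕⁻ (v j), fun j ↦ ?_, fun w ↦ ?_, ?_⟩
  · rw [← norm_fourier_L2, FourierTransform.fourier_fourierInv_eq, hv1]
  · have hvol : Tendsto (fun j ↦ volume (B j)) atTop (𝓝 0) := by
      have h1 := (tendsto_measure_cthickening_of_isClosed (μ := volume)
        (s := ({k₀} : Set (EuclideanSpace ℝ (Fin n)))) ⟨1, one_pos, by
          rw [Metric.cthickening_singleton _ zero_le_one]
          exact measure_closedBall_lt_top.ne⟩ isClosed_singleton).comp
        (tendsto_one_div_add_atTop_nhds_zero_nat (𝕜 := ℝ))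
      rw [measure_singleton] at h1
      refine tendsto_of_tendsto_of_tendsto_of_le_of_le tendsto_const_nhds h1
        (fun j ↦ zero_le) fun j ↦ measure_mono ?_
      rw [Metric.cthickening_singleton _ (hr j).le]
      exact Metric.ball_subset_closedBall
    -- By Cauchy-Schwarz the pairing with w sees only the L² mass of its transform in the shrinking
    -- ball, which vanishes by absolute continuity.
    have h2 : Tendsto (fun j ↦ (∫⁻ k in B j, ‖(𝓕 w : L2 n) k‖ₑ ^ 2) ^ (1 / 2 : ℝ)) atTop
        (𝓝 0) := by
      have h3 := tendsto_setLIntegral_zero (f := fun k ↦ ‖(𝓕 w : L2 n) k‖ₑ ^ 2) (μ := volume)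
        (by rw [lintegral_enorm_sq]; simp) hvol
      have h4 := h3.ennrpow_const (1 / 2 : ℝ)
      rwa [ENNReal.zero_rpow_of_pos (by norm_num)] at h4
    rw [tendsto_zero_iff_enorm_tendsto_zero]
    refine tendsto_of_tendsto_of_tendsto_of_le_of_le tendsto_const_nhds h2
      (fun j ↦ zero_le) fun j ↦ ?_
    change ‖⟪w, (𝓕⁻ (v j) : L2 n)⟫_ℂ‖ₑ ≤ _
    rw [← Lp.inner_fourier_eq, FourierTransform.fourier_fourierInv_eq, inner_eq_integral]
    have hw2 : AEStronglyMeasurable ((B j).indicator (𝓕 w : L2 n)) :=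
      (Lp.aestronglyMeasurable _).indicator (hBm j)
    calc _ ≤ ∫⁻ k, ‖v j k * starRingEnd ℂ ((𝓕 w : L2 n) k)‖ₑ :=
          enorm_integral_le_lintegral_enorm _
      _ = ∫⁻ k, ‖v j k‖ₑ * ‖(B j).indicator (𝓕 w : L2 n) k‖ₑ := by
          refine lintegral_congr_ae ?_
          filter_upwards [hvB j] with k hk
          rw [enorm_mul, hk, RCLike.enorm_conj]
          by_cases hkB : k ∈ B j <;> simp [hkB]
      _ ≤ (∫⁻ k, ‖v j k‖ₑ ^ 2) ^ (1 / 2 : ℝ) *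
          (∫⁻ k, ‖(B j).indicator (𝓕 w : L2 n) k‖ₑ ^ 2) ^ (1 / 2 : ℝ) :=
          lintegral_mul_enorm_le _ _ (Lp.aestronglyMeasurable _) hw2
      _ = _ := by
          rw [lintegral_enorm_sq, hve, one_pow, ENNReal.one_rpow, one_mul,
            ← lintegral_indicator (hBm j)]
          congr 1
          refine lintegral_congr fun k ↦ ?_
          by_cases hkB : k ∈ B j <;> simp [hkB]
  · set g : EuclideanSpace ℝ (Fin n) → ℝ := fun k ↦ 2 - b * (realSymbol n lam k ^ 2)⁻¹ with hg
    have hgc : Continuous g := by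
      refine continuous_const.sub (continuous_const.mul (Continuous.inv₀ ?_ fun k ↦ ?_))
      · exact continuous_realSymbol.pow 2
      · exact (pow_pos (realSymbol_pos hlam k) 2).ne'
    have hb0 : 0 < b := lt_of_lt_of_le (by
      have := Real.sqrt_pos.2 (neg_pos.2 hlam)
      positivity) hb
    have hg0 : g k₀ = 0 := by
      rw [hg]
      simp only
      rw [hk₀]
      field_simp
      ring
    rw [tendsto_zero_iff_norm_tendsto_zero, Metric.tendsto_atTop]
    intro ε hε
    obtain ⟨δ, hδ, hδg⟩ := Metric.continuousAt_iff.1 (hgc.continuousAt (x := k₀)) (ε / 2)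
      (half_pos hε)
    obtain ⟨N, hN⟩ := exists_nat_one_div_lt hδ
    refine ⟨N, fun j hj ↦ ?_⟩
    set f : L2 n := (2 : ℂ) • (𝓕⁻ (v j) : L2 n) -
      (b : ℂ) • quarterInverse n hlam (quarterInverse n hlam (𝓕⁻ (v j) : L2 n)) with hf
    have hfF : (𝓕 f : L2 n) =ᵐ[volume] fun k ↦ (g k : ℂ) * v j k := by
      have e : (𝓕 f : L2 n) = (2 : ℂ) • v j - (b : ℂ) •
          (𝓕 (quarterInverse n hlam (quarterInverse n hlam (𝓕⁻ (v j) : L2 n))) : L2 n) := by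
        have hsub := map_sub (Lp.fourierTransformₗᵢ (EuclideanSpace ℝ (Fin n)) ℂ)
          ((2 : ℂ) • (𝓕⁻ (v j) : L2 n))
          ((b : ℂ) • quarterInverse n hlam (quarterInverse n hlam (𝓕⁻ (v j) : L2 n)))
        refine hsub.trans ?_
        rw [map_smul, map_smul]
        exact congrArg₂ (fun a c : L2 n ↦ (2 : ℂ) • a - (b : ℂ) • c)
          ((Lp.fourierTransformₗᵢ (EuclideanSpace ℝ (Fin n)) ℂ).apply_symm_apply (v j)) rfl
      rw [e]
      have h2 := coeFn_fourier_quarterInverse hlam (𝓕⁻ (v j) : L2 n)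
      rw [FourierTransform.fourier_fourierInv_eq] at h2
      filter_upwards [coeFn_fourier_quarterInverse hlam (quarterInverse n hlam (𝓕⁻ (v j) : L2 n)),
        h2, Lp.coeFn_sub ((2 : ℂ) • v j) ((b : ℂ) •
          (𝓕 (quarterInverse n hlam (quarterInverse n hlam (𝓕⁻ (v j) : L2 n))) : L2 n)),
        Lp.coeFn_smul (2 : ℂ) (v j), Lp.coeFn_smul (b : ℂ)
          (𝓕 (quarterInverse n hlam (quarterInverse n hlam (𝓕⁻ (v j) : L2 n))) : L2 n)]
        with k h1 h2 h3 h4 h5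
      rw [h3, Pi.sub_apply, h4, h5, Pi.smul_apply, Pi.smul_apply, h1, h2, hg, inverseSymbol]
      push_cast
      simp only [smul_eq_mul]
      ring
    -- By continuity the multiplier is below ε/2 on the ball that supports v j.
    have hle : ‖f‖ₑ ^ 2 ≤ ((Real.toNNReal ((ε / 2) ^ 2) : NNReal) : ℝ≥0∞) * ‖v j‖ₑ ^ 2 := by
      rw [← enorm_fourier_L2, ← lintegral_enorm_sq, ← lintegral_enorm_sq (v j),
        ← lintegral_const_mul' _ _ ENNReal.coe_ne_top]
      refine lintegral_mono_ae ?_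
      filter_upwards [hfF, hvB j] with k h1 h2
      rw [h1, enorm_mul, mul_pow]
      by_cases hkB : k ∈ B j
      · gcongr
        rw [← ofReal_norm, ← ENNReal.ofReal_pow (norm_nonneg _)]
        refine ENNReal.ofReal_le_ofReal ?_
        rw [Complex.norm_real]
        have hk : dist k k₀ < δ := by
          refine (Metric.mem_ball.1 hkB).trans_le (le_trans ?_ hN.le)
          gcongr
        have := hδg hk
        rw [hg0, dist_zero_right] at this
        gcongr
      · rw [h2]
        simp [hkB]
    have h3 := norm_le_of_enorm_sq_le hle
    rw [hv1, mul_one, Real.coe_toNNReal _ (by positivity), Real.sqrt_sq (by positivity)] at h3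
    rw [dist_zero_right, norm_norm]
    linarith

theorem exists_formOperator_coercive (hlam : lam < 0) (K : L2 n →L[ℂ] L2 n) {α₀ E : ℝ}
    (hE : E < 2 * √(-lam) - α₀) :
    ∃ δ > 0, ∀ u, δ * ‖u‖ ^ 2 ≤ (⟪u, formOperator (quarterInverse n hlam) α₀ K u + K u⟫_ℂ).re -
      E * ‖quarterInverse n hlam u‖ ^ 2 := by
  have hq : 0 < √(-lam) := Real.sqrt_pos.2 (neg_pos.2 hlam)
  -- The bound ‖S u‖² ≤ ‖u‖²/√(-λ) can only be used with a nonnegative coefficient.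
  set b := max (E + α₀) 0
  have hb : b < 2 * √(-lam) := max_lt (by linarith) (by positivity)
  refine ⟨2 - b / √(-lam), sub_pos.2 ((div_lt_iff₀ hq).2 hb), fun u ↦ ?_⟩
  have h1 : (⟪u, formOperator (quarterInverse n hlam) α₀ K u + K u⟫_ℂ).re =
      2 * ‖u‖ ^ 2 - α₀ * ‖quarterInverse n hlam u‖ ^ 2 := by
    rw [formOperator_apply, sub_add_cancel, inner_sub_right, inner_smul_right, inner_smul_right,
      ← inner_quarterInverse, inner_self_eq_norm_sq_to_K, inner_self_eq_norm_sq_to_K]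
    simp [← Complex.ofReal_pow]
  have h2 := norm_quarterInverse_sq_le hlam u
  have h3 : (E + α₀) * ‖quarterInverse n hlam u‖ ^ 2 ≤ b / √(-lam) * ‖u‖ ^ 2 :=
    calc _ ≤ b * ‖quarterInverse n hlam u‖ ^ 2 := by
          gcongr
          exact le_max_left _ _
      _ = b / √(-lam) * (√(-lam) * ‖quarterInverse n hlam u‖ ^ 2) := by field_simp
      _ ≤ _ := by
          gcongr
  rw [h1]
  linarith

theorem norm_quarterPower_lt {lam₁ lam₂ : ℝ} (h12 : lam₁ < lam₂) (h2 : lam₂ < 0)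
    {φ : sobolevHalf n} (hφ : φ ≠ 0) : ‖quarterPower n lam₂ φ‖ < ‖quarterPower n lam₁ φ‖ := by
  have key : ∀ lam, ‖quarterPower n lam φ‖ₑ ^ 2 =
      ∫⁻ k, ‖quarterSymbol n lam k * (𝓕 (φ : L2 n) : L2 n) k‖ₑ ^ 2 := fun lam ↦ by
    rw [← enorm_fourier_L2, ← lintegral_enorm_sq]
    refine lintegral_congr_ae ?_
    filter_upwards [coeFn_fourier_quarterPower (lam := lam) φ] with k hk
    rw [hk]
  have hsym : ∀ k : EuclideanSpace ℝ (Fin n),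
      ‖quarterSymbol n lam₂ k‖ₑ < ‖quarterSymbol n lam₁ k‖ₑ := fun k ↦ by
    have hp1 := realSymbol_pos (n := n) (h12.trans h2) k
    have hp2 := realSymbol_pos (n := n) h2 k
    rw [quarterSymbol_eq, quarterSymbol_eq, ← ofReal_norm, ← ofReal_norm, Complex.norm_real,
      Complex.norm_real, Real.norm_of_nonneg hp1.le, Real.norm_of_nonneg hp2.le]
    refine (ENNReal.ofReal_lt_ofReal_iff hp1).2 ?_
    refine Real.rpow_lt_rpow ?_ (by linarith) (by norm_num)
    nlinarith [sq_nonneg (2 * Real.pi * ‖k‖)]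
  have hlt : ‖quarterPower n lam₂ φ‖ₑ ^ 2 < ‖quarterPower n lam₁ φ‖ₑ ^ 2 := by
    rw [key, key]
    -- The symbols are strictly ordered at every k, so the integrands are strictly ordered where the
    -- transform of φ is nonzero. That set has positive measure because φ ≠ 0.
    refine lintegral_strict_mono_of_ae_le_of_ae_lt_on
      (s := {k | (𝓕 (φ : L2 n) : L2 n) k ≠ 0})
      ((memLp_quarterSymbol_mul lam₁ φ).1.enorm.pow_const 2) (by rw [← key]; simp)
      (Eventually.of_forall fun k ↦ ?_) (fun h0 ↦ hφ ?_) (Eventually.of_forall fun k hk ↦ ?_)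
    · simp only [enorm_mul]
      gcongr
      exact (hsym k).le
    · have hz : (𝓕 (φ : L2 n) : L2 n) = 0 := by
        apply Lp.ext
        have h0' : ∀ᵐ k, (𝓕 (φ : L2 n) : L2 n) k = 0 := by
          rw [ae_iff]
          exact h0
        filter_upwards [h0', Lp.coeFn_zero ℂ 2 (volume : Measure (EuclideanSpace ℝ (Fin n)))]
          with k h1 h2
        rw [h1, h2]
        rfl
      refine Subtype.ext (norm_eq_zero.1 ?_)
      rw [← norm_fourier_L2, hz, norm_zero]
    · simp only [enorm_mul]
      refine ENNReal.pow_right_strictMono two_ne_zero ?_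
      rw [mul_comm, mul_comm (‖quarterSymbol n lam₁ k‖ₑ)]
      exact ENNReal.mul_lt_mul_right (enorm_ne_zero.2 hk) enorm_ne_top (hsym k)
  rw [← ofReal_norm, ← ofReal_norm] at hlt
  rw [← ENNReal.ofReal_pow (norm_nonneg _), ← ENNReal.ofReal_pow (norm_nonneg _)] at hlt
  exact lt_of_pow_lt_pow_left₀ 2 (norm_nonneg _) (lt_of_not_ge fun hge ↦
    hlt.not_ge (ENNReal.ofReal_le_ofReal hge))

theorem re_form_lt {lam₁ lam₂ : ℝ} (h12 : lam₁ < lam₂) (h2 : lam₂ < 0)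
    (α : EuclideanSpace ℝ (Fin n) → ℝ) {φ : sobolevHalf n} (hφ : φ ≠ 0) :
    (form α lam₂ φ φ).re < (form α lam₁ φ φ).re := by
  have h := pow_lt_pow_left₀ (norm_quarterPower_lt h12 h2 hφ) (norm_nonneg _) two_ne_zero
  unfold form
  rw [inner_self_eq_norm_sq_to_K, inner_self_eq_norm_sq_to_K, Complex.sub_re, Complex.sub_re]
  simp only [Complex.coe_algebraMap, ← Complex.ofReal_pow, ← Complex.ofReal_ofNat,
    ← Complex.ofReal_mul, Complex.ofReal_re]
  linarith

/-- The essential spectrum, the bottom of the spectrum as a lower bound of the form, and the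
existence of a ground state below the essential spectrum. -/
theorem IsVanishing.spectrum_relOperator {α : EuclideanSpace ℝ (Fin n) → ℝ} {α₀ p : ℝ}
    (hV : IsVanishing (fun x ↦ α x - α₀) p) (hn : 0 < n) (hlam : lam < 0) (hp : 1 < p)
    (hnp : n ≤ p) :
    essentialSpectrum (relOperator α lam) =
      Complex.ofReal '' Set.Ici (2 * √(-lam) - α₀) ∧
    IsLeast (realSpectrum α lam) (bottom α lam) ∧
    (∀ φ : sobolevHalf n, bottom α lam * ‖(φ : L2 n)‖ ^ 2 ≤ (form α lam φ φ).re) ∧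
    (bottom α lam < 2 * √(-lam) - α₀ → ∃ φ : sobolevHalf n, φ ≠ 0 ∧
      (form α lam φ φ).re = bottom α lam * ‖(φ : L2 n)‖ ^ 2) := by
  have hX : IsRelBounded (quarterInverse n hlam) (sqrtWeight fun x ↦ α x - α₀) :=
    hV.isRelBounded hn hlam hp hnp (aestronglyMeasurable_sqrtWeight hV.aestronglyMeasurable)
      (enorm_sqrtWeight_sq _)
  have hY : IsRelBounded (quarterInverse n hlam) (signWeight fun x ↦ α x - α₀) :=
    hV.isRelBounded hn hlam hp hnp (aestronglyMeasurable_signWeight hV.aestronglyMeasurable)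
      (enorm_signWeight_sq _)
  have hrep := hV.represents hn hlam hp hnp hX hY
  have hK := hV.isWeakStrongContinuous hn hlam hp hnp hX hY
  have : Fact ((2 : ℝ≥0∞) ≠ ∞) := ⟨by norm_num⟩
  have hsep : TopologicalSpace.SeparableSpace (L2 n) := inferInstance
  have hm : ∀ E < 2 * √(-lam) - α₀, ∃ δ > 0, ∀ u, δ * ‖u‖ ^ 2 ≤
      (⟪u, formOperator (quarterInverse n hlam) α₀ (potentialOperator hX hY) u +
        potentialOperator hX hY u⟫_ℂ).re - E * ‖quarterInverse n hlam u‖ ^ 2 :=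
    fun E hE ↦ exists_formOperator_coercive hlam _ hE
  have hW : ∀ E ≥ 2 * √(-lam) - α₀, ∃ u : ℕ → L2 n, (∀ j, ‖u j‖ = 1) ∧
      (∀ w, Tendsto (fun j ↦ ⟪w, u j⟫_ℂ) atTop (𝓝 0)) ∧
      Tendsto (fun j ↦ pencil (quarterInverse n hlam)
        (formOperator (quarterInverse n hlam) α₀ (potentialOperator hX hY) +
          potentialOperator hX hY) E (u j)) atTop (𝓝 0) := fun E hE ↦ by
    obtain ⟨u, h1, h2, h3⟩ := exists_weyl_sequence hn hlam (b := E + α₀) (by linarith)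
    refine ⟨u, h1, h2, ?_⟩
    simp only [pencil_formOperator_add]
    exact h3
  have hform : ∀ φ : sobolevHalf n, form α lam φ φ = ⟪quarterPower n lam φ,
      formOperator (quarterInverse n hlam) α₀ (potentialOperator hX hY)
        (quarterPower n lam φ)⟫_ℂ := fun φ ↦ (form_eq_inner hlam hX hY φ φ).2
  have hnt : Nontrivial (L2 n) := by
    -- Any vector of a Weyl sequence has norm 1, so the space is nontrivial.
    obtain ⟨u, hu, -⟩ := hW _ le_rfl
    exact ⟨u 0, 0, norm_ne_zero_iff.1 (by rw [hu]; exact one_ne_zero)⟩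
  obtain ⟨E, hE, hEle⟩ := hrep.exists_isLeast_spectrum
  have hEb : bottom α lam = E := hE.csInf_eq
  rw [hEb]
  refine ⟨hrep.essentialSpectrum_eq hK hm hW, hE, fun φ ↦ ?_, fun hlt ↦ ?_⟩
  · rw [hform]
    have := hEle (quarterPower n lam φ)
    rwa [quarterInverse_quarterPower] at this
  · obtain ⟨u, hu1, hu2⟩ := hrep.exists_ne_zero_of_mem_spectrum hK hm hlt hE.1
    refine ⟨⟨_, quarterInverse_mem_sobolevHalf hlam u⟩, fun h0 ↦ ?_, ?_⟩
    · have h0' : quarterInverse n hlam u = 0 := congrArg Subtype.val h0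
      have : u = 0 := quarterInverse_injective hlam (by rw [h0', map_zero])
      simp [this] at hu1
    · rw [hform, quarterPower_quarterInverse hlam u ⟨_, quarterInverse_mem_sobolevHalf hlam u⟩ rfl]
      have h1 := hrep.re_inner_pencil E u
      rw [hu2, inner_zero_right, Complex.zero_re, Complex.ofReal_re] at h1
      change _ = E * ‖quarterInverse n hlam u‖ ^ 2
      linarith

/-- The case distinction is whether the bottom at the smaller parameter is attained by an
eigenfunction below the essential spectrum. If not, comparing the thresholds 2√(-λ) - α₀ is enough.
-/
theorem IsVanishing.strictAntiOn_bottom {α : EuclideanSpace ℝ (Fin n) → ℝ} {α₀ p : ℝ}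
    (hV : IsVanishing (fun x ↦ α x - α₀) p) (hn : 0 < n) (hp : 1 < p) (hnp : n ≤ p) :
    StrictAntiOn (bottom α) (Set.Iio 0) := by
  intro lam₁ h1 lam₂ h2 h12
  rw [Set.mem_Iio] at h1 h2
  obtain ⟨hess1, -, -, hex1⟩ := hV.spectrum_relOperator hn h1 hp hnp
  obtain ⟨hess2, hleast2, hle2, -⟩ := hV.spectrum_relOperator hn h2 hp hnp
  rcases lt_or_ge (bottom α lam₁) (2 * √(-lam₁) - α₀) with hlt | hge
  · obtain ⟨φ, hφ, hφe⟩ := hex1 hlt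
    have hpos : 0 < ‖(φ : L2 n)‖ ^ 2 := by
      have : (φ : L2 n) ≠ 0 := fun h ↦ hφ (Subtype.ext h)
      positivity
    have h3 := (hle2 φ).trans_lt (re_form_lt h12 h2 α hφ)
    rw [hφe] at h3
    exact lt_of_mul_lt_mul_right h3 hpos.le
  · have hmem : 2 * √(-lam₂) - α₀ ∈ realSpectrum α lam₂ := by
      have : ((2 * √(-lam₂) - α₀ : ℝ) : ℂ) ∈ essentialSpectrum (relOperator α lam₂) := by
        rw [hess2]
        exact ⟨_, Set.self_mem_Ici, rfl⟩
      exact this.1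
    have h3 := hleast2.2 hmem
    have h4 : √(-lam₂) < √(-lam₁) := Real.sqrt_lt_sqrt (by linarith) (by linarith)
    linarith

end Spectrum

end RelSchroedinger

theorem proposition3p4 (d : ℕ) (hd : 2 ≤ d) (p : ℝ≥0∞) (hp_top : p ≠ ∞)
    (hp_two : d = 2 → 1 < p) (hp_three : 3 ≤ d → ((d - 1 : ℕ) : ℝ≥0∞) ≤ p)
    (α : EuclideanSpace ℝ (Fin (d - 1)) → ℝ)
    (hα : RelSchroedinger.MemLpAddLinfty α p) (α₀ : ℝ)
    (hdecay : ∀ ε : ℝ, 0 < ε → volume {x | ε < |α x - α₀|} < ∞) :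
    (∀ lam : ℝ, lam < 0 →
      RelSchroedinger.essentialSpectrum (RelSchroedinger.relOperator α lam) =
        Complex.ofReal '' Set.Ici (2 * Real.sqrt (-lam) - α₀)) ∧
    (∀ lam : ℝ, lam < 0 →
      IsGLB (RelSchroedinger.realSpectrum α lam) (RelSchroedinger.bottom α lam)) ∧
    StrictAntiOn (RelSchroedinger.bottom α) (Set.Iio 0) := by
  have hn : 0 < d - 1 := by omega
  have hp1 : 1 < p := by
    rcases hd.eq_or_lt with h | h
    · exact hp_two h.symm
    · refine lt_of_lt_of_le ?_ (hp_three h)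
      exact_mod_cast (by omega : 1 < d - 1)
  have hnp : ((d - 1 : ℕ) : ℝ≥0∞) ≤ p := by
    rcases hd.eq_or_lt with h | h
    · subst h
      simpa using hp1.le
    · exact hp_three h
  have hp1' : 1 < p.toReal := by
    simpa using (ENNReal.toReal_lt_toReal ENNReal.one_ne_top hp_top).2 hp1
  have hnp' : ((d - 1 : ℕ) : ℝ) ≤ p.toReal := by
    rw [← ENNReal.toReal_natCast]
    exact ENNReal.toReal_mono hp_top hnp
  have hV := RelSchroedinger.isVanishing_sub hp_top hα hdecay
  exact ⟨fun lam hlam ↦ (hV.spectrum_relOperator hn hlam hp1' hnp').1,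
    -- The least element makes `bottom` a genuine infimum, not the default value of `sInf` on an
    -- empty or unbounded set.
    fun lam hlam ↦ (hV.spectrum_relOperator hn hlam hp1' hnp').2.1.isGLB,
    hV.strictAntiOn_bottom hn hp1' hnp'⟩
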